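/- **Setting.** Let $X=\{x\}$ be one clock (values in $\mathbb R_{\ge 0}$) and $P$ a finite set of parameters. A parameter valuation is a map $v:P\to\mathbb Q_{\ge0}$. A (parametric) linear term is $\sum_i\alpha_i p_i+c$ with $\alpha_i,c\in\mathbb Z$. A constraint is a finite conjunction of atoms $x\bowtie t$ ($t$ a linear term), $p\bowtie c$ ($p\in P$, $c\in\mathbb Z$), true and false, with $\bowtie\in\{<,\le,=,\ge,>\}$. A 1-clock PTA $\mathcal A$ has a finite set $\Sigma$ of actions, a finite set $L$ of locations, an initial location $\ell_0$, an invariant (a constraint) $I(\ell)$ for each location, and a finite set of edges $(\ell,g,a,R,\ell')$ with a guard $g$ (a constraint), an action $a\in\Sigma$ and a reset set $R\subseteq X$. It is deterministic if for each $\ell\in L$ and $a\in\Sigma$ there is at most one edge from $\ell$ labelled $a$. Let $LT$ be the set of the linear terms used in the guards and invariants of $\mathcal A$ (an atom $p\bowtie c$ uses the terms $p$ and $c$). For a valuation $v$, a configuration of $v(\mathcal A)$ is a pair $(\ell,w)$, $w\in\mathbb R_{\ge0}$; it is valid if $w$ satisfies $I(\ell)$ under $v$. From $(\ell,w)$ one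 can wait $d\ge 0$ time units, $I(\ell)$ being satisfied throughout, and take an edge $(\ell,g,a,R,\ell')$ whose guard holds at $w+d$, reaching the configuration $(\ell',w')$, which must be valid, with $w'=0$ if $R=\{x\}$ and $w'=w+d$ otherwise. Runs start in $(\ell_0,0)$, which must be valid. A run is maximal if it is infinite or ends in a blocked configuration (one without outgoing transition). The trace of a run is the sequence of its locations and actions; its untimed word is the sequence of its actions. Consider either of two conventions for the trace set and the language of $v(\mathcal A)$: (M) the traces, respectively words, of all maximal runs; (F) those of all finite runs, maximal or not. **Algorithm.** A symbolic state is a pair $(\ell,C)$ with $C$ a constraint over $x$ and $P$, up to equivalence. Write $C{\downarrow_P}$ for the projection onto $P$, $C^{\nearrow}$ for time elapsing, $[C]_R$ for reset. The initial symbolic state is $(\ell_0,(x=0\wedge I(\ell_0))^{\nearrow}\wedge I(\ell_0))$. For an edge $e=(\ell,g,a,R,\ell')$ let $E_e(C)=[C\wedge g]_R\wedge I(\ell')$; the successor of $(\ell,C)$ by $e$ is $(\ell',E_e(C)^{\nearrow}\wedge I(\ell'))$, provided that it is nonempty. The algorithm $\mathsf{TPS}(\mathcal A,v)$ explores the symbolic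 states breadth first from the initial one. For each symbolic state $(\ell,C)$, when it is met for the first time: if $v\models C{\downarrow_P}$, it replaces $K_{good}$ by $K_{good}\wedge C{\downarrow_P}$ and goes on to the successors of $(\ell,C)$; otherwise it replaces $K_{bad}$ by $K_{bad}\vee C{\downarrow_P}$ and does not explore $(\ell,C)$ further. When an iteration has no symbolic state to explore further, it returns $K_{good}\wedge\neg K_{bad}$. Initially $K_{good}$ is true and $K_{bad}$ is false. Under convention (F) this is the algorithm; under convention (M) it is supplemented by blocking tests: for the parameter constraint $B$ stating that $(\ell_0,0)$ is valid and blocked, and, for each explored $(\ell,C)$ with $v\models C{\downarrow_P}$ and each edge $e$ from $\ell$ with target $\ell'$, for the parameter constraint $B$ stating that some $(\ell',w)$ with $w$ satisfying $E_e(C)$ is blocked, $K_{good}$ is strengthened by $B$ if $v\models B$ and by $\neg B$ otherwise. Time is measured in symbolic steps: one unit for each symbolic state treated and one for each iteration of the loop. **Theorem.** There is an absolute constant $c$ such that, under either convention, for every deterministic 1-clock PTA $\mathcal A$ and every parameter valuation $v$, the algorithm terminates in time at most $c\cdot|L|\cdot 2^{|LT|(|LT|+1)}$ and returns a constraint $K$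 such that, for all parameter valuations $v'$, $$v'\models K\iff v'(\mathcal A)\text{ and }v(\mathcal A)\text{ have the same trace set}\iff v'(\mathcal A)\text{ and }v(\mathcal A)\text{ have the same untimed language}.$$ Moreover, under either convention, the algorithm is effective: with linear constraints represented by finite lists of integer coefficients (and parameter constraints by finite disjunctions of conjunctions of linear inequalities and equalities), the initial values of its variables and the result of each iteration of its loop are computed by partial recursive functions. In particular, there is a partial recursive function that maps each deterministic 1-clock PTA $\mathcal A$ and valuation $v$ to a finite disjunction of conjunctions of linear inequalities and equalities over the parameters whose set of solutions is $\{v' : v'(\mathcal A)\text{ and }v(\mathcal A)\text{ have the same trace set}\}$, which is also the set of the $v'$ for which $v'(\mathcal A)$ and $v(\mathcal A)$ have the same untimed language. -/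

import Mathlib

open scoped NNReal NNRat

namespace OneClock

/-- The five comparison operators `<`, `≤`, `=`, `≥`, `>`. -/
inductive Cmp
  | lt | le | eq | ge | gt

/-- `c.Rel a b` is the comparison of `a` with `b` by the operator `c`. -/
def Cmp.Rel : Cmp → ℝ → ℝ → Prop
  | .lt, a, b => a < b
  | .le, a, b => a ≤ b
  | .eq, a, b => a = b
  | .ge, a, b => a ≥ b
  | .gt, a, b => a > b

/-- A parametric linear term `∑ i, α i * p i + c` with integer coefficients. -/
structure LinTerm (Par : Type) where
  coeff : Par → ℤ
  const : ℤ

/-- A parameter valuation: nonnegative rational values. -/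
abbrev Val (Par : Type) := Par → ℚ≥0

/-- The value of a linear term under a parameter valuation. -/
noncomputable def LinTerm.eval {Par : Type} [Fintype Par] (t : LinTerm Par) (v : Val Par) : ℝ :=
  (∑ i, (t.coeff i : ℝ) * (v i : ℝ)) + (t.const : ℝ)

/-- Atomic constraints: `x ⋈ t` for the unique clock `x` and a linear term `t`, `p ⋈ k` for a
parameter `p` and an integer `k`, true and false. -/
inductive Atom (Par : Type)
  | clock (c : Cmp) (t : LinTerm Par)
  | param (p : Par) (c : Cmp) (k : ℤ)
  | top
  | bot

/-- A constraint is a finite conjunction of atomic constraints. -/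
abbrev Constraint (Par : Type) := List (Atom Par)

section Constraints

variable {Par : Type} [Fintype Par]

/-- Satisfaction of an atomic constraint by a clock value and a parameter valuation. -/
def Atom.Sat (x : ℝ≥0) (v : Val Par) : Atom Par → Prop
  | .clock c t => c.Rel (x : ℝ) (t.eval v)
  | .param p c k => c.Rel (v p : ℝ) (k : ℝ)
  | .top => True
  | .bot => False

/-- Satisfaction of a constraint. -/
def Sat (x : ℝ≥0) (v : Val Par) (g : Constraint Par) : Prop :=
  ∀ a ∈ g, a.Sat x v

end Constraints

open scoped Classical in
/-- The linear terms occurring in an atomic constraint. In `p ⋈ k` these are `p` and `k`. -/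
noncomputable def Atom.terms {Par : Type} : Atom Par → Set (LinTerm Par)
  | .clock _ t => {t}
  | .param p _ k => {⟨Pi.single p 1, 0⟩, ⟨0, k⟩}
  | .top => ∅
  | .bot => ∅

/-- An edge: source location, guard, action, whether the clock is reset, target location. -/
structure Edge (Act Loc Par : Type) where
  src : Loc
  guard : Constraint Par
  act : Act
  reset : Bool
  tgt : Loc

/-- A one-clock parametric timed automaton whose guards and invariants may use parametric linear
terms. The list `edges` presents the finite set of edges. -/
structure PTA (Act Loc Par : Type) where
  init : Loc
  inv : Loc → Constraint Par
  edges : List (Edge Act Loc Par)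

variable {Act Loc Par : Type}

namespace PTA

/-- At most one edge for each source location and action. -/
def Deterministic (A : PTA Act Loc Par) : Prop :=
  ∀ e ∈ A.edges, ∀ e' ∈ A.edges, e.src = e'.src → e.act = e'.act → e = e'

/-- The set of the parametric linear terms used in the guards and invariants. -/
def linTerms (A : PTA Act Loc Par) : Set (LinTerm Par) :=
  {t | (∃ l, ∃ a ∈ A.inv l, t ∈ a.terms) ∨ (∃ e ∈ A.edges, ∃ a ∈ e.guard, t ∈ a.terms)}

end PTA

/-! ### Concrete semantics -/

/-- A configuration: a location and a clock value. -/
abbrev Config (Loc : Type) := Loc × ℝ≥0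

/-- A (finite or infinite) trace. A finite trace also records the location that it ends in. -/
inductive Trace (Act Loc : Type)
  | finite (tr : List (Loc × Act)) (last : Loc)
  | infinite (tr : ℕ → Loc × Act)

/-- A (finite or infinite) untimed word. -/
inductive Word (Act : Type)
  | finite (w : List Act)
  | infinite (w : ℕ → Act)

/-- The untimed word of a trace. -/
def Trace.word : Trace Act Loc → Word Act
  | .finite tr _ => .finite (tr.map Prod.snd)
  | .infinite tr => .infinite fun i => (tr i).2

/-- Which runs contribute to the trace set and to the language: the maximal ones (infinite, or
ending in a configuration without outgoing transition), or all finite ones, maximal or not. -/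
inductive RunKind
  | maximal
  | allFinite

namespace PTA

variable [Fintype Par]

/-- A configuration is valid if it satisfies the invariant of its location. -/
def Valid (A : PTA Act Loc Par) (v : Val Par) (s : Config Loc) : Prop :=
  Sat s.2 v (A.inv s.1)

/-- The transition from `s` to `s'` that waits for `d` time units and then takes the edge `e`;
the invariant of the source location has to hold throughout the delay. -/
def Step (A : PTA Act Loc Par) (v : Val Par) (s : Config Loc) (d : ℝ≥0) (e : Edge Act Loc Par)
    (s' : Config Loc) : Prop :=
  e ∈ A.edges ∧ e.src = s.1 ∧ e.tgt = s'.1 ∧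
  (∀ d' ≤ d, A.Valid v (s.1, s.2 + d')) ∧ Sat (s.2 + d) v e.guard ∧
  s'.2 = (if e.reset then 0 else s.2 + d) ∧ A.Valid v s'

/-- `A.Blocked v s`: the configuration `s` has no outgoing transition. -/
def Blocked (A : PTA Act Loc Par) (v : Val Par) (s : Config Loc) : Prop :=
  ¬ ∃ d e s', A.Step v s d e s'

/-- `A.Reach v tr s`: some finite sequence of transitions from the initial configuration ends in
`s` and visits the sequence `tr` of source locations and actions. -/
inductive Reach (A : PTA Act Loc Par) (v : Val Par) : List (Loc × Act) → Config Loc → Prop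
  | init (h : A.Valid v (A.init, 0)) : Reach A v [] (A.init, 0)
  | step {tr : List (Loc × Act)} {s s' : Config Loc} {d : ℝ≥0} {e : Edge Act Loc Par}
      (h : Reach A v tr s) (hs : A.Step v s d e s') : Reach A v (tr ++ [(s.1, e.act)]) s'

/-- The trace set of the timed automaton obtained from `A` by the valuation `v`. -/
def traces (A : PTA Act Loc Par) (v : Val Par) : RunKind → Set (Trace Act Loc)
  | .maximal =>
      {τ | (∃ tr s, A.Reach v tr s ∧ A.Blocked v s ∧ τ = .finite tr s.1) ∨
        ∃ (s : ℕ → Config Loc) (d : ℕ → ℝ≥0) (e : ℕ → Edge Act Loc Par),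
          s 0 = (A.init, 0) ∧ A.Valid v (s 0) ∧ (∀ i, A.Step v (s i) (d i) (e i) (s (i + 1))) ∧
          τ = .infinite fun i => ((s i).1, (e i).act)}
  | .allFinite => {τ | ∃ tr s, A.Reach v tr s ∧ τ = .finite tr s.1}

/-- The untimed language of the timed automaton obtained from `A` by the valuation `v`. -/
def language (A : PTA Act Loc Par) (v : Val Par) (κ : RunKind) : Set (Word Act) :=
  Trace.word '' A.traces v κ

end PTA

/-! ### Symbolic semantics -/

/-- The solution sets of constraints over the clock and the parameters. -/
abbrev Zone (Par : Type) := Set (ℝ≥0 × Val Par)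

/-- A symbolic state: a location and a constraint, up to equivalence of constraints. -/
abbrev SymState (Loc Par : Type) := Loc × Zone Par

/-- Time elapsing. -/
def Zone.elapse (Z : Zone Par) : Zone Par :=
  {q | ∃ y d : ℝ≥0, (y, q.2) ∈ Z ∧ q.1 = y + d}

/-- Reset of the clock if `b` is true. -/
def Zone.reset (b : Bool) (Z : Zone Par) : Zone Par :=
  if b then {q | q.1 = 0 ∧ ∃ y, (y, q.2) ∈ Z} else Z

/-- Projection onto the parameters. -/
def Zone.proj (Z : Zone Par) : Set (Val Par) :=
  {v | ∃ x, (x, v) ∈ Z}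

/-- The solution set of a constraint. -/
def Zone.of [Fintype Par] (g : Constraint Par) : Zone Par :=
  {q | Sat q.1 q.2 g}

namespace PTA

variable [Fintype Par]

/-- The initial symbolic state. -/
def symInit (A : PTA Act Loc Par) : SymState Loc Par :=
  let I := Zone.of (A.inv A.init)
  (A.init, Zone.elapse ({q | q.1 = 0} ∩ I) ∩ I)

/-- The solutions just after taking the edge `e` from the zone `Z`. -/
def entry (A : PTA Act Loc Par) (Z : Zone Par) (e : Edge Act Loc Par) : Zone Par :=
  Zone.reset e.reset (Z ∩ Zone.of e.guard) ∩ Zone.of (A.inv e.tgt)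

/-- The (nonempty) successors of a symbolic state. -/
def symSucc (A : PTA Act Loc Par) (σ : SymState Loc Par) : Set (SymState Loc Par) :=
  {σ' | ∃ e ∈ A.edges, e.src = σ.1 ∧
    σ' = (e.tgt, Zone.elapse (A.entry σ.2 e) ∩ Zone.of (A.inv e.tgt)) ∧ σ'.2.Nonempty}

/-- The parameter valuations for which some solution just after taking the edge `e` from the
zone `Z` is a configuration without outgoing transition. -/
def blockAfter (A : PTA Act Loc Par) (Z : Zone Par) (e : Edge Act Loc Par) : Set (Val Par) :=
  {v | ∃ x, (x, v) ∈ A.entry Z e ∧ A.Blocked v (e.tgt, x)}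

/-- The parameter valuations for which the initial configuration is valid and has no outgoing
transition. -/
def blockInit (A : PTA Act Loc Par) : Set (Val Par) :=
  {v | A.Valid v (A.init, 0) ∧ A.Blocked v (A.init, 0)}

end PTA

/-! ### The synthesis algorithm -/

/-- The contents of the variables of the algorithm: the constraints `good` and `bad`, the set
`met` of the symbolic states met in earlier iterations, the set `new` of those met for the first
time in the latest iteration, and the time spent so far. -/
structure TPSState (Loc Par : Type) where
  good : Set (Val Par)
  bad : Set (Val Par)
  met : Set (SymState Loc Par)
  new : Set (SymState Loc Par)
  time : ℕ∞

/-- `agree B v` is the constraint `B` if `v` satisfies it, and its negation otherwise. -/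
def agree (B : Set (Val Par)) (v : Val Par) : Set (Val Par) :=
  {v' | v' ∈ B ↔ v ∈ B}

namespace TPSState

variable [Fintype Par]

/-- The symbolic states among the new ones that are compatible with `v`. -/
def compatible (v : Val Par) (T : TPSState Loc Par) : Set (SymState Loc Par) :=
  {σ ∈ T.new | v ∈ σ.2.proj}

/-- The variables before the first iteration. -/
def start (κ : RunKind) (A : PTA Act Loc Par) (v : Val Par) : TPSState Loc Par where
  good := match κ with
    | .maximal => agree A.blockInit v
    | .allFinite => Set.univ
  bad := ∅
  met := ∅
  new := {A.symInit}
  time := 0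

/-- The constraint contributed by a symbolic state that is compatible with `v`. -/
def contribution (κ : RunKind) (A : PTA Act Loc Par) (v : Val Par) (σ : SymState Loc Par) :
    Set (Val Par) :=
  match κ with
  | .maximal => σ.2.proj ∩ {v' | ∀ e ∈ A.edges, e.src = σ.1 → v' ∈ agree (A.blockAfter σ.2 e) v}
  | .allFinite => σ.2.proj

/-- The treatment of the new symbolic states: the compatible ones strengthen `good`, the others
weaken `bad`. It takes one unit of time for each new symbolic state, and one for the iteration. -/
noncomputable def treat (κ : RunKind) (A : PTA Act Loc Par) (v : Val Par) (T : TPSState Loc Par) :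
    TPSState Loc Par where
  good := T.good ∩ ⋂ σ ∈ T.compatible v, contribution κ A v σ
  bad := T.bad ∪ ⋃ σ ∈ T.new \ T.compatible v, σ.2.proj
  met := T.met ∪ T.new
  new := T.new
  time := T.time + T.new.encard + 1

/-- The passage to the next iteration: only compatible symbolic states are explored further, and
only symbolic states that have not been met before are treated. -/
noncomputable def advance (κ : RunKind) (A : PTA Act Loc Par) (v : Val Par) (T : TPSState Loc Par) :
    TPSState Loc Par :=
  { T.treat κ A v with
    new := (⋃ σ ∈ T.compatible v, A.symSucc σ) \ (T.met ∪ T.new) }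

/-- `Returns κ A v T K t`: started with the variables `T`, the while loop terminates, it returns
the constraint `K`, and the clock of the algorithm then shows `t`. -/
inductive Returns (κ : RunKind) (A : PTA Act Loc Par) (v : Val Par) :
    TPSState Loc Par → Set (Val Par) → ℕ∞ → Prop
  | exit {T : TPSState Loc Par} (h : T.compatible v = ∅) :
      Returns κ A v T ((T.treat κ A v).good \ (T.treat κ A v).bad) (T.treat κ A v).time
  | loop {T : TPSState Loc Par} {K : Set (Val Par)} {t : ℕ∞} (h : T.compatible v ≠ ∅)
      (hr : Returns κ A v (T.advance κ A v) K t) : Returns κ A v T K t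

end TPSState

/-- `TPS κ A v K t`: on input `A` and `v` the algorithm terminates after time `t` and returns
`K`. -/
def TPS [Fintype Par] (κ : RunKind) (A : PTA Act Loc Par) (v : Val Par) (K : Set (Val Par))
    (t : ℕ∞) : Prop :=
  TPSState.Returns κ A v (TPSState.start κ A v) K t

/-! ### Finite descriptions of the input and of the output -/

/-- The code of a comparison operator. -/
def Cmp.code : Cmp → ℕ
  | .lt => 0
  | .le => 1
  | .eq => 2
  | .ge => 3
  | .gt => 4

/-- The comparison operator with a given code. -/
def Cmp.decode : ℕ → Cmp
  | 0 => .lt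
  | 1 => .le
  | 2 => .eq
  | 3 => .ge
  | _ => .gt

/-- Codes of linear terms: the list of the coefficients, and the constant. -/
abbrev TermCode := List ℤ × ℤ

/-- Codes of atomic constraints: tag, comparison operator, linear term. -/
abbrev AtomCode := ℕ × ℕ × TermCode

/-- Codes of edges. -/
abbrev EdgeCode := ℕ × List AtomCode × ℕ × Bool × ℕ

/-- Codes of automata: initial location, list of the invariants, list of the edges. -/
abbrev PTACode := ℕ × List (List AtomCode) × List EdgeCode

/-- Codes of parameter valuations: the list of the numerators and denominators. -/
abbrev ValCode := List (ℕ × ℕ)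

/-- Codes of parameter constraints: a finite disjunction of finite conjunctions of comparisons of
a linear term with `0`. -/
abbrev ParamConstraintCode := List (List (ℕ × TermCode))

/-- Codes of zones: a finite conjunction of comparisons of `m * x + t` with `0`, where `x` is the
clock, `m` an integer and `t` a linear term. -/
abbrev ZoneCode := List (ℕ × ℤ × TermCode)

/-- Codes of the variables of the algorithm: `good`, `bad`, `met`, `new`. -/
abbrev VarCode :=
  ParamConstraintCode × ParamConstraintCode × List (ℕ × ZoneCode) × List (ℕ × ZoneCode)

section Codes

variable {a l k : ℕ}

/-- The code of an atomic constraint. -/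
def Atom.code : Atom (Fin k) → AtomCode
  | .clock c t => (0, c.code, List.ofFn t.coeff, t.const)
  | .param p c m => (1, c.code, [(p : ℤ)], m)
  | .top => (2, 0, [], 0)
  | .bot => (3, 0, [], 0)

/-- The code of an edge. -/
def Edge.code (e : Edge (Fin a) (Fin l) (Fin k)) : EdgeCode :=
  (e.src, e.guard.map Atom.code, e.act, e.reset, e.tgt)

/-- The code of an automaton. -/
def PTA.code (A : PTA (Fin a) (Fin l) (Fin k)) : PTACode :=
  (A.init, List.ofFn fun i => (A.inv i).map Atom.code, A.edges.map Edge.code)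

/-- The code of a parameter valuation. -/
def valCode (v : Val (Fin k)) : ValCode :=
  List.ofFn fun i => ((v i).num, (v i).den)

/-- The linear term with a given code; missing coefficients are `0`. -/
def TermCode.toTerm (k : ℕ) (t : TermCode) : LinTerm (Fin k) :=
  ⟨fun i => t.1.getD i 0, t.2⟩

/-- The set of the parameter valuations that satisfy the coded parameter constraint. -/
def ParamConstraintCode.solutions (k : ℕ) (F : ParamConstraintCode) : Set (Val (Fin k)) :=
  {v | ∃ D ∈ F, ∀ c ∈ D, (Cmp.decode c.1).Rel ((TermCode.toTerm k c.2).eval v) 0}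

/-- The zone with a given code. -/
def ZoneCode.solutions (k : ℕ) (z : ZoneCode) : Zone (Fin k) :=
  {q | ∀ c ∈ z, (Cmp.decode c.1).Rel ((c.2.1 : ℝ) * (q.1 : ℝ) + (TermCode.toTerm k c.2.2).eval q.2) 0}

/-- The set of the symbolic states that occur in a list of codes. -/
def symStates (l k : ℕ) (S : List (ℕ × ZoneCode)) : Set (SymState (Fin l) (Fin k)) :=
  {σ | ∃ z, ((σ.1 : ℕ), z) ∈ S ∧ σ.2 = ZoneCode.solutions k z}

/-- `Represents c T`: the code `c` describes the contents `T` of the variables (the time, which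
the algorithm does not use, is left out). -/
def VarCode.Represents (c : VarCode) (T : TPSState (Fin l) (Fin k)) : Prop :=
  ParamConstraintCode.solutions k c.1 = T.good ∧ ParamConstraintCode.solutions k c.2.1 = T.bad ∧
  symStates l k c.2.2.1 = T.met ∧ symStates l k c.2.2.2 = T.new

/-- `Effective κ`: the algorithm can be executed on codes. The initial contents of its variables
are computable from the input, and so is, from the input and the contents of the variables, the
result of an iteration of the while loop: either the constraint that is returned, or the contents
of the variables at the next iteration. -/
def Effective (κ : RunKind) : Prop :=
  ∃ (first : PTACode × ValCode →. VarCode)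
    (next : (PTACode × ValCode) × VarCode →. ParamConstraintCode ⊕ VarCode),
    Partrec first ∧ Partrec next ∧
    ∀ (a l k : ℕ) (A : PTA (Fin a) (Fin l) (Fin k)) (v : Val (Fin k)),
      (∃ c ∈ first (A.code, valCode v), VarCode.Represents c (TPSState.start κ A v)) ∧
      ∀ (c : VarCode) (T : TPSState (Fin l) (Fin k)), VarCode.Represents c T →
        (T.compatible v = ∅ →
          ∃ F, Sum.inl F ∈ next ((A.code, valCode v), c) ∧
            ParamConstraintCode.solutions k F = (T.treat κ A v).good \ (T.treat κ A v).bad) ∧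
        (T.compatible v ≠ ∅ →
          ∃ c', Sum.inr c' ∈ next ((A.code, valCode v), c) ∧
            VarCode.Represents c' (T.advance κ A v))

end Codes

end OneClock

/-! Complexity. Every symbolic state that the algorithm meets is given by comparisons between the
clock, the parametric terms of the automaton and 0. Eliminating a clock value y merely composes
comparisons s ⋈ y and y ⋈ t into s ⋈ t, so time elapsing and reset create no new terms
(`exists_ordSat`, `IsOrderZone.elapse`, `IsOrderZone.reset`). Such a zone is determined by the
comparisons that it implies, and these are recorded by a rank for each index and one of three flags
for each unordered pair of indices (`zoneKey_injOn`). For n terms this leaves about 3^(n²/2) zones,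
up to a factor 2^(O(n log n)), which is O(2^(n(n+1))) because √3 < 2 (`exists_zone_count_bound`).
Each symbolic state is treated once, and each iteration but the last treats a compatible one, so N
order states lead to time at most 2N + 1.

Correctness. The zone at the end of a path of edges contains (x, v) exactly if, under v, some run
along the path enters the location at a value y ≤ x and x satisfies the invariant
(`PTA.SymRun.mem_iff`). Its projection is thus the set of valuations under which the path is
feasible. `good` makes the paths feasible under v feasible under v'; if a path is feasible under v'
but not under v, a shortest such prefix has a symbolic state that is treated and contributes to
`bad`. The blocking tests do the same for paths that can end in a blocked configuration. So the
result describes the v' with the same feasible (and blockable) paths as v (`PTA.mem_outcome_iff`).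

These paths determine the trace set. For infinite runs this is a compactness statement,
`PTA.infiniteRun_iff`: clock values can be rounded to finitely many representatives, and the
smallest value reachable can imitate all larger ones. Conversely, in a deterministic automaton an
action word fixes the path, independently of the valuation (`PTA.SymRun.unique`), so the untimed
language gives the paths back; when only maximal runs count, a feasible path is first extended to a
maximal run.

Effectivity. Fourier–Motzkin elimination on lists of integer coefficients is primitive recursive and
is correct over every ordered field, hence for real clock values and rational parameters alike.
Projection, emptiness, inclusion of zones and blocking all reduce to it. -/

namespace OneClock

/-! ### Fourier–Motzkin elimination over an ordered field. -/

section Elimination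

variable {K : Type*} [Field K] [LinearOrder K] [IsStrictOrderedRing K]

/-- The strict (`b = true`) or weak (`b = false`) inequality between `x` and `0`. -/
def Neg (b : Bool) (x : K) : Prop := if b then x < 0 else x ≤ 0

theorem neg_of_lt {K : Type*} [Field K] [LinearOrder K] {b : Bool} {x : K} (h : x < 0) : Neg b x := by
  cases b
  · simpa [Neg] using h.le
  · simpa [Neg] using h

theorem Neg.add {b c : Bool} {x y : K} (hx : Neg b x) (hy : Neg c y) : Neg (b || c) (x + y) := by
  cases b <;> cases c <;> simp only [Neg, Bool.or_true, Bool.or_false, if_true, if_false,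
    Bool.false_eq_true] at * <;> linarith

theorem neg_mul_iff {b : Bool} {a x : K} (ha : 0 < a) : Neg b (a * x) ↔ Neg b x := by
  cases b <;> simp [Neg, mul_neg_iff, mul_nonpos_iff, ha, ha.le, ha.not_ge, ha.not_gt]

theorem neg_not_iff {b : Bool} {x : K} : Neg (!b) (-x) ↔ ¬ Neg b x := by
  cases b <;> simp [Neg]

/-- Fourier–Motzkin elimination of one variable from finitely many linear inequalities. -/
theorem exists_forall_neg_iff {ι : Type*} [Finite ι] (b : ι → Bool) (a r : ι → K)
    (h : ∃ i, a i < 0) :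
    (∃ x, ∀ i, Neg (b i) (a i * x + r i)) ↔
      (∀ i, a i = 0 → Neg (b i) (r i)) ∧
      ∀ i j, 0 < a i → a j < 0 → Neg (b i || b j) (a i * r j + -a j * r i) := by
  constructor
  · rintro ⟨x, hx⟩
    refine ⟨fun i hi => by simpa [hi] using hx i, fun i j hi hj => ?_⟩
    have h1 := (neg_mul_iff hi).2 (hx j)
    have h2 := (neg_mul_iff (neg_pos.2 hj)).2 (hx i)
    have h3 := h2.add h1
    convert h3 using 1
    ring
  · rintro ⟨h0, hp⟩
    -- The lexicographic order selects a greatest lower bound and, among equal ones, a strict one,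
    -- since `false < true`. This bound implies all other lower bounds.
    obtain ⟨l, hl, hlmax⟩ := Set.exists_max_image {i | a i < 0}
      (fun i => toLex (-(r i / a i), b i)) (Set.toFinite _) h
    have lower : ∀ x, (if b l then -(r l / a l) < x else -(r l / a l) ≤ x) →
        ∀ i, a i < 0 → Neg (b i) (a i * x + r i) := by
      intro x hx i hi
      have h1 := hlmax i hi
      rw [Prod.Lex.le_iff] at h1
      have key : a i * x + r i = -a i * (-(r i / a i) - x) := by
        field_simp [hi.ne]
        ring
      rw [key, neg_mul_iff (neg_pos.2 hi)]
      simp only [ofLex_toLex] at h1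
      rcases h1 with h1 | ⟨h1, h2⟩
      · apply neg_of_lt
        split_ifs at hx <;> linarith
      · cases hb : b i
        · simp only [Neg, Bool.false_eq_true, if_false]
          split_ifs at hx <;> linarith
        · have : b l = true := by
            rw [hb] at h2
            exact Bool.eq_true_of_true_le h2
          simp only [Neg, if_true]
          simp only [this, if_true] at hx
          linarith
    by_cases hu : ∃ i, 0 < a i
    · obtain ⟨u, hu, humin⟩ := Set.exists_min_image {i | 0 < a i}
        (fun i => toLex (-(r i / a i), !b i)) (Set.toFinite _) hu
      have upper : ∀ x, (if b u then x < -(r u / a u) else x ≤ -(r u / a u)) →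
          ∀ i, 0 < a i → Neg (b i) (a i * x + r i) := by
        intro x hx i hi
        have h1 := humin i hi
        rw [Prod.Lex.le_iff] at h1
        have key : a i * x + r i = a i * (x - -(r i / a i)) := by
          field_simp [hi.ne']
          ring
        rw [key, neg_mul_iff hi]
        simp only [ofLex_toLex] at h1
        rcases h1 with h1 | ⟨h1, h2⟩
        · apply neg_of_lt
          split_ifs at hx <;> linarith
        · cases hb : b i
          · simp only [Neg, Bool.false_eq_true, if_false]
            split_ifs at hx <;> linarith
          · have : b u = true := by
              cases hbu : b u
              · rw [hb, hbu] at h2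
                exact absurd h2 (by decide)
              · rfl
            simp only [Neg, if_true]
            simp only [this, if_true] at hx
            linarith
      have hlu := hp u l hu hl
      -- The combination of the two tightest bounds is a positive multiple of lower minus upper
      -- bound, so `hlu` says that the interval between them is nonempty.
      have key : a u * r l + -a l * r u = (a u * -a l) * (-(r l / a l) - -(r u / a u)) := by
        have := (hl : a l < 0).ne
        have := (hu : 0 < a u).ne'
        field_simp
        ring
      rw [key, neg_mul_iff (mul_pos hu (neg_pos.2 hl))] at hlu
      obtain ⟨x, hx1, hx2⟩ : ∃ x, (if b l then -(r l / a l) < x else -(r l / a l) ≤ x) ∧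
          (if b u then x < -(r u / a u) else x ≤ -(r u / a u)) := by
        cases hbl : b l <;> cases hbu : b u <;> simp only [hbl, hbu, Neg, Bool.or_true,
          Bool.or_false, if_true, Bool.false_eq_true, if_false, sub_nonpos, sub_neg] at hlu ⊢
        · exact ⟨_, le_rfl, hlu⟩
        · exact ⟨_, le_rfl, hlu⟩
        · exact ⟨_, hlu, le_rfl⟩
        · exact exists_between hlu
      refine ⟨x, fun i => ?_⟩
      rcases lt_trichotomy (a i) 0 with hi | hi | hi
      · exact lower x hx1 i hi
      · simpa [hi] using h0 i hi
      · exact upper x hx2 i hi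
    · refine ⟨-(r l / a l) + 1, fun i => ?_⟩
      rcases lt_trichotomy (a i) 0 with hi | hi | hi
      · refine lower _ ?_ i hi
        split_ifs <;> linarith
      · simpa [hi] using h0 i hi
      · exact absurd ⟨i, hi⟩ hu

end Elimination

end OneClock
namespace OneClock

/-! ### Conjunctions of comparisons between finitely many values -/

/-- The values `g` satisfy the set `S` of strict and weak inequalities between indices. -/
def OrdSat {σ : Type*} (S : Set (Bool × σ × σ)) (g : σ → ℝ) : Prop :=
  ∀ s ∈ S, Neg s.1 (g s.2.1 - g s.2.2)

/-- Extension of a family of values by the value `y` at `none`. -/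
def optVal {σ : Type*} (y : ℝ) (g : σ → ℝ) (i : Option σ) : ℝ := i.elim y g

/-- The value y occurs only with coefficients 1, −1 and 0, so adding `g i ≤ y` to `y ≤ g j` yields a
comparison of two of the given values again, strict if one of the two is. The class of comparisons
is closed under elimination, which would fail with several clocks or general coefficients. -/
theorem exists_ordSat {σ : Type*} [Finite σ] (z : σ) (S : Set (Bool × Option σ × Option σ)) :
    ∃ S' : Set (Bool × σ × σ), ∀ g : σ → ℝ, g z = 0 →
      ((∃ y : ℝ, 0 ≤ y ∧ OrdSat S (optVal y g)) ↔ OrdSat S' g) := by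
  -- Nonnegativity of y becomes one more comparison, with the value 0 at `z`. It is also the lower
  -- bound that the elimination lemma requires.
  set T : Set (Bool × Option σ × Option σ) := insert (false, some z, none) S with hT
  -- The three families: comparisons without y, comparisons of y with itself (replaced by
  -- comparisons of `z` with itself), and compositions through y.
  refine ⟨{s | (s.1, some s.2.1, some s.2.2) ∈ T} ∪
    {s | s.2 = (z, z) ∧ (s.1, none, none) ∈ T} ∪
    {s | ∃ b c, s.1 = (b || c) ∧ (b, none, some s.2.2) ∈ T ∧ (c, some s.2.1, none) ∈ T}, ?_⟩
  intro g hg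
  have h0 : (∃ y : ℝ, 0 ≤ y ∧ OrdSat S (optVal y g)) ↔ ∃ y : ℝ, OrdSat T (optVal y g) := by
    refine exists_congr fun y => ?_
    rw [OrdSat, OrdSat, hT, Set.forall_mem_insert]
    simp [Neg, optVal, hg]
  rw [h0]
  let a : T → ℝ := fun s => optVal 1 0 s.1.2.1 - optVal 1 0 s.1.2.2
  let r : T → ℝ := fun s => optVal 0 g s.1.2.1 - optVal 0 g s.1.2.2
  have hval : ∀ (y : ℝ) (i : Option σ), optVal y g i = optVal 1 0 i * y + optVal 0 g i := by
    rintro y (_ | i) <;> simp [optVal]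
  have h1 : (∃ y : ℝ, OrdSat T (optVal y g)) ↔ ∃ y : ℝ, ∀ s : T, Neg s.1.1 (a s * y + r s) := by
    refine exists_congr fun y => ?_
    rw [OrdSat, Subtype.forall]
    refine forall₂_congr fun s hs => ?_
    rw [hval y s.2.1, hval y s.2.2]
    simp only [a, r]
    ring_nf
  rw [h1, exists_forall_neg_iff (fun s : T => s.1.1) a r
    ⟨⟨(false, some z, none), Set.mem_insert _ _⟩, by simp [a, optVal]⟩]
  constructor
  · rintro ⟨hz, hp⟩ ⟨b, i, j⟩ hs
    rcases hs with (hs | ⟨hs, hs'⟩) | ⟨b', c, hb, h1, h2⟩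
    · simpa [a, r, optVal] using hz ⟨_, hs⟩
    · obtain ⟨rfl, rfl⟩ := Prod.mk.inj hs
      simpa [a, r, optVal] using hz ⟨_, hs'⟩
    · have := hp ⟨_, h1⟩ ⟨_, h2⟩ (by simp [a, optVal]) (by simp [a, optVal])
      simp only at hb
      simpa [a, r, optVal, hb, sub_eq_add_neg] using this
  · intro h
    constructor
    · rintro ⟨⟨b, i | i, j | j⟩, hs⟩ ha
      · have := h (b, z, z) (Or.inl (Or.inr ⟨rfl, hs⟩))
        simpa [r, optVal] using this
      · simp [a, optVal] at ha
      · simp [a, optVal] at ha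
      · have := h (b, _, _) (Or.inl (Or.inl hs))
        simpa [r, optVal] using this
    · rintro ⟨⟨b, i | i, j | j⟩, hs⟩ ⟨⟨b', i' | i', j' | j'⟩, hs'⟩ ha ha' <;>
        simp [a, optVal, not_lt.2 (zero_le_one (α := ℝ))] at ha ha'
      have := h (b || b', i', j) (Or.inr ⟨b, b', rfl, hs, hs'⟩)
      simpa [r, a, optVal, sub_eq_add_neg] using this

/-! ### Zones cut out by comparisons between the clock and a family of terms. -/

section Zones

variable {Par τ : Type}

/-- The values of the clock (at `none`) and of the terms at a point. -/
def pointVal (f : τ → Val Par → ℝ) (q : ℝ≥0 × Val Par) : Option τ → ℝ :=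
  optVal q.1 fun t => f t q.2

/-- The zones defined by comparisons between the clock and the terms in the family `f`. -/
def IsOrderZone (f : τ → Val Par → ℝ) (Z : Zone Par) : Prop :=
  ∃ S : Set (Bool × Option τ × Option τ), Z = {q | OrdSat S (pointVal f q)}

variable {f : τ → Val Par → ℝ}

theorem IsOrderZone.inter {Z W : Zone Par} (hZ : IsOrderZone f Z) (hW : IsOrderZone f W) :
    IsOrderZone f (Z ∩ W) := by
  obtain ⟨S, rfl⟩ := hZ
  obtain ⟨T, rfl⟩ := hW
  refine ⟨S ∪ T, ?_⟩
  ext q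
  simp only [OrdSat, Set.mem_inter_iff, Set.mem_ofPred_eq, Set.mem_union, or_imp, forall_and]

theorem isOrderZone_univ : IsOrderZone f (Set.univ : Zone Par) :=
  ⟨∅, by ext; simp [OrdSat]⟩

theorem isOrderZone_rel (c : Cmp) (i j : Option τ) :
    IsOrderZone f {q | c.Rel (pointVal f q i) (pointVal f q j)} := by
  cases c
  · exact ⟨{(true, i, j)}, by ext; simp [OrdSat, Cmp.Rel, Neg]⟩
  · exact ⟨{(false, i, j)}, by ext; simp [OrdSat, Cmp.Rel, Neg]⟩
  · refine ⟨{(false, i, j), (false, j, i)}, ?_⟩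
    ext
    simp only [OrdSat, Cmp.Rel, Set.mem_ofPred_eq, le_antisymm_iff]
    simp [Neg]
  · exact ⟨{(false, j, i)}, by ext; simp [OrdSat, Cmp.Rel, Neg]⟩
  · exact ⟨{(true, j, i)}, by ext; simp [OrdSat, Cmp.Rel, Neg]⟩

theorem isOrderZone_empty : IsOrderZone f (∅ : Zone Par) :=
  ⟨{(true, none, none)}, by ext; simp [OrdSat, Neg]⟩

/-- The earlier clock value is quantified over the nonnegative reals, subject to being at most the
present one; it is eliminated by `exists_ordSat`. -/
theorem IsOrderZone.elapse [Finite τ] {z : τ} (hz : ∀ v, f z v = 0) {Z : Zone Par}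
    (hZ : IsOrderZone f Z) : IsOrderZone f Z.elapse := by
  obtain ⟨S, rfl⟩ := hZ
  -- In `Option (Option τ)`, `none` is the earlier clock value and `some none` the present one; `e`
  -- turns the constraints of the zone into constraints on the earlier value.
  let e : Option τ → Option (Option τ) := fun i => i.map some
  obtain ⟨S', hS'⟩ := exists_ordSat (some z)
    ((fun s : Bool × Option τ × Option τ => (s.1, e s.2.1, e s.2.2)) '' S ∪ {(false, none, some none)})
  refine ⟨S', ?_⟩
  ext ⟨x, v⟩
  have he : ∀ (y : ℝ≥0) (i : Option τ),
      optVal (y : ℝ) (pointVal f (x, v)) (e i) = pointVal f (y, v) i := by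
    rintro y (_ | i) <;> rfl
  rw [Set.mem_ofPred_eq, ← hS' _ (hz v)]
  constructor
  · rintro ⟨y, d, hy, rfl⟩
    refine ⟨y, y.2, ?_⟩
    rintro _ (⟨s, hs, rfl⟩ | rfl)
    · simp only [he]
      exact hy s hs
    · simp [Neg, optVal, pointVal]
  · rintro ⟨y, hy, h⟩
    lift y to ℝ≥0 using hy
    have hyx := h _ (Or.inr rfl)
    have hyx : y ≤ x := by
      rw [← NNReal.coe_le_coe]
      simpa [Neg, optVal, pointVal] using hyx
    refine ⟨y, x - y, fun s hs => ?_, (add_tsub_cancel_of_le hyx).symm⟩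
    have := h _ (Or.inl ⟨s, hs, rfl⟩)
    simpa only [he] using this

/-- The old clock value is eliminated, and the new one is set equal to the term `z`, whose value is
0. -/
theorem IsOrderZone.reset [Finite τ] {z : τ} (hz : ∀ v, f z v = 0) {Z : Zone Par}
    (hZ : IsOrderZone f Z) (b : Bool) : IsOrderZone f (Z.reset b) := by
  cases b
  · simpa [Zone.reset] using hZ
  obtain ⟨S, rfl⟩ := hZ
  obtain ⟨S', hS'⟩ := exists_ordSat z S
  have h1 : IsOrderZone f {q | ∃ y, (y, q.2) ∈ {q | OrdSat S (pointVal f q)}} := by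
    refine ⟨(fun s : Bool × τ × τ => (s.1, some s.2.1, some s.2.2)) '' S', ?_⟩
    ext ⟨x, v⟩
    have h2 := hS' (fun t => f t v) (hz v)
    have h3 : OrdSat ((fun s : Bool × τ × τ => (s.1, some s.2.1, some s.2.2)) '' S')
        (pointVal f (x, v)) ↔ OrdSat S' (fun t => f t v) := by
      simp only [OrdSat, Set.forall_mem_image]
      rfl
    rw [Set.mem_ofPred_eq, Set.mem_ofPred_eq, h3, ← h2]
    constructor
    · rintro ⟨y, hy⟩
      exact ⟨y, y.2, hy⟩
    · rintro ⟨y, hy, h⟩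
      exact ⟨⟨y, hy⟩, h⟩
  have h2 := (isOrderZone_rel (f := f) .eq none (some z)).inter h1
  convert h2 using 1
  ext ⟨x, v⟩
  simp [Zone.reset, Cmp.Rel, pointVal, optVal, hz]

/-! ### Counting -/

open scoped Classical in
/-- The encoding of an order zone by a ranking of the indices and a flag for each pair. -/
noncomputable def zoneKey [Fintype τ] (f : τ → Val Par → ℝ) (Z : Zone Par) :
    (Option τ → Fin (Fintype.card (Option τ) + 1)) × (Sym2 (Option τ) → Fin 3) :=
  (fun i => ⟨(Finset.univ.filter fun k => ∀ q ∈ Z, pointVal f q k ≤ pointVal f q i).card,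
      Nat.lt_succ_of_le (Finset.card_le_univ _)⟩,
    fun p => if ∃ i j, p = s(i, j) ∧ ∀ q ∈ Z, pointVal f q i < pointVal f q j then 2
      else if ∃ i j, p = s(i, j) ∧ ∀ q ∈ Z, pointVal f q i ≤ pointVal f q j then 1 else 0)

/-- The flag says that i and j are comparable on Z, the rank says in which direction: if j lies
below i and the rank of i does not exceed that of j, then the sets of indices below j and below i
are nested and of equal size, hence equal, so i lies below j as well. Flags for unordered instead of
ordered pairs halve the exponent of 3, without which the count would exceed the bound of the
theorem. -/
theorem zoneKey_le_iff [Fintype τ] (Z : Zone Par) (i j : Option τ) :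
    (∀ q ∈ Z, pointVal f q i ≤ pointVal f q j) ↔
      (zoneKey f Z).2 s(i, j) ≠ 0 ∧ (zoneKey f Z).1 i ≤ (zoneKey f Z).1 j := by
  classical
  let D : Option τ → Finset (Option τ) := fun i =>
    Finset.univ.filter fun k => ∀ q ∈ Z, pointVal f q k ≤ pointVal f q i
  have hmono : ∀ i j, (∀ q ∈ Z, pointVal f q i ≤ pointVal f q j) → D i ⊆ D j := by
    intro i j h k hk
    simp only [D, Finset.mem_filter, Finset.mem_univ, true_and] at hk ⊢
    exact fun q hq => (hk q hq).trans (h q hq)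
  constructor
  · intro h
    refine ⟨?_, ?_⟩
    · have hex : ∃ i' j', s(i, j) = s(i', j') ∧ ∀ q ∈ Z, pointVal f q i' ≤ pointVal f q j' :=
        ⟨i, j, rfl, h⟩
      simp only [zoneKey]
      rw [if_pos hex]
      split_ifs <;> decide
    · exact Finset.card_le_card (hmono i j h)
  · rintro ⟨h0, hle⟩
    have h1 : ∃ i' j', s(i, j) = s(i', j') ∧ ∀ q ∈ Z, pointVal f q i' ≤ pointVal f q j' := by
      by_contra h1
      apply h0
      simp only [zoneKey]
      rw [if_neg, if_neg h1]
      rintro ⟨i', j', h, h'⟩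
      exact h1 ⟨i', j', h, fun q hq => (h' q hq).le⟩
    obtain ⟨i', j', h, h'⟩ := h1
    rcases Sym2.eq_iff.1 h with ⟨rfl, rfl⟩ | ⟨rfl, rfl⟩
    · exact h'
    · have h2 := Finset.eq_of_subset_of_card_le (hmono _ _ h') hle
      have h3 : i ∈ D i := by simp [D]
      rw [← h2] at h3
      simpa [D] using h3

theorem zoneKey_lt_iff [Fintype τ] (Z : Zone Par) (i j : Option τ) :
    (∀ q ∈ Z, pointVal f q i < pointVal f q j) ↔
      (zoneKey f Z).2 s(i, j) = 2 ∧ ∀ q ∈ Z, pointVal f q i ≤ pointVal f q j := by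
  constructor
  · intro h
    refine ⟨?_, fun q hq => (h q hq).le⟩
    simp only [zoneKey]
    rw [if_pos ⟨i, j, rfl, h⟩]
  · rintro ⟨h2, hle⟩
    by_cases h1 : ∃ i' j', s(i, j) = s(i', j') ∧ ∀ q ∈ Z, pointVal f q i' < pointVal f q j'
    · obtain ⟨i', j', h, h'⟩ := h1
      rcases Sym2.eq_iff.1 h with ⟨rfl, rfl⟩ | ⟨rfl, rfl⟩
      · exact h'
      · exact fun q hq => absurd (hle q hq) (h' q hq).not_ge
    · simp only [zoneKey] at h2
      rw [if_neg h1] at h2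
      split_ifs at h2 <;> exact absurd h2 (by decide)

/-- A zone defined by some comparisons is also defined by all comparisons that it implies. That
description depends on the zone alone, so `zoneKey` determines the zone. -/
theorem IsOrderZone.eq_of_implied {Z : Zone Par} (hZ : IsOrderZone f Z) :
    Z = {q | ∀ i j, ((∀ p ∈ Z, pointVal f p i ≤ pointVal f p j) → pointVal f q i ≤ pointVal f q j) ∧
      ((∀ p ∈ Z, pointVal f p i < pointVal f p j) → pointVal f q i < pointVal f q j)} := by
  obtain ⟨S, hS⟩ := hZ
  ext q
  constructor
  · exact fun hq i j => ⟨fun h => h q hq, fun h => h q hq⟩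
  · intro h
    rw [hS]
    rintro ⟨b, i, j⟩ hs
    cases b
    · simp only [Neg, Bool.false_eq_true, if_false, sub_nonpos]
      refine (h i j).1 fun p hp => ?_
      rw [hS] at hp
      simpa [Neg] using hp _ hs
    · simp only [Neg, if_true, sub_neg]
      refine (h i j).2 fun p hp => ?_
      rw [hS] at hp
      simpa [Neg] using hp _ hs

theorem zoneKey_injOn [Fintype τ] : Set.InjOn (zoneKey f) {Z | IsOrderZone f Z} := by
  intro Z hZ W hW h
  have hle : ∀ i j, (∀ q ∈ Z, pointVal f q i ≤ pointVal f q j) ↔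
      ∀ q ∈ W, pointVal f q i ≤ pointVal f q j := fun i j => by
    rw [zoneKey_le_iff, zoneKey_le_iff, h]
  have hlt : ∀ i j, (∀ q ∈ Z, pointVal f q i < pointVal f q j) ↔
      ∀ q ∈ W, pointVal f q i < pointVal f q j := fun i j => by
    rw [zoneKey_lt_iff, zoneKey_lt_iff, h, hle]
  rw [IsOrderZone.eq_of_implied hZ, IsOrderZone.eq_of_implied hW]
  simp only [hle, hlt]

theorem finite_isOrderZone [Finite τ] : {Z | IsOrderZone f Z}.Finite := by
  have := Fintype.ofFinite τ
  exact Set.Finite.of_injOn (Set.mapsTo_univ _ _) zoneKey_injOn Set.finite_univ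

/-- For n terms there are n + 1 indices, counting the clock, ranks up to n + 1, and `(n + 2).choose
2` unordered pairs, the diagonal included. -/
theorem ncard_isOrderZone_le [Fintype τ] : {Z | IsOrderZone f Z}.ncard ≤
    (Fintype.card τ + 2) ^ (Fintype.card τ + 1) * 3 ^ (Fintype.card τ + 2).choose 2 := by
  classical
  have h := Set.ncard_le_ncard_of_injOn (zoneKey f) (Set.mapsTo_univ _ _) zoneKey_injOn
    (Set.finite_univ)
  refine h.trans (le_of_eq ?_)
  rw [Set.ncard_univ, Nat.card_eq_fintype_card, Fintype.card_prod, Fintype.card_fun,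
    Fintype.card_fun, Sym2.card, Fintype.card_option, Fintype.card_fin, Fintype.card_fin]

end Zones

/-- The bound on the number of order zones over `0` and `n` terms, compared with the bound on the
running time. -/
theorem exists_zone_count_bound : ∃ C : ℕ, ∀ n : ℕ,
    (n + 3) ^ (n + 2) * 3 ^ (n + 3).choose 2 ≤ C * 2 ^ (n * (n + 1)) := by
  -- The square of the left side divided by the square of 2^(n(n+1)) is the (n + 2)-nd power of this
  -- sequence over 16, as `key` below shows.
  have hlim : Filter.Tendsto (fun n : ℕ => 108 * ((n : ℝ) + 3) ^ 2 * (3 / 4) ^ n) Filter.atTop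
      (nhds 0) := by
    have h := ((tendsto_pow_const_mul_const_pow_of_abs_lt_one 2
      (r := (3 / 4 : ℝ)) (by norm_num [abs_of_pos])).comp (Filter.tendsto_add_atTop_nat 3)).const_mul
      (108 * (4 / 3) ^ 3)
    rw [mul_zero] at h
    refine h.congr fun n => ?_
    simp only [Function.comp_apply, pow_add]
    push_cast
    ring
  obtain ⟨N, hN⟩ := Filter.eventually_atTop.1 (hlim.eventually (gt_mem_nhds one_pos))
  have hlarge : ∀ n ≥ N, (n + 3) ^ (n + 2) * 3 ^ (n + 3).choose 2 ≤ 2 ^ (n * (n + 1)) := by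
    intro n hn
    have hc : (n + 3).choose 2 * 2 = n * (n + 1) + 4 * n + 6 := by
      have h := Nat.triangle_succ (n + 2)
      have h2 : (n + 3) * (n + 2) % 2 = 0 := by
        rw [mul_comm]
        exact Nat.even_iff.1 (Nat.even_mul_succ_self (n + 2))
      rw [Nat.choose_two_right]
      have : n + 3 - 1 = n + 2 := rfl
      rw [this, Nat.div_mul_cancel (Nat.dvd_of_mod_eq_zero h2)]
      ring
    -- Squaring removes the division by 2 in the binomial coefficient.
    rw [← Nat.pow_le_pow_iff_left two_ne_zero, mul_pow, ← pow_mul 3, hc, ← pow_mul 2, mul_comm _ 2,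
      pow_mul 2]
    have hb := pow_le_one₀ (n := n + 2) (by positivity) (hN n hn).le
    have key : (((n : ℝ) + 3) ^ (n + 2)) ^ 2 * 3 ^ (n * (n + 1) + 4 * n + 6) * 16 =
        (108 * ((n : ℝ) + 3) ^ 2 * (3 / 4) ^ n) ^ (n + 2) * 4 ^ (n * (n + 1)) := by
      have h3 : (3 : ℝ) ^ (n * (n + 1) + 4 * n + 6) = (3 ^ 3) ^ (n + 2) * (3 ^ n) ^ (n + 2) := by
        rw [← pow_mul, ← pow_mul, ← pow_add]
        ring_nf
      have h4 : (16 : ℝ) * (4 ^ n) ^ (n + 2) = 4 ^ (n + 2) * 4 ^ (n * (n + 1)) := by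
        rw [← pow_mul, ← pow_add, show (16 : ℝ) = 4 ^ 2 by norm_num, ← pow_add]
        ring_nf
      have h108 : (108 : ℝ) = 3 ^ 3 * 4 := by norm_num
      have ha := pow_right_comm ((n : ℝ) + 3) 2 (n + 2)
      rw [h3, h108, div_pow, mul_pow, mul_pow, mul_pow, div_pow, ha]
      generalize (((n : ℝ) + 3) ^ (n + 2)) ^ 2 = a
      field_simp
      linear_combination a * (3 ^ 3) ^ (n + 2) * (3 ^ n) ^ (n + 2) * h4
    have h16 : (((n : ℝ) + 3) ^ (n + 2)) ^ 2 * 3 ^ (n * (n + 1) + 4 * n + 6) ≤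
        4 ^ (n * (n + 1)) := by
      have h1 : (0 : ℝ) ≤ (((n : ℝ) + 3) ^ (n + 2)) ^ 2 * 3 ^ (n * (n + 1) + 4 * n + 6) := by
        positivity
      have h2 : (0 : ℝ) ≤ 4 ^ (n * (n + 1)) := by positivity
      nlinarith
    exact_mod_cast h16
  -- The constant 1 serves all n ≥ N; the sum dominates each of the finitely many remaining cases.
  refine ⟨1 + ∑ n ∈ Finset.range N, (n + 3) ^ (n + 2) * 3 ^ (n + 3).choose 2, fun n => ?_⟩
  rcases le_or_gt N n with hn | hn
  · exact (hlarge n hn).trans (Nat.le_mul_of_pos_left _ (by omega))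
  · have h1 := Finset.single_le_sum (f := fun n => (n + 3) ^ (n + 2) * 3 ^ (n + 3).choose 2)
      (fun _ _ => Nat.zero_le _) (Finset.mem_range.2 hn)
    refine (h1.trans (Nat.le_add_left _ 1)).trans (Nat.le_mul_of_pos_right _ (by positivity))

end OneClock
namespace OneClock

variable {Act Loc Par : Type} [Fintype Par]

/-! ### The reachable symbolic states are order zones -/

theorem LinTerm.eval_single [DecidableEq Par] (p : Par) (v : Val Par) :
    LinTerm.eval ⟨Pi.single p 1, 0⟩ v = v p := by
  simp [LinTerm.eval, Pi.single_apply, ite_mul]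

theorem LinTerm.eval_const (k : ℤ) (v : Val Par) : LinTerm.eval ⟨0, k⟩ v = k := by
  simp [LinTerm.eval]

/-- The terms of an automaton together with `0`. -/
noncomputable def PTA.termVal (A : PTA Act Loc Par) (t : Option A.linTerms) (v : Val Par) : ℝ :=
  t.elim 0 fun t => t.1.eval v

theorem PTA.isOrderZone_of (A : PTA Act Loc Par) {g : Constraint Par}
    (hg : ∀ a ∈ g, a.terms ⊆ A.linTerms) : IsOrderZone A.termVal (Zone.of g) := by
  induction g with
  | nil => simpa [Zone.of, Sat] using isOrderZone_univ
  | cons a g ih =>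
    have h1 : Zone.of (a :: g) = {q : ℝ≥0 × Val Par | a.Sat q.1 q.2} ∩ Zone.of g := by
      ext q
      simp [Zone.of, Sat]
    rw [h1]
    refine IsOrderZone.inter ?_ (ih fun b hb => hg b (List.mem_cons_of_mem _ hb))
    have ha := hg a List.mem_cons_self
    cases a with
    | clock c t =>
      exact isOrderZone_rel (f := A.termVal) c none (some (some ⟨t, ha rfl⟩))
    | param p c k =>
      have h := isOrderZone_rel (f := A.termVal) c (some (some ⟨_, ha (Or.inl rfl)⟩))
        (some (some ⟨_, ha (Or.inr rfl)⟩))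
      convert h using 2 with q
      simp [pointVal, optVal, PTA.termVal, Atom.Sat, LinTerm.eval_single, LinTerm.eval_const]
    | top => simpa [Atom.Sat] using isOrderZone_univ
    | bot => simpa [Atom.Sat] using isOrderZone_empty

theorem Atom.finite_terms {Par : Type} (a : Atom Par) : a.terms.Finite := by
  cases a <;> simp [Atom.terms]

theorem PTA.finite_linTerms {Act Loc Par : Type} [Finite Loc] (A : PTA Act Loc Par) : A.linTerms.Finite := by
  have h : A.linTerms = (⋃ l, ⋃ a ∈ {a | a ∈ A.inv l}, a.terms) ∪
      ⋃ e ∈ {e | e ∈ A.edges}, ⋃ a ∈ {a | a ∈ e.guard}, a.terms := by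
    ext t
    simp [PTA.linTerms]
  rw [h]
  refine (Set.finite_iUnion fun l => (List.finite_toSet _).biUnion fun a _ => a.finite_terms).union
    ((List.finite_toSet _).biUnion fun e _ => (List.finite_toSet _).biUnion fun a _ =>
      a.finite_terms)

theorem PTA.isOrderZone_inv (A : PTA Act Loc Par) (l : Loc) :
    IsOrderZone A.termVal (Zone.of (A.inv l)) :=
  A.isOrderZone_of fun a ha _ ht => Or.inl ⟨l, a, ha, ht⟩

theorem PTA.isOrderZone_guard (A : PTA Act Loc Par) {e : Edge Act Loc Par} (he : e ∈ A.edges) :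
    IsOrderZone A.termVal (Zone.of e.guard) :=
  A.isOrderZone_of fun a ha _ ht => Or.inr ⟨e, he, a, ha, ht⟩

/-- The symbolic states whose zones compare the clock, the terms of the automaton and `0`. -/
def PTA.orderStates (A : PTA Act Loc Par) : Set (SymState Loc Par) :=
  {σ | IsOrderZone A.termVal σ.2}

theorem PTA.symInit_mem_orderStates [Finite Loc] (A : PTA Act Loc Par) :
    A.symInit ∈ A.orderStates := by
  have := A.finite_linTerms.to_subtype
  refine IsOrderZone.inter (IsOrderZone.elapse (z := none) (fun _ => rfl) ?_) (A.isOrderZone_inv _)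
  refine IsOrderZone.inter ?_ (A.isOrderZone_inv _)
  convert isOrderZone_rel (f := A.termVal) .eq none (some none) using 2 with q
  simp [pointVal, optVal, PTA.termVal, Cmp.Rel]

theorem PTA.symSucc_subset_orderStates [Finite Loc] (A : PTA Act Loc Par) {σ : SymState Loc Par}
    (hσ : σ ∈ A.orderStates) : A.symSucc σ ⊆ A.orderStates := by
  have := A.finite_linTerms.to_subtype
  rintro _ ⟨e, he, -, rfl, -⟩
  refine IsOrderZone.inter (IsOrderZone.elapse (z := none) (fun _ => rfl) ?_) (A.isOrderZone_inv _)
  refine IsOrderZone.inter ?_ (A.isOrderZone_inv _)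
  exact (IsOrderZone.inter hσ (A.isOrderZone_guard he)).reset (z := none) (fun _ => rfl) _

theorem PTA.orderStates_eq (A : PTA Act Loc Par) :
    A.orderStates = Set.univ ×ˢ {Z | IsOrderZone A.termVal Z} := by
  ext σ
  simp [PTA.orderStates]

theorem PTA.finite_orderStates [Finite Loc] (A : PTA Act Loc Par) : A.orderStates.Finite := by
  have := A.finite_linTerms.to_subtype
  rw [A.orderStates_eq]
  exact Set.finite_univ.prod finite_isOrderZone

theorem PTA.ncard_orderStates_le [Finite Loc] (A : PTA Act Loc Par) : A.orderStates.ncard ≤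
    Nat.card Loc * ((A.linTerms.ncard + 3) ^ (A.linTerms.ncard + 2) *
      3 ^ (A.linTerms.ncard + 3).choose 2) := by
  have := A.finite_linTerms.fintype
  have h := ncard_isOrderZone_le (f := A.termVal)
  rw [Fintype.card_option, ← Nat.card_eq_fintype_card, Nat.card_coe_set_eq] at h
  rw [A.orderStates_eq, Set.ncard_prod, Set.ncard_univ]
  exact Nat.mul_le_mul_left _ h

/-! ### The breadth-first exploration -/

/-- The symbolic states explored by the algorithm. -/
inductive PTA.Explored (A : PTA Act Loc Par) (v : Val Par) : SymState Loc Par → Prop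
  | init (h : v ∈ A.symInit.2.proj) : Explored A v A.symInit
  | succ {σ σ' : SymState Loc Par} (h : Explored A v σ) (hs : σ' ∈ A.symSucc σ)
      (hv : v ∈ σ'.2.proj) : Explored A v σ'

/-- The symbolic states treated by the algorithm. -/
def PTA.Treated (A : PTA Act Loc Par) (v : Val Par) (σ : SymState Loc Par) : Prop :=
  σ = A.symInit ∨ ∃ ρ, A.Explored v ρ ∧ σ ∈ A.symSucc ρ

theorem PTA.Treated.explored {A : PTA Act Loc Par} {v : Val Par} {σ : SymState Loc Par}
    (h : A.Treated v σ) (hv : v ∈ σ.2.proj) : A.Explored v σ := by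
  rcases h with rfl | ⟨ρ, hρ, hs⟩
  · exact .init hv
  · exact .succ hρ hs hv

theorem PTA.Explored.mem_proj {A : PTA Act Loc Par} {v : Val Par} {σ : SymState Loc Par}
    (h : A.Explored v σ) : v ∈ σ.2.proj := by
  cases h <;> assumption

/-- The constraint returned by the algorithm, in terms of the explored symbolic states. -/
def PTA.outcome (κ : RunKind) (A : PTA Act Loc Par) (v : Val Par) : Set (Val Par) :=
  {v' | v' ∈ (TPSState.start κ A v).good ∧
    (∀ σ, A.Explored v σ → v' ∈ TPSState.contribution κ A v σ) ∧
    ∀ σ, A.Treated v σ → v ∉ σ.2.proj → v' ∉ σ.2.proj}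

/-- The invariant of the while loop. -/
structure TPSState.Invariant (κ : RunKind) (A : PTA Act Loc Par) (v : Val Par)
    (T : TPSState Loc Par) : Prop where
  treated : ∀ σ ∈ T.met ∪ T.new, A.Treated v σ
  init_mem : A.symInit ∈ T.met ∪ T.new
  succ_mem : ∀ σ ∈ T.met, v ∈ σ.2.proj → A.symSucc σ ⊆ T.met ∪ T.new
  good : T.good = {v' | v' ∈ (start κ A v).good ∧
    ∀ σ ∈ T.met, v ∈ σ.2.proj → v' ∈ contribution κ A v σ}
  bad : T.bad = {v' | ∃ σ ∈ T.met, v ∉ σ.2.proj ∧ v' ∈ σ.2.proj}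
  disjoint : Disjoint T.met T.new
  order : T.met ∪ T.new ⊆ A.orderStates
  time : T.time ≤ 2 * T.met.encard

theorem TPSState.invariant_start [Finite Loc] (κ : RunKind) (A : PTA Act Loc Par) (v : Val Par) :
    (start κ A v).Invariant κ A v where
  treated σ hσ := by
    simp [start] at hσ
    exact Or.inl hσ
  init_mem := by simp [start]
  succ_mem := by simp [start]
  good := by simp [start]
  bad := by simp [start]
  disjoint := by simp [start]
  order := by simpa [start] using A.symInit_mem_orderStates
  time := by simp [start]

variable {κ : RunKind} {A : PTA Act Loc Par} {v : Val Par} {T : TPSState Loc Par}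

theorem TPSState.Invariant.good_treat (h : T.Invariant κ A v) :
    (T.treat κ A v).good = {v' | v' ∈ (start κ A v).good ∧
      ∀ σ ∈ T.met ∪ T.new, v ∈ σ.2.proj → v' ∈ contribution κ A v σ} := by
  ext v'
  simp only [treat, h.good, compatible, Set.mem_inter_iff, Set.mem_iInter, Set.mem_union,
    Set.mem_ofPred_eq, or_imp, forall_and, and_imp]
  tauto

theorem TPSState.Invariant.bad_treat (h : T.Invariant κ A v) :
    (T.treat κ A v).bad = {v' | ∃ σ ∈ T.met ∪ T.new, v ∉ σ.2.proj ∧ v' ∈ σ.2.proj} := by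
  ext v'
  simp only [treat, h.bad, compatible, Set.mem_union, Set.mem_iUnion, Set.mem_sdiff,
    Set.mem_ofPred_eq, or_and_right, exists_or]
  refine or_congr Iff.rfl (exists_congr fun σ => ?_)
  simp only [exists_prop]
  tauto

theorem TPSState.Invariant.time_treat (h : T.Invariant κ A v) :
    (T.treat κ A v).time ≤ 2 * T.met.encard + T.new.encard + 1 := by
  simp only [treat]
  gcongr
  exact h.time

theorem TPSState.Invariant.advance [Finite Loc] (h : T.Invariant κ A v)
    (hne : T.compatible v ≠ ∅) : (T.advance κ A v).Invariant κ A v where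
  treated σ hσ := by
    simp only [TPSState.advance, treat, Set.union_sdiff_self] at hσ
    rcases hσ with hσ | hσ
    · exact h.treated σ hσ
    · simp only [Set.mem_iUnion] at hσ
      obtain ⟨ρ, hρ, hs⟩ := hσ
      exact Or.inr ⟨ρ, (h.treated ρ (Or.inr hρ.1)).explored hρ.2, hs⟩
  init_mem := Or.inl h.init_mem
  succ_mem σ hσ hv := by
    simp only [TPSState.advance, treat, Set.union_sdiff_self]
    rcases hσ with hσ | hσ
    · exact (h.succ_mem σ hσ hv).trans Set.subset_union_left
    · refine Set.subset_union_of_subset_right ?_ _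
      exact Set.subset_biUnion_of_mem (u := fun σ => A.symSucc σ)
        (show σ ∈ T.compatible v from ⟨hσ, hv⟩)
  good := h.good_treat
  bad := h.bad_treat
  disjoint := Set.disjoint_sdiff_right
  order := by
    simp only [TPSState.advance, treat, Set.union_sdiff_self]
    refine Set.union_subset h.order ?_
    simp only [Set.iUnion_subset_iff]
    exact fun σ hσ => A.symSucc_subset_orderStates (h.order (Or.inr hσ.1))
  time := by
    obtain ⟨σ, hσ⟩ := Set.nonempty_iff_ne_empty.2 hne
    -- The loop continues only if a new state is compatible, so the unit charged for the iteration
    -- can be paid by a new state. Hence two units per state met.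
    have h1 : 1 ≤ T.new.encard := Set.one_le_encard_iff_nonempty.2 ⟨σ, hσ.1⟩
    refine h.time_treat.trans ?_
    simp only [TPSState.advance, treat]
    rw [Set.encard_union_eq h.disjoint, mul_add, add_assoc, two_mul T.new.encard]
    gcongr

/-- When no new state is compatible, nothing is left to explore: `met ∪ new` is exactly the set of
treated states. The result therefore does not depend on the order of the exploration. -/
theorem TPSState.Invariant.result_eq (h : T.Invariant κ A v) (hT : T.compatible v = ∅) :
    (T.treat κ A v).good \ (T.treat κ A v).bad = A.outcome κ v := by
  have hall : ∀ σ, A.Treated v σ ↔ σ ∈ T.met ∪ T.new := by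
    refine fun σ => ⟨fun hσ => ?_, h.treated σ⟩
    have hex : ∀ ρ, A.Explored v ρ → ρ ∈ T.met ∪ T.new := by
      intro ρ hρ
      induction hρ with
      | init _ => exact h.init_mem
      | @succ σ σ' hσ hs _ ih =>
        rcases ih with ih | ih
        · exact h.succ_mem σ ih hσ.mem_proj hs
        · exact absurd (show σ ∈ T.compatible v from ⟨ih, hσ.mem_proj⟩) (by simp [hT])
    rcases hσ with rfl | ⟨ρ, hρ, hs⟩
    · exact h.init_mem
    · rcases hex ρ hρ with hm | hm
      · exact h.succ_mem ρ hm hρ.mem_proj hs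
      · exact absurd (show ρ ∈ T.compatible v from ⟨hm, hρ.mem_proj⟩) (by simp [hT])
  have hexp : ∀ σ, A.Explored v σ ↔ σ ∈ T.met ∪ T.new ∧ v ∈ σ.2.proj := fun σ =>
    ⟨fun hσ => ⟨(hall σ).1 (by cases hσ with
      | init _ => exact Or.inl rfl
      | succ h1 h2 _ => exact Or.inr ⟨_, h1, h2⟩), hσ.mem_proj⟩,
      fun hσ => ((hall σ).2 hσ.1).explored hσ.2⟩
  ext v'
  simp only [h.good_treat, h.bad_treat, PTA.outcome, hall, hexp, Set.mem_sdiff, Set.mem_ofPred_eq,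
    and_imp, not_exists, not_and, and_assoc]

/-- Each further iteration moves a state of the finite set `orderStates` into `met`, so the number
of order states not yet met decreases. At the exit `met` and `new` are disjoint parts of
`orderStates`, which gives the bound on the time. -/
theorem TPSState.Invariant.returns [Finite Loc] (h : T.Invariant κ A v) :
    ∃ t, TPSState.Returns κ A v T (A.outcome κ v) t ∧ t ≤ 2 * A.orderStates.encard + 1 := by
  induction hn : (A.orderStates \ T.met).ncard using Nat.strong_induction_on generalizing T with
  | _ n ih =>
    by_cases hT : T.compatible v = ∅
    · refine ⟨_, h.result_eq hT ▸ .exit hT, h.time_treat.trans ?_⟩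
      gcongr
      calc 2 * T.met.encard + T.new.encard ≤ 2 * T.met.encard + 2 * T.new.encard := by
            gcongr
            exact le_mul_of_one_le_left' (by norm_num)
        _ = 2 * (T.met ∪ T.new).encard := by rw [Set.encard_union_eq h.disjoint, mul_add]
        _ ≤ 2 * A.orderStates.encard := by
            gcongr
            exact h.order
    · obtain ⟨σ, hσ⟩ := Set.nonempty_iff_ne_empty.2 hT
      have hlt : (A.orderStates \ (T.advance κ A v).met).ncard < n := by
        rw [← hn]
        refine Set.ncard_lt_ncard ?_ (A.finite_orderStates.subset Set.sdiff_subset)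
        refine (Set.ssubset_iff_of_subset (Set.sdiff_subset_sdiff_right Set.subset_union_left)).2
          ⟨σ, ⟨h.order (Or.inr hσ.1), Set.disjoint_right.1 h.disjoint hσ.1⟩, fun h' => h'.2 ?_⟩
        exact Or.inr hσ.1
      obtain ⟨t, ht, hle⟩ := ih _ hlt (h.advance hT) rfl
      exact ⟨t, .loop hT ht, hle⟩

theorem exists_TPS_time : ∃ C : ℕ, ∀ (κ : RunKind) (Act Loc Par : Type) [Finite Loc]
    [Fintype Par] (A : PTA Act Loc Par) (v : Val Par),
    ∃ t : ℕ∞, TPS κ A v (A.outcome κ v) t ∧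
      t ≤ ((C * (Nat.card Loc * 2 ^ (A.linTerms.ncard * (A.linTerms.ncard + 1))) : ℕ) : ℕ∞) := by
  obtain ⟨C, hC⟩ := exists_zone_count_bound
  -- There are N ≥ 1 order states, because the initial symbolic state is one, so 2N + 1 ≤ 3N.
  refine ⟨3 * C, fun κ Act Loc Par _ _ A v => ?_⟩
  obtain ⟨t, ht, hle⟩ := (TPSState.invariant_start κ A v).returns
  refine ⟨t, ht, hle.trans ?_⟩
  rw [← A.finite_orderStates.cast_ncard_eq]
  have h1 : 0 < A.orderStates.ncard :=
    (Set.ncard_pos A.finite_orderStates).2 ⟨_, A.symInit_mem_orderStates⟩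
  have h2 := A.ncard_orderStates_le.trans (Nat.mul_le_mul_left _ (hC A.linTerms.ncard))
  have h3 : 2 * A.orderStates.ncard + 1 ≤
      3 * C * (Nat.card Loc * 2 ^ (A.linTerms.ncard * (A.linTerms.ncard + 1))) := by
    rw [show ∀ a b c : ℕ, 3 * a * (b * c) = 3 * (b * (a * c)) by intros; ring]
    omega
  exact_mod_cast h3

end OneClock
namespace OneClock

variable {Act Loc Par : Type} [Fintype Par]

/-! ### Symbolic and concrete paths -/

theorem Cmp.Rel.of_between {c : Cmp} {a b x t : ℝ} (ha : c.Rel a t) (hb : c.Rel b t) (hax : a ≤ x)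
    (hxb : x ≤ b) : c.Rel x t := by
  cases c <;> simp only [Cmp.Rel] at * <;> linarith

/-- Constraints are convex in the clock. Hence an invariant that holds at both ends of a delay holds
throughout, and the symbolic semantics, which tests the ends only, is exact. -/
theorem Sat.of_between {g : Constraint Par} {v : Val Par} {a b x : ℝ≥0} (ha : Sat a v g)
    (hb : Sat b v g) (hax : a ≤ x) (hxb : x ≤ b) : Sat x v g := by
  intro at' hat
  have h1 := ha at' hat
  have h2 := hb at' hat
  cases at' with
  | clock c t => exact h1.of_between h2 (by exact_mod_cast hax) (by exact_mod_cast hxb)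
  | param p c k => exact h1
  | top => trivial
  | bot => exact h1

namespace PTA

/-- The source locations and actions of a sequence of edges. -/
def trace (π : List (Edge Act Loc Par)) : List (Loc × Act) := π.map fun e => (e.src, e.act)

/-- `A.Run v π s`: some run from the initial configuration follows the edges `π` and ends
in `s`. -/
inductive Run (A : PTA Act Loc Par) (v : Val Par) :
    List (Edge Act Loc Par) → Config Loc → Prop
  | init (h : A.Valid v (A.init, 0)) : Run A v [] (A.init, 0)
  | step {π : List (Edge Act Loc Par)} {s s' : Config Loc} {d : ℝ≥0} {e : Edge Act Loc Par}
      (h : Run A v π s) (hs : A.Step v s d e s') : Run A v (π ++ [e]) s'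

/-- `A.SymRun π σ`: the symbolic run along the edges `π` ends in `σ`, possibly with an empty
zone. -/
inductive SymRun (A : PTA Act Loc Par) : List (Edge Act Loc Par) → SymState Loc Par → Prop
  | init : SymRun A [] A.symInit
  | step {π : List (Edge Act Loc Par)} {σ : SymState Loc Par} {e : Edge Act Loc Par}
      (h : SymRun A π σ) (he : e ∈ A.edges) (hsrc : e.src = σ.1) :
      SymRun A (π ++ [e]) (e.tgt, Zone.elapse (A.entry σ.2 e) ∩ Zone.of (A.inv e.tgt))

variable {A : PTA Act Loc Par} {v v' : Val Par} {π : List (Edge Act Loc Par)} {s : Config Loc}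
  {σ : SymState Loc Par} {e : Edge Act Loc Par}

theorem reach_iff {tr : List (Loc × Act)} :
    A.Reach v tr s ↔ ∃ π, A.Run v π s ∧ tr = trace π := by
  constructor
  · intro h
    induction h with
    | init h => exact ⟨[], .init h, rfl⟩
    | step _ hs ih =>
      obtain ⟨π, hπ, rfl⟩ := ih
      exact ⟨_, .step hπ hs, by simp [trace, hs.2.1]⟩
  · rintro ⟨π, h, rfl⟩
    induction h with
    | init h => exact .init h
    | step _ hs ih =>
      have := Reach.step ih hs
      simpa [trace, hs.2.1] using this

theorem Run.valid (h : A.Run v π s) : A.Valid v s := by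
  cases h with
  | init h => exact h
  | step _ hs => exact hs.2.2.2.2.2.2

theorem Run.append_inv {π ρ : List (Edge Act Loc Par)} (h : A.Run v (π ++ ρ) s) :
    ∃ s', A.Run v π s' := by
  induction ρ using List.reverseRecOn generalizing s with
  | nil => exact ⟨s, by simpa using h⟩
  | append_singleton ρ e ih =>
    rw [← List.append_assoc] at h
    generalize hτ : π ++ ρ ++ [e] = τ at h
    cases h with
    | init => simp at hτ
    | step h _ =>
      obtain ⟨rfl, -⟩ := List.append_inj' hτ rfl
      exact ih h

theorem run_snoc_iff : A.Run v (π ++ [e]) s ↔ ∃ s' d, A.Run v π s' ∧ A.Step v s' d e s := by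
  constructor
  · intro h
    generalize hτ : π ++ [e] = τ at h
    cases h with
    | init => simp at hτ
    | step h hs =>
      obtain ⟨rfl, he⟩ := List.append_inj' hτ rfl
      obtain rfl := List.singleton_inj.1 he
      exact ⟨_, _, h, hs⟩
  · rintro ⟨s', d, h, hs⟩
    exact .step h hs

theorem run_nil_iff : A.Run v [] s ↔ s = (A.init, 0) ∧ A.Valid v s := by
  constructor
  · intro h
    generalize hτ : [] = τ at h
    cases h with
    | init h => exact ⟨rfl, h⟩
    | step => simp at hτ
  · rintro ⟨rfl, h⟩
    exact .init h

theorem mem_elapse_inter {Z : Zone Par} {g : Constraint Par} (x : ℝ≥0) (v : Val Par) :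
    (x, v) ∈ Z.elapse ∩ Zone.of g ↔ ∃ y ≤ x, (y, v) ∈ Z ∧ Sat x v g := by
  constructor
  · rintro ⟨⟨y, d, hy, rfl : x = y + d⟩, hg⟩
    exact ⟨y, le_self_add, hy, hg⟩
  · rintro ⟨y, hyx, hy, hg⟩
    exact ⟨⟨y, x - y, hy, (add_tsub_cancel_of_le hyx).symm⟩, hg⟩

/-- The hypothesis `hZ` has the form of `SymRun.mem_iff`, so that the lemma serves both as the
induction step there and, afterwards, for the blocking tests. -/
theorem mem_entry_iff {Z : Zone Par} {l : Loc}
    (hZ : ∀ x, (x, v) ∈ Z ↔ ∃ y ≤ x, A.Run v π (l, y) ∧ A.Valid v (l, x))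
    (he : e ∈ A.edges) (hsrc : e.src = l) (x : ℝ≥0) :
    (x, v) ∈ A.entry Z e ↔ A.Run v (π ++ [e]) (e.tgt, x) := by
  have hmid : ∀ x, (x, v) ∈ Zone.reset e.reset (Z ∩ Zone.of e.guard) ↔
      ∃ y, (y, v) ∈ Z ∧ Sat y v e.guard ∧ x = if e.reset then 0 else y := by
    intro x
    cases hr : e.reset
    · simp [Zone.reset, Zone.of]
    · simp only [Zone.reset, if_true, Set.mem_inter_iff, Zone.of, Set.mem_ofPred_eq]
      constructor
      · rintro ⟨hx, y, hy⟩
        exact ⟨y, hy.1, hy.2, hx⟩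
      · rintro ⟨y, h1, h2, hx⟩
        exact ⟨hx, y, h1, h2⟩
  rw [run_snoc_iff, entry, Set.mem_inter_iff, hmid]
  constructor
  · rintro ⟨⟨y, hy, hg, hx⟩, hinv⟩
    obtain ⟨y₀, hle, hrun, hval⟩ := (hZ y).1 hy
    refine ⟨(l, y₀), y - y₀, hrun, he, hsrc, rfl, fun d' hd' => ?_, ?_, ?_, hinv⟩
    · refine Sat.of_between hrun.valid hval le_self_add ?_
      calc y₀ + d' ≤ y₀ + (y - y₀) := by gcongr
        _ = y := add_tsub_cancel_of_le hle
    · simpa [add_tsub_cancel_of_le hle] using hg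
    · simpa [add_tsub_cancel_of_le hle] using hx
  · rintro ⟨⟨l', y₀⟩, d, hrun, -, hsrc', -, hval, hg, hx, hinv⟩
    obtain rfl : l = l' := hsrc.symm.trans hsrc'
    exact ⟨⟨y₀ + d, (hZ _).2 ⟨y₀, le_self_add, hrun, hval d le_rfl⟩, hg, hx⟩, hinv⟩

/-- Here y is the value on entering the location and x a value to which one can wait there; validity
on the way from y to x follows by convexity. -/
theorem SymRun.mem_iff (h : A.SymRun π σ) (x : ℝ≥0) (v : Val Par) :
    (x, v) ∈ σ.2 ↔ ∃ y ≤ x, A.Run v π (σ.1, y) ∧ A.Valid v (σ.1, x) := by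
  induction h generalizing x with
  | init =>
    refine (mem_elapse_inter x v).trans (exists_congr fun y => and_congr_right fun _ =>
      and_congr_left fun _ => ?_)
    rw [run_nil_iff]
    constructor
    · rintro ⟨rfl : y = 0, h⟩
      exact ⟨rfl, h⟩
    · rintro ⟨h1, h2⟩
      exact ⟨congrArg Prod.snd h1, h2⟩
  | step h he hsrc ih =>
    refine (mem_elapse_inter x v).trans (exists_congr fun y => and_congr_right fun _ =>
      and_congr_left fun _ => ?_)
    exact mem_entry_iff ih he hsrc y

theorem Run.exists_symRun (h : A.Run v π s) : ∃ σ, A.SymRun π σ ∧ σ.1 = s.1 := by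
  induction h with
  | init => exact ⟨_, .init, rfl⟩
  | step _ hs ih =>
    obtain ⟨σ, hσ, hl⟩ := ih
    exact ⟨_, .step hσ hs.1 (hs.2.1.trans hl.symm), hs.2.2.1⟩

/-- Determinism enters through this lemma: location and action leave one choice of edge, so an
action word fixes the path and its symbolic run, without reference to a valuation. -/
theorem SymRun.unique (hA : A.Deterministic) {π' : List (Edge Act Loc Par)}
    {σ' : SymState Loc Par} (h : A.SymRun π σ) (h' : A.SymRun π' σ')
    (hw : π.map Edge.act = π'.map Edge.act) : π = π' ∧ σ = σ' := by
  induction h generalizing π' σ' with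
  | init =>
    cases h' with
    | init => exact ⟨rfl, rfl⟩
    | step => simp at hw
  | step h he hsrc ih =>
    cases h' with
    | init => simp at hw
    | step h' he' hsrc' =>
      rw [List.map_append, List.map_append] at hw
      obtain ⟨h1, h2⟩ := List.append_inj' hw rfl
      obtain ⟨rfl, rfl⟩ := ih h' h1
      obtain rfl := hA _ he _ he' (hsrc.trans hsrc'.symm) (by simpa using h2)
      exact ⟨rfl, rfl⟩

theorem Run.unique (hA : A.Deterministic) {π' : List (Edge Act Loc Par)} {s' : Config Loc}
    (h : A.Run v π s) (h' : A.Run v' π' s') (hw : π.map Edge.act = π'.map Edge.act) :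
    π = π' ∧ s.1 = s'.1 := by
  obtain ⟨σ, hσ, hl⟩ := h.exists_symRun
  obtain ⟨σ', hσ', hl'⟩ := h'.exists_symRun
  obtain ⟨rfl, rfl⟩ := hσ.unique hA hσ' hw
  exact ⟨rfl, hl.symm.trans hl'⟩

/-- No determinism is needed: the final location is the target of the last edge, or the initial
location, under every valuation. -/
theorem Run.loc_eq {s' : Config Loc} (h : A.Run v π s) (h' : A.Run v' π s') : s.1 = s'.1 := by
  induction π using List.reverseRecOn with
  | nil => rw [(run_nil_iff.1 h).1, (run_nil_iff.1 h').1]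
  | append_singleton π e ih =>
    obtain ⟨_, _, _, hs⟩ := run_snoc_iff.1 h
    obtain ⟨_, _, _, hs'⟩ := run_snoc_iff.1 h'
    exact hs.2.2.1.symm.trans hs'.2.2.1

/-- The sequence `π` of edges can be followed from the initial configuration. -/
def Feasible (A : PTA Act Loc Par) (v : Val Par) (π : List (Edge Act Loc Par)) : Prop :=
  ∃ s, A.Run v π s

/-- The sequence `π` of edges can be followed to a configuration without outgoing transition. -/
def BlockedAfter (A : PTA Act Loc Par) (v : Val Par) (π : List (Edge Act Loc Par)) : Prop :=
  ∃ s, A.Run v π s ∧ A.Blocked v s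

theorem SymRun.mem_proj_iff (h : A.SymRun π σ) : v ∈ σ.2.proj ↔ A.Feasible v π := by
  constructor
  · rintro ⟨x, hx⟩
    obtain ⟨y, _, hy, _⟩ := (h.mem_iff x v).1 hx
    exact ⟨_, hy⟩
  · rintro ⟨⟨l, x⟩, hs⟩
    obtain ⟨σ', hσ', hl⟩ := hs.exists_symRun
    have hl' : σ.1 = l := by
      clear hs
      cases h with
      | init =>
        generalize hτ : [] = τ at hσ'
        cases hσ' with
        | init => exact hl
        | step => simp at hτ
      | step h he hsrc =>
        rename_i π₀ σ₀ e
        generalize hτ : π₀ ++ [e] = τ at hσ'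
        cases hσ' with
        | init => simp at hτ
        | step h he hsrc =>
          obtain ⟨-, he⟩ := List.append_inj' hτ rfl
          obtain rfl := List.singleton_inj.1 he
          exact hl
    subst hl'
    exact ⟨x, (h.mem_iff x v).2 ⟨x, le_rfl, hs, hs.valid⟩⟩

theorem Feasible.of_append {ρ : List (Edge Act Loc Par)} (h : A.Feasible v (π ++ ρ)) :
    A.Feasible v π :=
  h.elim fun _ hs => hs.append_inv

theorem blockedAfter_nil_iff : A.BlockedAfter v [] ↔ v ∈ A.blockInit := by
  constructor
  · rintro ⟨s, hs, hb⟩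
    obtain ⟨rfl, hv⟩ := run_nil_iff.1 hs
    exact ⟨hv, hb⟩
  · rintro ⟨hv, hb⟩
    exact ⟨_, .init hv, hb⟩

/-- The right side depends on π only through the symbolic state reached, so one blocking test per
symbolic state and edge covers all paths that lead to that state. -/
theorem SymRun.blockedAfter_iff (h : A.SymRun π σ) (he : e ∈ A.edges) (hsrc : e.src = σ.1) :
    A.BlockedAfter v (π ++ [e]) ↔ v ∈ A.blockAfter σ.2 e := by
  have h1 := fun x => mem_entry_iff (fun x => h.mem_iff x v) he hsrc x
  constructor
  · rintro ⟨⟨l, x⟩, hs, hb⟩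
    obtain ⟨_, _, _, hs'⟩ := run_snoc_iff.1 hs
    obtain rfl : e.tgt = l := hs'.2.2.1
    exact ⟨x, (h1 x).2 hs, hb⟩
  · rintro ⟨x, hx, hb⟩
    exact ⟨_, (h1 x).1 hx, hb⟩

/-! ### The constraint returned by the algorithm -/

theorem Explored.exists_symRun (h : A.Explored v σ) : ∃ π, A.SymRun π σ ∧ A.Feasible v π := by
  induction h with
  | init h => exact ⟨[], .init, SymRun.init.mem_proj_iff.1 h⟩
  | succ _ hs hv ih =>
    obtain ⟨π, hπ, -⟩ := ih
    obtain ⟨e, he, hsrc, rfl, -⟩ := hs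
    have := SymRun.step hπ he hsrc
    exact ⟨_, this, this.mem_proj_iff.1 hv⟩

theorem Treated.exists_symRun (h : A.Treated v σ) : ∃ π, A.SymRun π σ := by
  rcases h with rfl | ⟨ρ, hρ, e, he, hsrc, rfl, -⟩
  · exact ⟨[], .init⟩
  · obtain ⟨π, hπ, -⟩ := hρ.exists_symRun
    exact ⟨_, SymRun.step hπ he hsrc⟩

/-- The prefixes of a feasible path are feasible, so all symbolic states on the way are compatible
with v and the exploration does not stop before σ. -/
theorem SymRun.explored (h : A.SymRun π σ) (hv : A.Feasible v π) : A.Explored v σ := by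
  induction h with
  | init => exact .init (SymRun.init.mem_proj_iff.2 hv)
  | step h he hsrc ih =>
    have hv' := (SymRun.step h he hsrc).mem_proj_iff.2 hv
    refine .succ (ih hv.of_append) ⟨_, he, hsrc, rfl, ?_⟩ hv'
    exact hv'.elim fun x hx => ⟨_, hx⟩

/-- The same sequences of edges can be followed under `v` and `v'`, and, if only maximal runs
count, to configurations without outgoing transition. -/
def SameRuns (κ : RunKind) (A : PTA Act Loc Par) (v v' : Val Par) : Prop :=
  (∀ π, A.Feasible v π ↔ A.Feasible v' π) ∧
    (κ = .maximal → ∀ π, A.BlockedAfter v π ↔ A.BlockedAfter v' π)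

theorem contribution_subset_proj {κ : RunKind} :
    TPSState.contribution κ A v σ ⊆ σ.2.proj := by
  cases κ
  · exact Set.inter_subset_left
  · exact subset_rfl

/-- `good` carries feasible paths from v to v' and `bad` carries them back; the tests `agree`
compare the paths that can end blocked. -/
theorem mem_outcome_iff {κ : RunKind} : v' ∈ A.outcome κ v ↔ SameRuns κ A v v' := by
  constructor
  · rintro ⟨hstart, hexp, hbad⟩
    have hf : ∀ π, A.Feasible v π → A.Feasible v' π := by
      rintro π ⟨s, hs⟩
      obtain ⟨σ, hσ, -⟩ := hs.exists_symRun
      exact hσ.mem_proj_iff.1 (contribution_subset_proj (hexp σ (hσ.explored ⟨s, hs⟩)))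
    -- If v' first gets further than v by the edge e, the symbolic state before e is explored; so
    -- the one after e is treated, is incompatible with v, and would exclude v' through `bad`.
    have hf' : ∀ π, A.Feasible v' π → A.Feasible v π := by
      intro π
      induction π using List.reverseRecOn with
      | nil =>
        intro h
        by_contra h'
        rw [← SymRun.init.mem_proj_iff] at h h'
        exact hbad _ (Or.inl rfl) h' h
      | append_singleton π e ih =>
        intro h
        by_contra h'
        have hπ := ih h.of_append
        obtain ⟨s, hs⟩ := h
        obtain ⟨s₀, d, hs₀, hstep⟩ := run_snoc_iff.1 hs
        obtain ⟨σ, hσ, hl⟩ := hs₀.exists_symRun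
        have hnext := hσ.step hstep.1 (hstep.2.1.trans hl.symm)
        have h1 := hnext.mem_proj_iff.2 ⟨s, hs⟩
        refine hbad _ (Or.inr ⟨σ, hσ.explored hπ, e, hstep.1, hstep.2.1.trans hl.symm, rfl, ?_⟩)
          (fun h2 => h' (hnext.mem_proj_iff.1 h2)) h1
        exact h1.elim fun x hx => ⟨_, hx⟩
    refine ⟨fun π => ⟨hf π, hf' π⟩, ?_⟩
    rintro rfl π
    rcases List.eq_nil_or_concat' π with rfl | ⟨π, e, rfl⟩
    · rw [blockedAfter_nil_iff, blockedAfter_nil_iff]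
      exact hstart.symm
    -- A path infeasible under v is infeasible under v', so neither can block after it; otherwise
    -- the state before the last edge is explored and was tested.
    · by_cases hπ : A.Feasible v (π ++ [e])
      · obtain ⟨s, hs⟩ := hπ
        obtain ⟨s₀, d, hs₀, hstep⟩ := run_snoc_iff.1 hs
        obtain ⟨σ, hσ, hl⟩ := hs₀.exists_symRun
        have hsrc := hstep.2.1.trans hl.symm
        rw [hσ.blockedAfter_iff hstep.1 hsrc, hσ.blockedAfter_iff hstep.1 hsrc]
        exact ((hexp σ (hσ.explored ⟨_, hs₀⟩)).2 e hstep.1 hsrc).symm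
      · constructor
        · rintro ⟨s, hs, -⟩
          exact absurd ⟨s, hs⟩ hπ
        · rintro ⟨s, hs, -⟩
          exact absurd (hf' _ ⟨s, hs⟩) hπ
  · rintro ⟨hf, hb⟩
    refine ⟨?_, fun σ hσ => ?_, fun σ hσ hv hv' => ?_⟩
    · cases κ
      · have := hb rfl []
        rw [blockedAfter_nil_iff, blockedAfter_nil_iff] at this
        exact this.symm
      · trivial
    · obtain ⟨π, hπ, hfeas⟩ := hσ.exists_symRun
      have h1 := hπ.mem_proj_iff.2 ((hf π).1 hfeas)
      cases κ
      · refine ⟨h1, fun e he hsrc => ?_⟩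
        have := hb rfl (π ++ [e])
        rw [hπ.blockedAfter_iff he hsrc, hπ.blockedAfter_iff he hsrc] at this
        exact this.symm
      · exact h1
    · obtain ⟨π, hπ⟩ := hσ.exists_symRun
      rw [hπ.mem_proj_iff] at hv hv'
      exact hv ((hf π).2 hv')

end PTA

end OneClock
namespace OneClock

variable {Act Loc Par : Type} [Fintype Par]

/-! ### Infinite runs -/

/-- The clock values can be represented by finitely many of them, monotonically, such that the
comparisons with finitely many given values do not change. -/
theorem exists_finite_representatives (T : Set ℝ) (hT : T.Finite) :
    ∃ φ : ℝ≥0 → ℝ≥0, Monotone φ ∧ (Set.range φ).Finite ∧ φ 0 = 0 ∧ (∀ x, φ (φ x) = φ x) ∧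
      ∀ x, ∀ t ∈ T, cmp (φ x : ℝ) t = cmp (x : ℝ) t := by
  -- The threshold 0 is added so that 0 represents itself, as the initial configuration and resets
  -- demand. `φ x` depends only on the comparisons of x with the thresholds, of which there are
  -- finitely many patterns.
  have := (hT.insert 0).to_subtype
  let sig : ℝ≥0 → (insert 0 T : Set ℝ) → Ordering := fun x t => cmp (x : ℝ) t
  let φ : ℝ≥0 → ℝ≥0 := fun x => Function.invFun sig (sig x)
  have hsig : ∀ x, sig (φ x) = sig x := fun x => Function.invFun_eq ⟨x, rfl⟩
  have hcmp : ∀ x, ∀ t ∈ insert 0 T, cmp (φ x : ℝ) t = cmp (x : ℝ) t :=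
    fun x t ht => congrFun (hsig x) ⟨t, ht⟩
  refine ⟨φ, fun x y hxy => ?_, ?_, ?_, fun x => ?_, fun x t ht => hcmp x t (Or.inr ht)⟩
  · by_cases h : sig x = sig y
    · exact (congrArg (Function.invFun sig) h).le
    -- If x ≤ y have different patterns, some threshold t satisfies x ≤ t ≤ y, and the
    -- representatives lie on the same sides of t.
    · obtain ⟨⟨t, ht⟩, hne⟩ := Function.ne_iff.1 h
      have hxy' : (x : ℝ) ≤ y := by exact_mod_cast hxy
      have hxt : (x : ℝ) ≤ t := by
        by_contra! hlt
        apply hne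
        change cmp (x : ℝ) t = cmp (y : ℝ) t
        rw [(cmp_eq_gt_iff _ _).2 hlt, (cmp_eq_gt_iff _ _).2 (hlt.trans_le hxy')]
      have hty : t ≤ (y : ℝ) := by
        by_contra! hlt
        apply hne
        change cmp (x : ℝ) t = cmp (y : ℝ) t
        rw [(cmp_eq_lt_iff _ _).2 hlt, (cmp_eq_lt_iff _ _).2 (hxy'.trans_lt hlt)]
      have h1 := (le_iff_le_of_cmp_eq_cmp (hcmp x t ht)).2 hxt
      have h2 := (le_iff_le_of_cmp_eq_cmp (cmp_eq_cmp_symm.1 (hcmp y t ht))).2 hty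
      exact_mod_cast h1.trans h2
  · refine (Set.finite_range (Function.invFun sig)).subset ?_
    rintro _ ⟨x, rfl⟩
    exact ⟨_, rfl⟩
  · have := hcmp 0 0 (Set.mem_insert _ _)
    rw [NNReal.coe_zero, cmp_self_eq_eq, cmp_eq_eq_iff] at this
    exact_mod_cast this
  · exact congrArg (Function.invFun sig) (hsig x)

theorem Cmp.rel_iff_of_cmp_eq {c : Cmp} {x y t : ℝ} (h : cmp x t = cmp y t) :
    c.Rel x t ↔ c.Rel y t := by
  cases c
  · exact lt_iff_lt_of_cmp_eq_cmp h
  · exact le_iff_le_of_cmp_eq_cmp h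
  · exact eq_iff_eq_of_cmp_eq_cmp h
  · exact le_iff_le_of_cmp_eq_cmp (cmp_eq_cmp_symm.1 h)
  · exact lt_iff_lt_of_cmp_eq_cmp (cmp_eq_cmp_symm.1 h)

theorem Sat.of_cmp {T : Set ℝ} {v : Val Par} {x y : ℝ≥0}
    (h : ∀ t ∈ T, cmp (y : ℝ) t = cmp (x : ℝ) t) {g : Constraint Par}
    (hg : ∀ a ∈ g, ∀ t ∈ a.terms, t.eval v ∈ T) (hx : Sat x v g) : Sat y v g := by
  intro a ha
  have h1 := hx a ha
  cases a with
  | clock c t => exact (Cmp.rel_iff_of_cmp_eq (h _ (hg _ ha t rfl))).2 h1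
  | param p c k => exact h1
  | top => trivial
  | bot => exact h1

namespace PTA

variable {A : PTA Act Loc Par} {v v' : Val Par} {π : List (Edge Act Loc Par)}

/-- A smaller value is never worse: one waits from x to y first, which the invariant permits by
convexity, and then proceeds as from y. -/
theorem Step.of_le {l : Loc} {x y d : ℝ≥0} {e : Edge Act Loc Par} {s' : Config Loc}
    (h : A.Step v (l, y) d e s') (hxy : x ≤ y) (hx : A.Valid v (l, x)) :
    A.Step v (l, x) (y - x + d) e s' := by
  obtain ⟨he, hsrc, htgt, hval, hg, hr, hv⟩ := h
  have hd : x + (y - x + d) = y + d := by rw [← add_assoc, add_tsub_cancel_of_le hxy]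
  refine ⟨he, hsrc, htgt, fun d' hd' => ?_, hd.symm ▸ hg, hd.symm ▸ hr, hv⟩
  refine Sat.of_between hx (hval d le_rfl) le_self_add ?_
  change x + d' ≤ y + d
  rw [← hd]
  gcongr

/-- Guards and invariants see a clock value only through its comparisons with the terms, which φ
preserves. Monotonicity keeps the rounded delay nonnegative, and `φ 0 = 0` makes rounding compatible
with resets. -/
theorem Step.map {φ : ℝ≥0 → ℝ≥0} (hmono : Monotone φ) (h0 : φ 0 = 0)
    (hφ : ∀ x, ∀ t ∈ A.linTerms, cmp (φ x : ℝ) (t.eval v) = cmp (x : ℝ) (t.eval v))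
    {s s' : Config Loc} {d : ℝ≥0} {e : Edge Act Loc Par} (h : A.Step v s d e s') :
    A.Step v (s.1, φ s.2) (φ (s.2 + d) - φ s.2) e (s'.1, φ s'.2) := by
  have hinv : ∀ l x, Sat x v (A.inv l) → Sat (φ x) v (A.inv l) := fun l x hx => by
    refine Sat.of_cmp (T := (fun t => LinTerm.eval t v) '' A.linTerms) ?_ ?_ hx
    · rintro _ ⟨t, ht, rfl⟩
      exact hφ x t ht
    · exact fun a ha t ht => ⟨t, Or.inl ⟨l, a, ha, ht⟩, rfl⟩
  obtain ⟨he, hsrc, htgt, hval, hg, hr, hv⟩ := h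
  have hle : φ s.2 ≤ φ (s.2 + d) := hmono le_self_add
  have hd : φ s.2 + (φ (s.2 + d) - φ s.2) = φ (s.2 + d) := add_tsub_cancel_of_le hle
  refine ⟨he, hsrc, htgt, fun d' hd' => ?_, ?_, ?_, hinv _ _ hv⟩
  · have h1 : Sat s.2 v (A.inv s.1) := by simpa [Valid] using hval 0 zero_le
    refine Sat.of_between (hinv _ _ h1) (hinv _ _ (hval d le_rfl)) le_self_add ?_
    change φ s.2 + d' ≤ φ (s.2 + d)
    rw [← hd]
    gcongr
  · change Sat (φ s.2 + _) v e.guard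
    rw [hd]
    refine Sat.of_cmp (T := (fun t => LinTerm.eval t v) '' A.linTerms) ?_ ?_ hg
    · rintro _ ⟨t, ht, rfl⟩
      exact hφ _ t ht
    · exact fun a ha t ht => ⟨t, Or.inr ⟨e, he, a, ha, ht⟩, rfl⟩
  · change φ s'.2 = if e.reset then 0 else φ s.2 + _
    rw [hd, hr]
    split_ifs <;> simp [h0]

theorem Run.map {φ : ℝ≥0 → ℝ≥0} (hmono : Monotone φ) (h0 : φ 0 = 0)
    (hφ : ∀ x, ∀ t ∈ A.linTerms, cmp (φ x : ℝ) (t.eval v) = cmp (x : ℝ) (t.eval v))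
    {s : Config Loc} (h : A.Run v π s) : A.Run v π (s.1, φ s.2) := by
  induction h with
  | init h => simpa [h0] using Run.init h
  | step _ hs ih => exact .step ih (hs.map hmono h0 hφ)

/-- The first `n` edges of an infinite sequence of edges. -/
def takeSeq (e : ℕ → Edge Act Loc Par) (n : ℕ) : List (Edge Act Loc Par) :=
  (List.range n).map e

theorem takeSeq_succ {Act Loc Par : Type} (e : ℕ → Edge Act Loc Par) (n : ℕ) :
    takeSeq e (n + 1) = takeSeq e n ++ [e n] := by
  simp [takeSeq, List.range_succ]

/-- Some infinite run follows the infinite sequence `e` of edges. -/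
def InfiniteRun (A : PTA Act Loc Par) (v : Val Par) (e : ℕ → Edge Act Loc Par) : Prop :=
  ∃ (s : ℕ → Config Loc) (d : ℕ → ℝ≥0), s 0 = (A.init, 0) ∧ A.Valid v (s 0) ∧
    ∀ i, A.Step v (s i) (d i) (e i) (s (i + 1))

/-- The runs along different prefixes need not extend each other. The smallest value reachable after
n edges can however imitate all others, so these minima form a run. With strict guards the infimum
need not be attained; rounding to finitely many representatives ensures that it is. -/
theorem infiniteRun_iff [Finite Loc] {e : ℕ → Edge Act Loc Par} :
    A.InfiniteRun v e ↔ ∀ n, A.Feasible v (takeSeq e n) := by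
  constructor
  · rintro ⟨s, d, h0, hv, hs⟩ n
    refine ⟨s n, ?_⟩
    induction n with
    | zero =>
      rw [h0] at hv ⊢
      exact .init hv
    | succ n ih =>
      rw [takeSeq_succ]
      exact .step ih (hs n)
  · intro h
    obtain ⟨φ, hmono, hfin, h0, hidem, hcmp⟩ :=
      exists_finite_representatives _ (A.finite_linTerms.image fun t => t.eval v)
    have hφ : ∀ x, ∀ t ∈ A.linTerms, cmp (φ x : ℝ) (t.eval v) = cmp (x : ℝ) (t.eval v) :=
      fun x t ht => hcmp x _ ⟨t, ht, rfl⟩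
    choose s hs using h
    have hmin : ∀ n, ∃ x ∈ {x | x ∈ Set.range φ ∧ A.Run v (takeSeq e n) ((s n).1, x)},
        ∀ y ∈ {x | x ∈ Set.range φ ∧ A.Run v (takeSeq e n) ((s n).1, x)}, x ≤ y := fun n =>
      Set.exists_min_image _ id (hfin.subset fun x hx => hx.1)
        ⟨φ (s n).2, ⟨_, rfl⟩, (hs n).map hmono h0 hφ⟩
    choose x hx hxmin using hmin
    have hstep : ∀ n, ∃ d, A.Step v ((s n).1, x n) d (e n) ((s (n + 1)).1, x (n + 1)) := by
      intro n
      have hrun := (hx (n + 1)).2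
      rw [takeSeq_succ] at hrun
      -- The minimum after n + 1 edges comes from some y after n edges. The representative of y is
      -- at least the minimum `x n`, from which the same step is therefore possible.
      obtain ⟨⟨l, y⟩, d, hy, hstep⟩ := run_snoc_iff.1 hrun
      obtain rfl : l = (s n).1 := hy.loc_eq (hs n)
      have h1 := hstep.map hmono h0 hφ
      have h2 : φ (x (n + 1)) = x (n + 1) := by
        obtain ⟨z, hz⟩ := (hx (n + 1)).1
        rw [← hz, hidem]
      simp only [h2] at h1
      exact ⟨_, h1.of_le (hxmin n _ ⟨⟨_, rfl⟩, hy.map hmono h0 hφ⟩) (hx n).2.valid⟩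
    choose d hd using hstep
    have h00 := run_nil_iff.1 (hx 0).2
    exact ⟨fun n => ((s n).1, x n), d, h00.1, h00.2, hd⟩

theorem takeSeq_length {Act Loc Par : Type} (e : ℕ → Edge Act Loc Par) (n : ℕ) : (takeSeq e n).length = n := by
  simp [takeSeq]

/-- A finite run can be extended to a maximal one. -/
theorem Feasible.exists_maximal [Finite Loc] (h : A.Feasible v π) :
    (∃ ρ, A.BlockedAfter v (π ++ ρ)) ∨
      ∃ e : ℕ → Edge Act Loc Par, A.InfiniteRun v e ∧ takeSeq e π.length = π := by
  by_contra! hcon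
  obtain ⟨hb, hinf⟩ := hcon
  -- Without a blocked continuation every feasible extension of π can be prolonged; iterating a
  -- choice of the next edge produces the infinite path.
  have hext : ∀ ρ, A.Feasible v (π ++ ρ) → ∃ e, A.Feasible v (π ++ (ρ ++ [e])) := by
    rintro ρ ⟨s, hs⟩
    have h1 : ¬ A.Blocked v s := fun h1 => hb ρ ⟨s, hs, h1⟩
    obtain ⟨d, e, s', hstep⟩ := not_not.1 h1
    exact ⟨e, s', by simpa using hs.step hstep⟩
  have : Nonempty (Edge Act Loc Par) := ⟨(hext [] (by simpa using h)).choose⟩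
  choose! next hnext using hext
  let ρ : ℕ → List (Edge Act Loc Par) := fun n => Nat.rec [] (fun _ ρ => ρ ++ [next ρ]) n
  have hρ : ∀ n, A.Feasible v (π ++ ρ n) := by
    intro n
    induction n with
    | zero => simpa [ρ] using h
    | succ n ih => exact hnext _ ih
  have hlen : ∀ n, (ρ n).length = n := by
    intro n
    induction n with
    | zero => rfl
    | succ n ih =>
      change (ρ n ++ [next (ρ n)]).length = n + 1
      simp [ih]
  let e : ℕ → Edge Act Loc Par := fun n =>
    if hn : n < π.length then π[n] else next (ρ (n - π.length))
  have hpre : takeSeq e π.length = π := by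
    refine List.ext_getElem (takeSeq_length _ _) fun i h1 h2 => ?_
    simp [takeSeq, e, h2]
  have htake : ∀ n, takeSeq e (π.length + n) = π ++ ρ n := by
    intro n
    induction n with
    | zero => simpa [ρ] using hpre
    | succ n ih =>
      rw [← add_assoc, takeSeq_succ, ih]
      change _ = π ++ (ρ n ++ [next (ρ n)])
      simp [e]
  refine hinf e (infiniteRun_iff.2 fun n => ?_) hpre
  have h1 := hρ n
  rw [← htake, takeSeq, add_comm, List.range_add, List.map_append] at h1
  exact h1.of_append

/-! ### Traces and words -/

theorem Run.finite_mem_traces {s : Config Loc} (h : A.Run v π s) :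
    Trace.finite (trace π) s.1 ∈ A.traces v .allFinite :=
  ⟨_, s, reach_iff.2 ⟨π, h, rfl⟩, rfl⟩

theorem mem_traces_allFinite {τ : Trace Act Loc} : τ ∈ A.traces v .allFinite ↔
    ∃ π s, A.Run v π s ∧ τ = .finite (trace π) s.1 := by
  constructor
  · rintro ⟨tr, s, h, rfl⟩
    obtain ⟨π, hπ, rfl⟩ := reach_iff.1 h
    exact ⟨π, s, hπ, rfl⟩
  · rintro ⟨π, s, h, rfl⟩
    exact h.finite_mem_traces

theorem mem_traces_maximal {τ : Trace Act Loc} : τ ∈ A.traces v .maximal ↔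
    (∃ π s, A.Run v π s ∧ A.Blocked v s ∧ τ = .finite (trace π) s.1) ∨
      ∃ e, A.InfiniteRun v e ∧ τ = .infinite fun i => ((e i).src, (e i).act) := by
  refine or_congr ?_ ?_
  · constructor
    · rintro ⟨tr, s, h, hb, rfl⟩
      obtain ⟨π, hπ, rfl⟩ := reach_iff.1 h
      exact ⟨π, s, hπ, hb, rfl⟩
    · rintro ⟨π, s, h, hb, rfl⟩
      exact ⟨_, s, reach_iff.2 ⟨π, h, rfl⟩, hb, rfl⟩
  · constructor
    · rintro ⟨s, d, e, h0, hv, hs, rfl⟩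
      exact ⟨e, ⟨s, d, h0, hv, hs⟩, by simp only [(hs _).2.1]⟩
    · rintro ⟨e, ⟨s, d, h0, hv, hs⟩, rfl⟩
      exact ⟨s, d, e, h0, hv, hs, by simp only [(hs _).2.1]⟩

theorem trace_map_snd {Act Loc Par : Type} (π : List (Edge Act Loc Par)) :
    (trace π).map Prod.snd = π.map Edge.act := by
  simp [trace]

theorem mem_language_allFinite {w : Word Act} : w ∈ A.language v .allFinite ↔
    ∃ π, A.Feasible v π ∧ w = .finite (π.map Edge.act) := by
  constructor
  · rintro ⟨τ, hτ, rfl⟩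
    obtain ⟨π, s, h, rfl⟩ := mem_traces_allFinite.1 hτ
    exact ⟨π, ⟨s, h⟩, by simp [Trace.word, trace_map_snd]⟩
  · rintro ⟨π, ⟨s, h⟩, rfl⟩
    exact ⟨_, mem_traces_allFinite.2 ⟨π, s, h, rfl⟩, by simp [Trace.word, trace_map_snd]⟩

theorem mem_language_maximal {w : Word Act} : w ∈ A.language v .maximal ↔
    (∃ π, A.BlockedAfter v π ∧ w = .finite (π.map Edge.act)) ∨
      ∃ e, A.InfiniteRun v e ∧ w = .infinite fun i => (e i).act := by
  constructor
  · rintro ⟨τ, hτ, rfl⟩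
    rcases mem_traces_maximal.1 hτ with ⟨π, s, h, hb, rfl⟩ | ⟨e, he, rfl⟩
    · exact Or.inl ⟨π, ⟨s, h, hb⟩, by simp [Trace.word, trace_map_snd]⟩
    · exact Or.inr ⟨e, he, rfl⟩
  · rintro (⟨π, ⟨s, h, hb⟩, rfl⟩ | ⟨e, he, rfl⟩)
    · exact ⟨_, mem_traces_maximal.2 (Or.inl ⟨π, s, h, hb, rfl⟩), by
        simp [Trace.word, trace_map_snd]⟩
    · exact ⟨_, mem_traces_maximal.2 (Or.inr ⟨e, he, rfl⟩), rfl⟩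

theorem SameRuns.symm {κ : RunKind} (h : SameRuns κ A v v') : SameRuns κ A v' v :=
  ⟨fun π => (h.1 π).symm, fun hκ π => (h.2 hκ π).symm⟩

theorem SameRuns.traces_subset [Finite Loc] {κ : RunKind} (h : SameRuns κ A v v') :
    A.traces v κ ⊆ A.traces v' κ := by
  intro τ hτ
  cases κ
  · rcases mem_traces_maximal.1 hτ with ⟨π, s, hs, hb, rfl⟩ | ⟨e, he, rfl⟩
    · obtain ⟨s', hs', hb'⟩ := (h.2 rfl π).1 ⟨s, hs, hb⟩
      rw [hs.loc_eq hs']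
      exact mem_traces_maximal.2 (Or.inl ⟨π, s', hs', hb', rfl⟩)
    · refine mem_traces_maximal.2 (Or.inr ⟨e, ?_, rfl⟩)
      rw [infiniteRun_iff] at he ⊢
      exact fun n => (h.1 _).1 (he n)
  · obtain ⟨π, s, hs, rfl⟩ := mem_traces_allFinite.1 hτ
    obtain ⟨s', hs'⟩ := (h.1 π).1 ⟨s, hs⟩
    rw [hs.loc_eq hs']
    exact hs'.finite_mem_traces

/-- For maximal runs the word of π itself need not be in the language. So π is extended to a maximal
run, and determinism identifies the path of a run under v' with the same word. -/
theorem feasible_of_language_subset [Finite Loc] (hA : A.Deterministic) {κ : RunKind}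
    (h : A.language v κ ⊆ A.language v' κ) (hπ : A.Feasible v π) : A.Feasible v' π := by
  cases κ
  · rcases hπ.exists_maximal with ⟨ρ, s, hs, hb⟩ | ⟨e, he, hpre⟩
    · rcases mem_language_maximal.1
        (h (mem_language_maximal.2 (Or.inl ⟨_, ⟨s, hs, hb⟩, rfl⟩))) with
        ⟨π', ⟨s', hs', -⟩, hw⟩ | ⟨e, -, hw⟩
      · obtain ⟨rfl, -⟩ := hs.unique hA hs' (Word.finite.inj hw)
        exact hs'.append_inv
      · cases hw
    · rcases mem_language_maximal.1 (h (mem_language_maximal.2 (Or.inr ⟨_, he, rfl⟩))) with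
        ⟨π', -, hw⟩ | ⟨e', he', hw⟩
      · cases hw
      -- Uniqueness concerns finite paths, so the two infinite words are compared on their first
      -- `π.length` letters only.
      · obtain ⟨s', hs'⟩ := infiniteRun_iff.1 he' π.length
        obtain ⟨s, hs⟩ := hπ
        rw [← hpre] at hs
        have hact : (takeSeq e π.length).map Edge.act = (takeSeq e' π.length).map Edge.act := by
          simp only [takeSeq, List.map_map]
          exact List.map_congr_left fun i _ => congrFun (Word.infinite.inj hw) i
        obtain ⟨heq, -⟩ := hs.unique hA hs' hact
        rw [← heq, hpre] at hs'
        exact ⟨s', hs'⟩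
  · obtain ⟨π', hπ', hw⟩ := mem_language_allFinite.1 (h (mem_language_allFinite.2 ⟨π, hπ, rfl⟩))
    obtain ⟨s, hs⟩ := hπ
    obtain ⟨s', hs'⟩ := hπ'
    obtain ⟨rfl, -⟩ := hs.unique hA hs' (Word.finite.inj hw)
    exact ⟨s', hs'⟩

theorem blockedAfter_of_language_subset (hA : A.Deterministic)
    (h : A.language v .maximal ⊆ A.language v' .maximal) (hπ : A.BlockedAfter v π) :
    A.BlockedAfter v' π := by
  rcases mem_language_maximal.1 (h (mem_language_maximal.2 (Or.inl ⟨π, hπ, rfl⟩))) with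
    ⟨π', hπ', hw⟩ | ⟨e, -, hw⟩
  · obtain ⟨s, hs, -⟩ := hπ
    obtain ⟨s', hs', hb⟩ := hπ'
    obtain ⟨rfl, -⟩ := hs.unique hA hs' (Word.finite.inj hw)
    exact ⟨s', hs', hb⟩
  · cases hw

theorem sameRuns_of_language_eq [Finite Loc] (hA : A.Deterministic) {κ : RunKind}
    (h : A.language v κ = A.language v' κ) : SameRuns κ A v v' := by
  refine ⟨fun π => ⟨feasible_of_language_subset hA h.subset,
    feasible_of_language_subset hA h.symm.subset⟩, ?_⟩
  rintro rfl π
  exact ⟨blockedAfter_of_language_subset hA h.subset,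
    blockedAfter_of_language_subset hA h.symm.subset⟩

/-- A circle: same runs, hence same traces, hence same language, hence same runs. Only the last
implication needs determinism. -/
theorem outcome_eq_traces [Finite Loc] (hA : A.Deterministic) (κ : RunKind) (v : Val Par) :
    A.outcome κ v = {v' | A.traces v' κ = A.traces v κ} := by
  ext v'
  rw [mem_outcome_iff]
  exact ⟨fun h => h.symm.traces_subset.antisymm h.traces_subset,
    fun h => sameRuns_of_language_eq hA (congrArg (Trace.word '' ·) h.symm)⟩

theorem outcome_eq_language [Finite Loc] (hA : A.Deterministic) (κ : RunKind) (v : Val Par) :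
    A.outcome κ v = {v' | A.language v' κ = A.language v κ} := by
  ext v'
  rw [mem_outcome_iff]
  exact ⟨fun h => congrArg (Trace.word '' ·) (h.symm.traces_subset.antisymm h.traces_subset),
    fun h => sameRuns_of_language_eq hA h.symm⟩

end PTA

end OneClock
namespace OneClock

/-! ### Primitive recursive operations on integers and lists -/

section PrimrecBasics

variable {α β γ σ : Type*} [Primcodable α] [Primcodable β] [Primcodable γ] [Primcodable σ]

theorem primrec_fst {f : α → β × γ} (hf : Primrec f) : Primrec fun a => (f a).1 :=
  Primrec.fst.comp hf

theorem primrec_snd {f : α → β × γ} (hf : Primrec f) : Primrec fun a => (f a).2 :=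
  Primrec.snd.comp hf

theorem primrec_cons {f : α → β} {g : α → List β} (hf : Primrec f) (hg : Primrec g) :
    Primrec fun a => f a :: g a :=
  Primrec.list_cons.comp hf hg

theorem primrec_append {f g : α → List β} (hf : Primrec f) (hg : Primrec g) :
    Primrec fun a => f a ++ g a :=
  Primrec.list_append.comp hf hg

theorem primrec_map {f : α → List β} {g : α → β → σ} (hf : Primrec f)
    (hg : Primrec fun p : α × β => g p.1 p.2) : Primrec fun a => (f a).map fun b => g a b :=
  Primrec.list_map hf hg.to₂

theorem primrec_flatMap {f : α → List β} {g : α → β → List σ} (hf : Primrec f)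
    (hg : Primrec fun p : α × β => g p.1 p.2) : Primrec fun a => (f a).flatMap fun b => g a b :=
  Primrec.list_flatMap hf hg.to₂

theorem primrec_ite {c : α → Prop} [DecidablePred c] {f g : α → σ} (hc : PrimrecPred c)
    (hf : Primrec f) (hg : Primrec g) : Primrec fun a => if c a then f a else g a :=
  Primrec.ite hc hf hg

theorem primrecPred_eq [DecidableEq β] {f g : α → β} (hf : Primrec f) (hg : Primrec g) :
    PrimrecPred fun a => f a = g a :=
  PrimrecRel.comp Primrec.eq hf hg

theorem primrecPred_nat_lt {f g : α → ℕ} (hf : Primrec f) (hg : Primrec g) :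
    PrimrecPred fun a => f a < g a :=
  PrimrecRel.comp Primrec.nat_lt hf hg

theorem primrecPred_not {p : α → Prop} (hp : PrimrecPred p) : PrimrecPred fun a => ¬ p a := hp.not

theorem primrecPred_and {p q : α → Prop} (hp : PrimrecPred p) (hq : PrimrecPred q) :
    PrimrecPred fun a => p a ∧ q a := hp.and hq

theorem primrecPred_forall {f : α → List β} {p : α → β → Prop} (hf : Primrec f)
    (hp : PrimrecPred fun q : α × β => p q.1 q.2) : PrimrecPred fun a => ∀ b ∈ f a, p a b := by
  have h : PrimrecRel fun (b : β) (a : α) => p a b :=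
    (hp.comp (Primrec.pair Primrec.snd Primrec.fst)).primrecRel
  exact h.forall_mem_list.comp hf Primrec.id

theorem primrecPred_exists {f : α → List β} {p : α → β → Prop} (hf : Primrec f)
    (hp : PrimrecPred fun q : α × β => p q.1 q.2) : PrimrecPred fun a => ∃ b ∈ f a, p a b := by
  have h : PrimrecRel fun (b : β) (a : α) => p a b :=
    (hp.comp (Primrec.pair Primrec.snd Primrec.fst)).primrecRel
  exact h.exists_mem_list.comp hf Primrec.id

theorem primrec_filter {f : α → List β} {p : α → β → Prop} [∀ a, DecidablePred (p a)]
    (hf : Primrec f) (hp : PrimrecPred fun q : α × β => p q.1 q.2) :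
    Primrec fun a => (f a).filter fun b => p a b := by
  have h : Primrec fun a => (f a).flatMap fun b => if p a b then [b] else [] :=
    primrec_flatMap hf (primrec_ite hp (primrec_cons Primrec.snd (Primrec.const [])) (Primrec.const []))
  refine h.of_eq fun a => ?_
  induction f a with
  | nil => rfl
  | cons b l ih =>
    rw [List.flatMap_cons, ih, List.filter_cons]
    by_cases hb : p a b <;> simp [hb]

open Encodable in
-- Nonnegative integers have even codes and negative ones odd codes. So the positive and negative
-- parts are primitive recursive, and integer arithmetic reduces to arithmetic on natural numbers.
theorem encode_int (z : ℤ) : encode z = if 0 ≤ z then 2 * z.toNat else 2 * (-z).toNat - 1 := by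
  cases z with
  | ofNat n => simp; rfl
  | negSucc n =>
    have : ¬ (0 ≤ Int.negSucc n) := by simp
    rw [if_neg this]
    change 2 * n + 1 = 2 * (n + 1) - 1
    omega

theorem primrec_toNat {f : α → ℤ} (hf : Primrec f) : Primrec fun a => (f a).toNat := by
  have h : Primrec Int.toNat := by
    have h1 : Primrec fun z : ℤ => if Encodable.encode z % 2 = 0 then Encodable.encode z / 2 else 0 :=
      primrec_ite (primrecPred_eq (Primrec.nat_mod.comp Primrec.encode (Primrec.const 2))
        (Primrec.const 0)) (Primrec.nat_div.comp Primrec.encode (Primrec.const 2)) (Primrec.const 0)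
    refine h1.of_eq fun z => ?_
    rw [encode_int]
    split_ifs <;> omega
  exact h.comp hf

theorem primrec_nat_sub {f g : α → ℕ} (hf : Primrec f) (hg : Primrec g) :
    Primrec fun a => (f a : ℤ) - (g a : ℤ) := by
  have h : Primrec fun p : ℕ × ℕ => (p.1 : ℤ) - (p.2 : ℤ) := by
    rw [← Primrec.encode_iff]
    have h1 : Primrec fun p : ℕ × ℕ => if p.1 < p.2 then 2 * (p.2 - p.1) - 1 else 2 * (p.1 - p.2) :=
      primrec_ite (primrecPred_nat_lt Primrec.fst Primrec.snd)
        (Primrec.nat_sub.comp (Primrec.nat_mul.comp (Primrec.const 2)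
          (Primrec.nat_sub.comp Primrec.snd Primrec.fst)) (Primrec.const 1))
        (Primrec.nat_mul.comp (Primrec.const 2) (Primrec.nat_sub.comp Primrec.fst Primrec.snd))
    refine h1.of_eq fun p => ?_
    rw [encode_int]
    split_ifs <;> omega
  exact h.comp (Primrec.pair hf hg)

theorem primrec_natCast {f : α → ℕ} (hf : Primrec f) : Primrec fun a => (f a : ℤ) :=
  (primrec_nat_sub hf (Primrec.const 0)).of_eq fun a => by simp

theorem primrec_neg_toNat {f : α → ℤ} (hf : Primrec f) : Primrec fun a => (-f a).toNat := by
  have h : Primrec fun z : ℤ => (-z).toNat := by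
    have h1 : Primrec fun z : ℤ => if Encodable.encode z % 2 = 0 then 0
        else (Encodable.encode z + 1) / 2 :=
      primrec_ite (primrecPred_eq (Primrec.nat_mod.comp Primrec.encode (Primrec.const 2))
        (Primrec.const 0)) (Primrec.const 0)
        (Primrec.nat_div.comp (Primrec.succ.comp Primrec.encode) (Primrec.const 2))
    refine h1.of_eq fun z => ?_
    rw [encode_int]
    split_ifs <;> omega
  exact h.comp hf

theorem primrec_int_neg {f : α → ℤ} (hf : Primrec f) : Primrec fun a => -f a :=
  (primrec_nat_sub (primrec_neg_toNat hf) (primrec_toNat hf)).of_eq fun a => by omega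

theorem primrec_int_add {f g : α → ℤ} (hf : Primrec f) (hg : Primrec g) :
    Primrec fun a => f a + g a :=
  (primrec_nat_sub (Primrec.nat_add.comp (primrec_toNat hf) (primrec_toNat hg))
    (Primrec.nat_add.comp (primrec_neg_toNat hf) (primrec_neg_toNat hg))).of_eq fun a => by
      push_cast; omega

theorem primrec_int_mul {f g : α → ℤ} (hf : Primrec f) (hg : Primrec g) :
    Primrec fun a => f a * g a :=
  (primrec_nat_sub
    (Primrec.nat_add.comp (Primrec.nat_mul.comp (primrec_toNat hf) (primrec_toNat hg))
      (Primrec.nat_mul.comp (primrec_neg_toNat hf) (primrec_neg_toNat hg)))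
    (Primrec.nat_add.comp (Primrec.nat_mul.comp (primrec_toNat hf) (primrec_neg_toNat hg))
      (Primrec.nat_mul.comp (primrec_neg_toNat hf) (primrec_toNat hg)))).of_eq fun a => by
      have h1 : f a = ((f a).toNat : ℤ) - ((-f a).toNat : ℤ) := by omega
      have h2 : g a = ((g a).toNat : ℤ) - ((-g a).toNat : ℤ) := by omega
      conv_rhs => rw [h1, h2]
      push_cast
      ring

theorem primrecPred_int_pos {f : α → ℤ} (hf : Primrec f) : PrimrecPred fun a => 0 < f a :=
  (primrecPred_nat_lt (Primrec.const 0) (primrec_toNat hf)).of_eq fun a => by omega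

theorem primrecPred_int_neg {f : α → ℤ} (hf : Primrec f) : PrimrecPred fun a => f a < 0 :=
  (primrecPred_nat_lt (Primrec.const 0) (primrec_neg_toNat hf)).of_eq fun a => by omega

theorem primrecPred_int_nonpos {f : α → ℤ} (hf : Primrec f) : PrimrecPred fun a => f a ≤ 0 :=
  (primrecPred_int_pos hf).not.of_eq fun _ => not_lt

theorem primrec_getD {f : α → List β} {g : α → ℕ} (d : β) (hf : Primrec f) (hg : Primrec g) :
    Primrec fun a => (f a).getD (g a) d :=
  (Primrec.list_getD d).comp hf hg

theorem primrec_bool_not {f : α → Bool} (hf : Primrec f) : Primrec fun a => !f a :=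
  Primrec.not.comp hf

theorem primrec_bool_or {f g : α → Bool} (hf : Primrec f) (hg : Primrec g) :
    Primrec fun a => f a || g a :=
  Primrec.or.comp hf hg

end PrimrecBasics

/-! ### Linear inequalities on codes -/

/-- The linear combination `m * s + n * t` of two coded terms. -/
def termComb (m n : ℤ) (s t : TermCode) : TermCode :=
  ((List.range (max s.1.length t.1.length)).map fun i => m * s.1.getD i 0 + n * t.1.getD i 0,
    m * s.2 + n * t.2)

/-- The coefficient of the first variable. -/
def termHead (t : TermCode) : ℤ := t.1.getD 0 0

/-- The term without its first variable. -/
def termTail (t : TermCode) : TermCode := (t.1.tail, t.2)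

/-- The term with a new first variable, which has the coefficient `a`. -/
def termCons (a : ℤ) (t : TermCode) : TermCode := (a :: t.1, t.2)

/-- Codes of strict and weak inequalities between a linear term and `0`. -/
abbrev Lit := Bool × TermCode

/-- The negation of an inequality. -/
def litNot (c : Lit) : Lit := (!c.1, termComb (-1) 0 c.2 c.2)

/-- The inequalities equivalent to a coded comparison with `0`. -/
def cmpLits (c : ℕ × TermCode) : List Lit :=
  if c.1 = 0 then [(true, c.2)]
  else if c.1 = 1 then [(false, c.2)]
  else if c.1 = 2 then [(false, c.2), (false, termComb (-1) 0 c.2 c.2)]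
  else if c.1 = 3 then [(false, termComb (-1) 0 c.2 c.2)]
  else [(true, termComb (-1) 0 c.2 c.2)]

/-- The comparison with `0` given by an inequality. -/
def litCmp (c : Lit) : ℕ × TermCode := (if c.1 = true then 0 else 1, c.2)

/-- The weak inequality between a term with the given coefficients and `0`. -/
def weak (as : List ℤ) : Lit := (false, as, 0)

/-- Elimination of the first variable, which is nonnegative. -/
def elimHead (cs : List Lit) : List Lit :=
  ((weak [-1] :: cs).flatMap fun c => if termHead c.2 = 0 then [(c.1, termTail c.2)] else []) ++
  (weak [-1] :: cs).flatMap fun c => (weak [-1] :: cs).flatMap fun d =>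
    if 0 < termHead c.2 ∧ termHead d.2 < 0 then
      [(c.1 || d.1, termComb (termHead c.2) (-termHead d.2) (termTail d.2) (termTail c.2))] else []

/-- The truth of an inequality when all variables are `0`. -/
def LitConst (c : Lit) : Prop := if c.1 = true then c.2.2 < 0 else c.2.2 ≤ 0

instance : DecidablePred LitConst := fun c => by unfold LitConst; infer_instance

/-- Satisfiability of a conjunction of inequalities in `n` nonnegative variables. -/
def Satisfiable (n : ℕ) (cs : List Lit) : Prop := ∀ c ∈ elimHead^[n] cs, LitConst c

instance (n : ℕ) : DecidablePred (Satisfiable n) := fun c => by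
  unfold Satisfiable; infer_instance

/-- Substitution of the fraction `p.1 / p.2` for the first variable. -/
def litSubst (p : ℕ × ℕ) (c : Lit) : Lit :=
  (c.1, termComb p.2 p.1 (termTail c.2) ([], termHead c.2))

/-- The truth of a conjunction of inequalities under a coded valuation. -/
def ConjTrue (v : ValCode) (D : List Lit) : Prop :=
  ∀ c ∈ v.foldl (fun D p => D.map fun c => litSubst p c) D, LitConst c

instance (v : ValCode) : DecidablePred (ConjTrue v) := fun c => by
  unfold ConjTrue; infer_instance

/-- Codes of disjunctions of conjunctions of inequalities. -/
abbrev DNF := List (List Lit)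

/-- The truth of a disjunction of conjunctions of inequalities under a coded valuation. -/
def DnfTrue (v : ValCode) (F : DNF) : Prop := ∃ D ∈ F, ConjTrue v D

instance (v : ValCode) : DecidablePred (DnfTrue v) := fun c => by
  unfold DnfTrue; infer_instance

/-- Conjunction of two disjunctions. -/
def dnfAnd (F G : DNF) : DNF := F.flatMap fun D => G.map fun E => D ++ E

/-- Conjunction of a list of disjunctions. -/
def dnfAll (Fs : List DNF) : DNF := Fs.foldr (fun F G => dnfAnd F G) [[]]

/-- Negation. -/
def dnfNot (F : DNF) : DNF := dnfAll (F.map fun D => D.map fun c => [litNot c])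

/-- The constraint `F` if it is true under `v`, and its negation otherwise. -/
def dnfAgree (v : ValCode) (F : DNF) : DNF := if DnfTrue v F then F else dnfNot F

section PrimrecLinear

variable {α : Type*} [Primcodable α]

theorem primrec_termComb {m n : α → ℤ} {s t : α → TermCode} (hm : Primrec m) (hn : Primrec n)
    (hs : Primrec s) (ht : Primrec t) : Primrec fun a => termComb (m a) (n a) (s a) (t a) := by
  refine Primrec.pair (primrec_map (Primrec.list_range.comp (Primrec.nat_max.comp
    (Primrec.list_length.comp (primrec_fst hs)) (Primrec.list_length.comp (primrec_fst ht)))) ?_) ?_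
  · have h (f : α → ℤ) (hf : Primrec f) : Primrec fun p : α × ℕ => f p.1 := hf.comp Primrec.fst
    have h' (f : α → TermCode) (hf : Primrec f) : Primrec fun p : α × ℕ => (f p.1).1.getD p.2 0 :=
      primrec_getD 0 (primrec_fst (hf.comp Primrec.fst)) Primrec.snd
    exact primrec_int_add (primrec_int_mul (h m hm) (h' s hs)) (primrec_int_mul (h n hn) (h' t ht))
  · exact primrec_int_add (primrec_int_mul hm (primrec_snd hs)) (primrec_int_mul hn (primrec_snd ht))

theorem primrec_termHead {t : α → TermCode} (ht : Primrec t) : Primrec fun a => termHead (t a) :=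
  primrec_getD 0 (primrec_fst ht) (Primrec.const 0)

theorem primrec_termTail {t : α → TermCode} (ht : Primrec t) : Primrec fun a => termTail (t a) :=
  Primrec.pair (Primrec.list_tail.comp (primrec_fst ht)) (primrec_snd ht)

theorem primrec_termCons {m : α → ℤ} {t : α → TermCode} (hm : Primrec m) (ht : Primrec t) :
    Primrec fun a => termCons (m a) (t a) :=
  Primrec.pair (primrec_cons hm (primrec_fst ht)) (primrec_snd ht)

theorem primrec_termNeg {t : α → TermCode} (ht : Primrec t) :
    Primrec fun a => termComb (-1) 0 (t a) (t a) :=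
  primrec_termComb (Primrec.const _) (Primrec.const _) ht ht

theorem primrec_litNot {c : α → Lit} (hc : Primrec c) : Primrec fun a => litNot (c a) :=
  Primrec.pair (primrec_bool_not (primrec_fst hc)) (primrec_termNeg (primrec_snd hc))

theorem primrec_cmpLits {c : α → ℕ × TermCode} (hc : Primrec c) :
    Primrec fun a => cmpLits (c a) := by
  have h : ∀ n : ℕ, PrimrecPred fun a => (c a).1 = n := fun n =>
    primrecPred_eq (primrec_fst hc) (Primrec.const n)
  have hp : ∀ b : Bool, Primrec fun a => (b, (c a).2) := fun b =>
    Primrec.pair (Primrec.const b) (primrec_snd hc)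
  have hn : ∀ b : Bool, Primrec fun a => (b, termComb (-1) 0 (c a).2 (c a).2) := fun b =>
    Primrec.pair (Primrec.const b) (primrec_termNeg (primrec_snd hc))
  have hnil : Primrec fun _ : α => ([] : List Lit) := Primrec.const _
  exact primrec_ite (h 0) (primrec_cons (hp _) hnil) <|
    primrec_ite (h 1) (primrec_cons (hp _) hnil) <|
    primrec_ite (h 2) (primrec_cons (hp _) (primrec_cons (hn _) hnil)) <|
    primrec_ite (h 3) (primrec_cons (hn _) hnil) (primrec_cons (hn _) hnil)

theorem primrec_litCmp {c : α → Lit} (hc : Primrec c) : Primrec fun a => litCmp (c a) :=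
  Primrec.pair (primrec_ite (primrecPred_eq (primrec_fst hc) (Primrec.const true))
    (Primrec.const 0) (Primrec.const 1)) (primrec_snd hc)

theorem primrec_elimHead {cs : α → List Lit} (hcs : Primrec cs) :
    Primrec fun a => elimHead (cs a) := by
  have hnil {β : Type _} [Primcodable β] : Primrec fun _ : β => ([] : List Lit) := Primrec.const _
  have hds : Primrec fun a => weak [-1] :: cs a := primrec_cons (Primrec.const _) hcs
  have hc : Primrec fun p : α × Lit => p.2 := Primrec.snd
  have hc' : Primrec fun p : (α × Lit) × Lit => p.1.2 := Primrec.snd.comp Primrec.fst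
  have hd' : Primrec fun p : (α × Lit) × Lit => p.2 := Primrec.snd
  refine primrec_append (primrec_flatMap hds ?_) (primrec_flatMap hds (primrec_flatMap
    (hds.comp Primrec.fst) ?_))
  · exact primrec_ite (primrecPred_eq (primrec_termHead (primrec_snd hc)) (Primrec.const 0))
      (primrec_cons (Primrec.pair (primrec_fst hc) (primrec_termTail (primrec_snd hc))) hnil) hnil
  · have hhc := primrec_termHead (primrec_snd hc')
    have hhd := primrec_termHead (primrec_snd hd')
    exact primrec_ite (primrecPred_and (primrecPred_int_pos hhc) (primrecPred_int_neg hhd))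
      (primrec_cons (Primrec.pair (primrec_bool_or (primrec_fst hc') (primrec_fst hd'))
        (primrec_termComb hhc (primrec_int_neg hhd) (primrec_termTail (primrec_snd hd'))
          (primrec_termTail (primrec_snd hc')))) hnil) hnil

theorem primrecPred_litConst {c : α → Lit} (hc : Primrec c) : PrimrecPred fun a => LitConst (c a) := by
  have h : PrimrecPred fun a => ((c a).1 = true ∧ (c a).2.2 < 0) ∨
      (¬ (c a).1 = true ∧ (c a).2.2 ≤ 0) :=
    (primrecPred_and (primrecPred_eq (primrec_fst hc) (Primrec.const true))
      (primrecPred_int_neg (primrec_snd (primrec_snd hc)))).or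
    (primrecPred_and (primrecPred_eq (primrec_fst hc) (Primrec.const true)).not
      (primrecPred_int_nonpos (primrec_snd (primrec_snd hc))))
  refine h.of_eq fun a => ?_
  unfold LitConst
  split_ifs with h <;> simp [h]

theorem primrecPred_satisfiable {n : α → ℕ} {cs : α → List Lit} (hn : Primrec n)
    (hcs : Primrec cs) : PrimrecPred fun a => Satisfiable (n a) (cs a) :=
  primrecPred_forall (Primrec.nat_iterate hn hcs (primrec_elimHead Primrec.snd).to₂)
    (primrecPred_litConst Primrec.snd)

theorem primrec_litSubst {p : α → ℕ × ℕ} {c : α → Lit} (hp : Primrec p) (hc : Primrec c) :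
    Primrec fun a => litSubst (p a) (c a) :=
  Primrec.pair (primrec_fst hc) (primrec_termComb (primrec_natCast (primrec_snd hp))
    (primrec_natCast (primrec_fst hp)) (primrec_termTail (primrec_snd hc))
    (Primrec.pair (Primrec.const []) (primrec_termHead (primrec_snd hc))))

theorem primrecPred_conjTrue {v : α → ValCode} {D : α → List Lit} (hv : Primrec v)
    (hD : Primrec D) : PrimrecPred fun a => ConjTrue (v a) (D a) := by
  have h : Primrec fun q : α × List Lit × (ℕ × ℕ) => q.2.1.map fun c => litSubst q.2.2 c :=
    primrec_map (primrec_fst Primrec.snd)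
      (primrec_litSubst (primrec_snd (primrec_snd Primrec.fst)) Primrec.snd)
  exact primrecPred_forall (Primrec.list_foldl hv hD h.to₂) (primrecPred_litConst Primrec.snd)

theorem primrecPred_dnfTrue {v : α → ValCode} {F : α → DNF} (hv : Primrec v)
    (hF : Primrec F) : PrimrecPred fun a => DnfTrue (v a) (F a) :=
  primrecPred_exists hF (primrecPred_conjTrue (hv.comp Primrec.fst) Primrec.snd)

theorem primrec_dnfAnd {F G : α → DNF} (hF : Primrec F) (hG : Primrec G) :
    Primrec fun a => dnfAnd (F a) (G a) :=
  primrec_flatMap hF (primrec_map (hG.comp Primrec.fst)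
    (primrec_append (Primrec.snd.comp Primrec.fst) Primrec.snd))

theorem primrec_dnfAll {Fs : α → List DNF} (hFs : Primrec Fs) :
    Primrec fun a => dnfAll (Fs a) :=
  Primrec.list_foldr hFs (Primrec.const [[]])
    (primrec_dnfAnd (primrec_fst Primrec.snd) (primrec_snd Primrec.snd)).to₂

theorem primrec_dnfNot {F : α → DNF} (hF : Primrec F) : Primrec fun a => dnfNot (F a) :=
  primrec_dnfAll (primrec_map hF (primrec_map Primrec.snd
    (primrec_cons (primrec_litNot Primrec.snd) (Primrec.const []))))

theorem primrec_dnfAgree {v : α → ValCode} {F : α → DNF} (hv : Primrec v) (hF : Primrec F) :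
    Primrec fun a => dnfAgree (v a) (F a) :=
  primrec_ite (primrecPred_dnfTrue hv hF) hF (primrec_dnfNot hF)

end PrimrecLinear

end OneClock
namespace OneClock

/-! ### Evaluation of coded inequalities -/

section Evaluation

variable {K : Type*} [Field K]

/-- The value of a coded term when the variables have the values `ρ`. -/
def termVal (t : TermCode) (ρ : ℕ → K) : K :=
  (∑ i ∈ Finset.range t.1.length, (t.1.getD i 0 : K) * ρ i) + t.2

/-- The sequence of values with the new first value `x`. -/
def consEnv (x : K) (ρ : ℕ → K) (i : ℕ) : K := Nat.casesOn i x ρ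

@[simp]
theorem consEnv_zero {K : Type*} (x : K) (ρ : ℕ → K) : consEnv x ρ 0 = x := rfl

@[simp]
theorem consEnv_succ {K : Type*} (x : K) (ρ : ℕ → K) (i : ℕ) : consEnv x ρ (i + 1) = ρ i := rfl

theorem termVal_eq_sum (t : TermCode) (ρ : ℕ → K) {n : ℕ} (hn : t.1.length ≤ n) :
    termVal t ρ = (∑ i ∈ Finset.range n, (t.1.getD i 0 : K) * ρ i) + t.2 := by
  rw [termVal, Finset.sum_subset (Finset.range_mono hn)]
  intro i _ hi
  rw [Finset.mem_range, not_lt] at hi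
  rw [List.getD_eq_default _ _ hi, Int.cast_zero, zero_mul]

theorem termVal_termComb (m n : ℤ) (s t : TermCode) (ρ : ℕ → K) :
    termVal (termComb m n s t) ρ = m * termVal s ρ + n * termVal t ρ := by
  rw [termVal_eq_sum s ρ (le_max_left _ t.1.length), termVal_eq_sum t ρ (le_max_right s.1.length _),
    termVal]
  have hlen : (termComb m n s t).1.length = max s.1.length t.1.length := by simp [termComb]
  rw [hlen, mul_add, mul_add, Finset.mul_sum, Finset.mul_sum, add_add_add_comm,
    ← Finset.sum_add_distrib]
  congr 1
  · refine Finset.sum_congr rfl fun i hi => ?_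
    have h : (termComb m n s t).1.getD i 0 = m * s.1.getD i 0 + n * t.1.getD i 0 := by
      rw [Finset.mem_range] at hi
      rw [List.getD_eq_getElem _ _ (hlen ▸ hi)]
      simp [termComb]
    rw [h]
    push_cast
    ring
  · simp [termComb]

theorem termVal_neg (t : TermCode) (ρ : ℕ → K) : termVal (termComb (-1) 0 t t) ρ = -termVal t ρ := by
  simp [termVal_termComb]

theorem termVal_head_tail (t : TermCode) (ρ : ℕ → K) :
    termVal t ρ = termHead t * ρ 0 + termVal (termTail t) fun i => ρ (i + 1) := by
  rw [termVal_eq_sum t ρ (n := t.1.tail.length + 1) (by simp [List.length_tail]; omega),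
    Finset.sum_range_succ', termVal]
  have h : ∀ i, t.1.tail.getD i 0 = t.1.getD (i + 1) 0 := fun i => by
    cases t.1 <;> simp
  simp only [termTail, termHead, h]
  ring

theorem termVal_termCons (a : ℤ) (t : TermCode) (ρ : ℕ → K) :
    termVal (termCons a t) ρ = a * ρ 0 + termVal t fun i => ρ (i + 1) := by
  rw [termVal_head_tail]
  rfl

theorem termVal_nil (c : ℤ) (ρ : ℕ → K) : termVal ([], c) ρ = c := by
  simp [termVal]

theorem termVal_zero (t : TermCode) : termVal t (fun _ => (0 : K)) = t.2 := by
  simp [termVal]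

variable [LinearOrder K]

/-- The truth of an inequality when the variables have the values `ρ`. -/
def LitHolds (ρ : ℕ → K) (c : Lit) : Prop := Neg c.1 (termVal c.2 ρ)

/-- The truth of a conjunction of inequalities. -/
def ConjHolds (ρ : ℕ → K) (D : List Lit) : Prop := ∀ c ∈ D, LitHolds ρ c

/-- The truth of a disjunction of conjunctions of inequalities. -/
def DnfHolds (ρ : ℕ → K) (F : DNF) : Prop := ∃ D ∈ F, ConjHolds ρ D

theorem litHolds_weak_cons (ρ : ℕ → K) (a : ℤ) (as : List ℤ) : LitHolds ρ (weak (a :: as)) ↔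
    a * ρ 0 + termVal (as, 0) (fun i => ρ (i + 1)) ≤ 0 := by
  rw [LitHolds, weak, show ((a :: as, 0) : TermCode) = termCons a (as, 0) from rfl,
    termVal_termCons]
  simp [Neg]

theorem conjHolds_append (ρ : ℕ → K) (D E : List Lit) :
    ConjHolds ρ (D ++ E) ↔ ConjHolds ρ D ∧ ConjHolds ρ E :=
  List.forall_mem_append

theorem conjHolds_cons (ρ : ℕ → K) (c : Lit) (D : List Lit) :
    ConjHolds ρ (c :: D) ↔ LitHolds ρ c ∧ ConjHolds ρ D :=
  List.forall_mem_cons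

variable [IsStrictOrderedRing K]

theorem litHolds_litNot (ρ : ℕ → K) (c : Lit) : LitHolds ρ (litNot c) ↔ ¬ LitHolds ρ c := by
  rw [LitHolds, LitHolds, litNot, termVal_neg, neg_not_iff]

/-- The literal `weak [-1]` expresses that the eliminated variable is nonnegative and supplies the
lower bound that `exists_forall_neg_iff` requires. The multipliers are coefficients, so no division
occurs; the output does not depend on the field. -/
theorem conjHolds_elimHead (ρ : ℕ → K) (cs : List Lit) :
    ConjHolds ρ (elimHead cs) ↔ ∃ x : K, 0 ≤ x ∧ ConjHolds (consEnv x ρ) cs := by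
  let ds := weak [-1] :: cs
  have h1 : (∃ x : K, 0 ≤ x ∧ ConjHolds (consEnv x ρ) cs) ↔ ∃ x : K, ∀ c : {c // c ∈ ds},
      Neg c.1.1 ((termHead c.1.2 : K) * x + termVal (termTail c.1.2) ρ) := by
    refine exists_congr fun x => ?_
    have : (0 ≤ x ∧ ConjHolds (consEnv x ρ) cs) ↔ ConjHolds (consEnv x ρ) ds := by
      rw [conjHolds_cons, litHolds_weak_cons]
      simp [consEnv, termVal_nil]
    rw [this, ConjHolds, Subtype.forall]
    refine forall₂_congr fun c _ => ?_
    rw [LitHolds, termVal_head_tail]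
    rfl
  rw [h1, exists_forall_neg_iff (fun c : {c // c ∈ ds} => c.1.1) _ _
    ⟨⟨weak [-1], List.mem_cons_self⟩, by simp [weak, termHead]⟩, elimHead, conjHolds_append]
  simp only [ConjHolds, List.forall_mem_flatMap, Subtype.forall, Int.cast_eq_zero, Int.cast_pos,
    Int.cast_lt_zero]
  refine and_congr (forall₂_congr fun c _ => ?_) ⟨fun h c hc d hd hc' hd' => ?_,
    fun h c hc d hd => ?_⟩
  · split_ifs with h
    · simp [h, LitHolds]
    · simp [h]
  · have := h c hc d hd
    rw [if_pos ⟨hc', hd'⟩] at this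
    simpa [LitHolds, termVal_termComb] using this
  · split_ifs with h'
    · have := h c hc d hd h'.1 h'.2
      simpa [LitHolds, termVal_termComb] using this
    · simp

end Evaluation

end OneClock
namespace OneClock

/-! ### Satisfiability and evaluation -/

theorem neg_ratCast (b : Bool) (x : ℚ) : Neg b (x : ℝ) ↔ Neg b x := by
  cases b <;> simp [Neg]

theorem termVal_ratCast (t : TermCode) (ρ : ℕ → ℚ) :
    termVal t (fun i => (ρ i : ℝ)) = ((termVal t ρ : ℚ) : ℝ) := by
  simp [termVal]

theorem conjHolds_ratCast (ρ : ℕ → ℚ) (D : List Lit) :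
    ConjHolds (fun i => (ρ i : ℝ)) D ↔ ConjHolds ρ D :=
  forall₂_congr fun c _ => by rw [LitHolds, LitHolds, termVal_ratCast, neg_ratCast]

theorem consEnv_head_tail {K : Type*} (ρ : ℕ → K) : consEnv (ρ 0) (fun i => ρ (i + 1)) = ρ := by
  funext i
  cases i <;> rfl

theorem litConst_iff (c : Lit) : LitConst c ↔ LitHolds (fun _ => (0 : ℚ)) c := by
  rw [LitConst, LitHolds, termVal_zero, Neg]
  split_ifs <;> simp

/-- Each round eliminates one nonnegative variable. After n rounds the remaining variables are 0 and
the constants decide. -/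
theorem satisfiable_iff (n : ℕ) (cs : List Lit) : Satisfiable n cs ↔
    ∃ ρ : ℕ → ℚ, (∀ i, 0 ≤ ρ i) ∧ (∀ i ≥ n, ρ i = 0) ∧ ConjHolds ρ cs := by
  induction n generalizing cs with
  | zero =>
    have h : Satisfiable 0 cs ↔ ConjHolds (fun _ => (0 : ℚ)) cs :=
      forall₂_congr fun c _ => litConst_iff c
    rw [h]
    constructor
    · exact fun h => ⟨_, fun _ => le_rfl, fun _ _ => rfl, h⟩
    · rintro ⟨ρ, -, h0, h⟩
      rwa [show ρ = fun _ => 0 from funext fun i => h0 i (Nat.zero_le _)] at h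
  | succ n ih =>
    have h : Satisfiable (n + 1) cs ↔ Satisfiable n (elimHead cs) := by
      simp only [Satisfiable, Function.iterate_succ_apply]
    rw [h, ih]
    constructor
    · rintro ⟨ρ, hpos, h0, hρ⟩
      obtain ⟨x, hx, hcs⟩ := (conjHolds_elimHead ρ cs).1 hρ
      refine ⟨consEnv x ρ, ?_, ?_, hcs⟩
      · rintro (_ | i)
        exacts [hx, hpos i]
      · rintro (_ | i) hi
        · omega
        · exact h0 i (by omega)
    · rintro ⟨ρ, hpos, h0, hρ⟩
      refine ⟨fun i => ρ (i + 1), fun i => hpos _, fun i hi => h0 _ (by omega), ?_⟩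
      exact (conjHolds_elimHead _ cs).2 ⟨ρ 0, hpos 0, by rwa [consEnv_head_tail]⟩

variable {k l a : ℕ}

/-- The values of the variables under a valuation of `k` parameters. -/
def env (v : Val (Fin k)) (i : ℕ) : ℚ := if h : i < k then (v ⟨i, h⟩ : ℚ) else 0

theorem env_nonneg (v : Val (Fin k)) (i : ℕ) : 0 ≤ env v i := by
  unfold env
  split_ifs
  exacts [NNRat.coe_nonneg _, le_rfl]

theorem env_apply (v : Val (Fin k)) (i : Fin k) : env v i = (v i : ℚ) := by
  simp [env]

theorem env_of_le (v : Val (Fin k)) {i : ℕ} (hi : k ≤ i) : env v i = 0 := by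
  simp [env, hi]

theorem exists_env_eq {ρ : ℕ → ℚ} (hpos : ∀ i, 0 ≤ ρ i) (h0 : ∀ i ≥ k, ρ i = 0) :
    ∃ v : Val (Fin k), env v = ρ := by
  refine ⟨fun i => ⟨ρ i, hpos i⟩, funext fun i => ?_⟩
  unfold env
  split_ifs with h
  · rfl
  · exact (h0 i (not_lt.1 h)).symm

/-- The inequality is multiplied by the positive denominator, which keeps the coefficients integral.
-/
theorem litHolds_litSubst {q : ℚ≥0} (ρ : ℕ → ℚ) (c : Lit) :
    LitHolds ρ (litSubst (q.num, q.den) c) ↔ LitHolds (consEnv (q : ℚ) ρ) c := by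
  have hden : (0 : ℚ) < q.den := by exact_mod_cast q.den_pos
  have hq : (q.den : ℚ) * (q : ℚ) = q.num := by exact_mod_cast q.den_mul_eq_num
  rw [LitHolds, LitHolds, litSubst, termVal_termComb, termVal_nil, termVal_head_tail c.2,
    ← neg_mul_iff (b := c.1) (x := _ + termVal _ fun i => consEnv (q : ℚ) ρ (i + 1)) hden]
  have : (q.den : ℚ) * ((termHead c.2 : ℚ) * consEnv (q : ℚ) ρ 0 +
      termVal (termTail c.2) fun i => consEnv (q : ℚ) ρ (i + 1)) =
      ((q.den : ℤ) : ℚ) * termVal (termTail c.2) ρ + ((q.num : ℤ) : ℚ) * (termHead c.2 : ℚ) := by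
    push_cast
    rw [← hq]
    simp only [consEnv_zero, consEnv_succ]
    ring
  rw [this]

theorem conjTrue_iff (v : Val (Fin k)) (D : List Lit) :
    ConjTrue (valCode v) D ↔ ConjHolds (env v) D := by
  induction k generalizing D with
  | zero =>
    have h : env v = fun _ => 0 := funext fun i => env_of_le v (Nat.zero_le i)
    rw [h]
    exact forall₂_congr fun c _ => litConst_iff c
  | succ k ih =>
    have h1 : valCode v = ((v 0).num, (v 0).den) :: valCode fun i => v i.succ := by
      simp [valCode, List.ofFn_succ]
    have h2 : env v = consEnv ((v 0 : ℚ≥0) : ℚ) (env fun i => v i.succ) := by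
      funext i
      cases i <;> simp [env]

    have h3 : ConjTrue (valCode v) D ↔ ConjTrue (valCode fun i => v i.succ)
        (D.map fun c => litSubst ((v 0).num, (v 0).den) c) := by
      rw [ConjTrue, h1]
      rfl
    rw [h3, ih, h2]
    simp only [ConjHolds, List.forall_mem_map, litHolds_litSubst]

section Boolean

variable {K : Type*} [Field K] [LinearOrder K]

theorem dnfHolds_dnfAnd (ρ : ℕ → K) (F G : DNF) :
    DnfHolds ρ (dnfAnd F G) ↔ DnfHolds ρ F ∧ DnfHolds ρ G := by
  simp only [DnfHolds, dnfAnd, List.mem_flatMap, List.mem_map]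
  constructor
  · rintro ⟨_, ⟨D, hD, E, hE, rfl⟩, h⟩
    rw [conjHolds_append] at h
    exact ⟨⟨D, hD, h.1⟩, ⟨E, hE, h.2⟩⟩
  · rintro ⟨⟨D, hD, h1⟩, ⟨E, hE, h2⟩⟩
    exact ⟨_, ⟨D, hD, E, hE, rfl⟩, (conjHolds_append ρ D E).2 ⟨h1, h2⟩⟩

theorem dnfHolds_dnfAll (ρ : ℕ → K) (Fs : List DNF) :
    DnfHolds ρ (dnfAll Fs) ↔ ∀ F ∈ Fs, DnfHolds ρ F := by
  induction Fs with
  | nil => simp [dnfAll, DnfHolds, ConjHolds]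
  | cons F Fs ih =>
    rw [List.forall_mem_cons, ← ih, ← dnfHolds_dnfAnd]
    rfl

theorem dnfHolds_dnfNot [IsStrictOrderedRing K] (ρ : ℕ → K) (F : DNF) :
    DnfHolds ρ (dnfNot F) ↔ ¬ DnfHolds ρ F := by
  rw [dnfNot, dnfHolds_dnfAll]
  have h : ∀ D : List Lit, DnfHolds ρ (D.map fun c => [litNot c]) ↔ ¬ ConjHolds ρ D := fun D => by
    simp only [DnfHolds, List.mem_map, ConjHolds, not_forall]
    constructor
    · rintro ⟨_, ⟨c, hc, rfl⟩, h⟩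
      exact ⟨c, hc, (litHolds_litNot ρ c).1 (h _ List.mem_cons_self)⟩
    · rintro ⟨c, hc, h⟩
      refine ⟨_, ⟨c, hc, rfl⟩, fun d hd => ?_⟩
      rw [List.mem_singleton.1 hd]
      exact (litHolds_litNot ρ c).2 h
  simp only [List.forall_mem_map, h]
  simp [DnfHolds]

theorem dnfHolds_singleton (ρ : ℕ → K) (D : List Lit) : DnfHolds ρ [D] ↔ ConjHolds ρ D := by
  simp [DnfHolds]

theorem dnfHolds_append (ρ : ℕ → K) (F G : DNF) :
    DnfHolds ρ (F ++ G) ↔ DnfHolds ρ F ∨ DnfHolds ρ G := by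
  simp [DnfHolds, or_and_right, exists_or]

end Boolean

/-- The set of the parameter valuations described by a disjunction of conjunctions. -/
def dnfSet (k : ℕ) (F : DNF) : Set (Val (Fin k)) := {v | DnfHolds (env v) F}

theorem dnfTrue_iff (v : Val (Fin k)) (F : DNF) : DnfTrue (valCode v) F ↔ v ∈ dnfSet k F :=
  exists_congr fun D => and_congr_right fun _ => conjTrue_iff v D

theorem dnfSet_dnfAgree (v : Val (Fin k)) (F : DNF) :
    dnfSet k (dnfAgree (valCode v) F) = agree (dnfSet k F) v := by
  ext v'
  have h := dnfTrue_iff v F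
  rw [dnfAgree]
  split_ifs with hF
  · simp [agree, h.1 hF]
  · have : v ∉ dnfSet k F := fun h' => hF (h.2 h')
    simp only [agree, Set.mem_ofPred_eq, this, iff_false]
    exact dnfHolds_dnfNot _ _

/-- The values of the clock and of the parameters. -/
noncomputable def pointEnv (q : ℝ≥0 × Val (Fin k)) : ℕ → ℝ :=
  consEnv (q.1 : ℝ) fun i => (env q.2 i : ℝ)

/-- The zone described by a conjunction of inequalities, the first variable being the clock. -/
def zoneSet (k : ℕ) (Z : List Lit) : Zone (Fin k) := {q | ConjHolds (pointEnv q) Z}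

theorem conjHolds_elimHead_env (v : Val (Fin k)) (Z : List Lit) :
    ConjHolds (env v) (elimHead Z) ↔ v ∈ (zoneSet k Z).proj := by
  rw [← conjHolds_ratCast, conjHolds_elimHead]
  exact ⟨fun ⟨x, hx, h⟩ => ⟨⟨x, hx⟩, h⟩, fun ⟨x, h⟩ => ⟨x, x.2, h⟩⟩

theorem dnfSet_elimHead (Z : List Lit) : dnfSet k [elimHead Z] = (zoneSet k Z).proj := by
  ext v
  rw [← conjHolds_elimHead_env]
  exact dnfHolds_singleton _ _

/-- The clock is eliminated over ℝ, the k parameters over ℚ; this is one procedure with k + 1 rounds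
because `elimHead` is correct over both fields and the parameter values are rational. -/
theorem zoneSet_nonempty_iff (Z : List Lit) :
    (zoneSet k Z).Nonempty ↔ Satisfiable (k + 1) Z := by
  have h : Satisfiable (k + 1) Z ↔ Satisfiable k (elimHead Z) := by
    simp only [Satisfiable, Function.iterate_succ_apply]
  rw [h, satisfiable_iff]
  constructor
  · rintro ⟨⟨x, v⟩, hq⟩
    exact ⟨env v, env_nonneg v, fun i hi => env_of_le v hi,
      (conjHolds_elimHead_env v Z).2 ⟨x, hq⟩⟩
  · rintro ⟨ρ, hpos, h0, hρ⟩
    obtain ⟨v, rfl⟩ := exists_env_eq hpos h0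
    obtain ⟨x, hx⟩ := (conjHolds_elimHead_env v Z).1 hρ
    exact ⟨_, hx⟩

theorem zoneSet_append (Z W : List Lit) : zoneSet k (Z ++ W) = zoneSet k Z ∩ zoneSet k W :=
  Set.ext fun _ => conjHolds_append _ _ _

/-- Inclusion of the zones described by two conjunctions of inequalities. -/
def ZoneLe (k : ℕ) (Z W : List Lit) : Prop := ∀ c ∈ W, ¬ Satisfiable (k + 1) (litNot c :: Z)

instance (k : ℕ) (Z W : List Lit) : Decidable (ZoneLe k Z W) := by
  unfold ZoneLe; infer_instance

/-- Inclusion fails exactly if some inequality of W can be violated inside Z. Inclusion both ways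
decides whether two codes give the same symbolic state. -/
theorem zoneLe_iff (Z W : List Lit) : ZoneLe k Z W ↔ zoneSet k Z ⊆ zoneSet k W := by
  simp only [ZoneLe, ← zoneSet_nonempty_iff, Set.not_nonempty_iff_eq_empty,
    Set.eq_empty_iff_forall_notMem]
  constructor
  · intro h q hq c hc
    have := h c hc q
    by_contra hn
    exact this ((conjHolds_cons _ _ _).2 ⟨(litHolds_litNot _ _).2 hn, hq⟩)
  · intro h c hc q hq
    obtain ⟨h1, h2⟩ := (conjHolds_cons _ _ _).1 hq
    exact (litHolds_litNot _ _).1 h1 (h h2 c hc)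

/-! ### Operations on zones -/

/-- Application of `f` to the term of an inequality. -/
def litMap (f : TermCode → TermCode) (c : Lit) : Lit := (c.1, f c.2)

/-- Insertion of a second variable with coefficient `0`. -/
def termInsert (t : TermCode) : TermCode := termCons (termHead t) (termCons 0 (termTail t))

/-- Insertion of a first variable with coefficient `0`. -/
def termShift (t : TermCode) : TermCode := termCons 0 t

/-- Substitution of `0` for the first variable. -/
def termZero (t : TermCode) : TermCode := termCons 0 (termTail t)

section Substitution

variable {K : Type*} [Field K] [LinearOrder K]

theorem conjHolds_map_insert (x y : K) (ρ : ℕ → K) (D : List Lit) :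
    ConjHolds (consEnv y (consEnv x ρ)) (D.map (litMap termInsert)) ↔
      ConjHolds (consEnv y ρ) D := by
  simp only [ConjHolds, List.forall_mem_map]
  refine forall₂_congr fun c _ => ?_
  rw [LitHolds, LitHolds, litMap, termInsert, termVal_termCons, termVal_termCons,
    termVal_head_tail c.2]
  simp

theorem conjHolds_map_shift (y : K) (ρ : ℕ → K) (D : List Lit) :
    ConjHolds (consEnv y ρ) (D.map (litMap termShift)) ↔ ConjHolds ρ D := by
  simp only [ConjHolds, List.forall_mem_map]
  refine forall₂_congr fun c _ => ?_
  rw [LitHolds, LitHolds, litMap, termShift, termVal_termCons]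
  simp

theorem conjHolds_map_zero (x : K) (ρ : ℕ → K) (D : List Lit) :
    ConjHolds (consEnv x ρ) (D.map (litMap termZero)) ↔ ConjHolds (consEnv 0 ρ) D := by
  simp only [ConjHolds, List.forall_mem_map]
  refine forall₂_congr fun c _ => ?_
  rw [LitHolds, LitHolds, litMap, termZero, termVal_termCons, termVal_head_tail c.2]
  simp

end Substitution

/-- Time elapsing. -/
def elapseLits (Z : List Lit) : List Lit := elimHead (weak [1, -1] :: Z.map (litMap termInsert))

/-- Reset of the clock if `b` is true. -/
def resetLits (b : Bool) (Z : List Lit) : List Lit :=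
  if b = true then weak [1] :: (elimHead Z).map (litMap termShift) else Z

/-- The variables are, in this order, the earlier clock value y, the present one x, and the
parameters. `termInsert` makes the zone speak of y, `weak [1, -1]` is y ≤ x, and y is eliminated. -/
theorem zoneSet_elapseLits (Z : List Lit) : zoneSet k (elapseLits Z) = (zoneSet k Z).elapse := by
  ext ⟨x, v⟩
  change ConjHolds (pointEnv (x, v)) _ ↔ _
  rw [elapseLits, conjHolds_elimHead]
  simp only [conjHolds_cons, litHolds_weak_cons, pointEnv, conjHolds_map_insert]
  constructor
  · rintro ⟨y, hy, hyx, h⟩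
    lift y to ℝ≥0 using hy
    rw [show (([-1], 0) : TermCode) = termCons (-1) ([], 0) from rfl, termVal_termCons,
      termVal_nil] at hyx
    simp only [consEnv_zero, consEnv_succ, Int.cast_one, Int.cast_neg, Int.cast_zero] at hyx
    have hyx' : y ≤ x := by
      rw [← NNReal.coe_le_coe]
      linarith
    exact ⟨y, x - y, h, (add_tsub_cancel_of_le hyx').symm⟩
  · rintro ⟨y, d, h, rfl : x = y + d⟩
    refine ⟨y, y.2, ?_, h⟩
    rw [show (([-1], 0) : TermCode) = termCons (-1) ([], 0) from rfl, termVal_termCons, termVal_nil]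
    simp

theorem pointEnv_zero_iff (q : ℝ≥0 × Val (Fin k)) : LitHolds (pointEnv q) (weak [1]) ↔ q.1 = 0 := by
  rw [litHolds_weak_cons, termVal_nil, pointEnv, consEnv_zero]
  simp only [Int.cast_one, Int.cast_zero, one_mul, add_zero]
  rw [← NNReal.coe_zero, NNReal.coe_le_coe, nonpos_iff_eq_zero]

theorem zoneSet_resetLits (b : Bool) (Z : List Lit) :
    zoneSet k (resetLits b Z) = (zoneSet k Z).reset b := by
  cases b
  · simp [resetLits, Zone.reset]
  · ext ⟨x, v⟩
    change ConjHolds (pointEnv (x, v)) _ ↔ _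
    rw [resetLits, if_pos rfl, conjHolds_cons, pointEnv_zero_iff, pointEnv, conjHolds_map_shift,
      conjHolds_ratCast, conjHolds_elimHead_env]
    rfl

/-! ### Atoms and constraints -/

theorem conjHolds_cmpLits (ρ : ℕ → ℝ) (c : ℕ × TermCode) :
    ConjHolds ρ (cmpLits c) ↔ (Cmp.decode c.1).Rel (termVal c.2 ρ) 0 := by
  obtain ⟨n, t⟩ := c
  rcases n with _ | _ | _ | _ | n
  case succ.succ.zero =>
    simp only [Cmp.decode, Cmp.Rel]
    rw [le_antisymm_iff]
    simp [cmpLits, ConjHolds, LitHolds, termVal_neg, Neg]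
  all_goals simp [cmpLits, ConjHolds, LitHolds, termVal_neg, Cmp.decode, Cmp.Rel, Neg]

theorem litHolds_litCmp (ρ : ℕ → ℝ) (c : Lit) :
    (Cmp.decode (litCmp c).1).Rel (termVal (litCmp c).2 ρ) 0 ↔ LitHolds ρ c := by
  obtain ⟨_ | _, t⟩ := c <;> simp [litCmp, Cmp.decode, Cmp.Rel, LitHolds, Neg]

theorem env_real (v : Val (Fin k)) (i : Fin k) : (env v i : ℝ) = v i := by
  rw [env_apply]
  norm_cast

theorem eval_toTerm (t : TermCode) (v : Val (Fin k)) :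
    (TermCode.toTerm k t).eval v = termVal t fun i => (env v i : ℝ) := by
  rw [termVal_eq_sum t _ (le_max_left _ k), LinTerm.eval]
  have h : ∑ i : Fin k, (((TermCode.toTerm k t).coeff i : ℤ) : ℝ) * (v i : ℝ) =
      ∑ i ∈ Finset.range k, (t.1.getD i 0 : ℝ) * (env v i : ℝ) := by
    rw [← Fin.sum_univ_eq_sum_range (fun i => (t.1.getD i 0 : ℝ) * (env v i : ℝ))]
    exact Finset.sum_congr rfl fun i _ => by rw [env_real]; rfl
  rw [h, Finset.sum_subset (Finset.range_mono (le_max_right t.1.length k))]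
  · rfl
  · intro i _ hi
    rw [Finset.mem_range, not_lt] at hi
    rw [env_of_le v hi, Rat.cast_zero, mul_zero]

theorem eval_eq_termVal (t : LinTerm (Fin k)) (v : Val (Fin k)) :
    t.eval v = termVal (List.ofFn t.coeff, t.const) fun i => (env v i : ℝ) := by
  rw [← eval_toTerm]
  congr 1
  cases t
  simp [TermCode.toTerm]

/-- The inequalities equivalent to an atomic constraint. -/
def atomLits (c : AtomCode) : List Lit :=
  if c.1 = 0 then cmpLits (c.2.1, termCons 1 (termComb (-1) 0 c.2.2 c.2.2))
  else if c.1 = 1 then cmpLits (c.2.1, termCons 0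
    ((List.range (c.2.2.1.getD 0 0).toNat).map (fun _ => 0) ++ [1], -c.2.2.2))
  else if c.1 = 2 then [] else [(true, [], 0)]

/-- The inequalities equivalent to a constraint. -/
def constraintLits (g : List AtomCode) : List Lit := g.flatMap atomLits

theorem Cmp.decode_code (c : Cmp) : Cmp.decode c.code = c := by
  cases c <;> rfl

theorem Cmp.rel_add_iff (c : Cmp) {x y z : ℝ} (h : x - y = z) : c.Rel z 0 ↔ c.Rel x y := by
  subst h
  cases c <;> simp [Cmp.Rel, sub_eq_zero]

theorem termVal_single (n : ℕ) (m : ℤ) (ρ : ℕ → ℝ) :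
    termVal ((List.range n).map (fun _ => 0) ++ [1], m) ρ = ρ n + m := by
  rw [termVal_eq_sum _ _ (n := n + 1) (by simp), Finset.sum_range_succ, Finset.sum_eq_zero]
  · simp
  · intro i hi
    rw [Finset.mem_range] at hi
    rw [List.getD_append _ _ _ _ (by simpa using hi)]
    simp [hi]

/-- A clock atom is a comparison of x − t with 0 and a parameter atom one of p − m with 0; the
coefficients of p form a unit vector, preceded by the coefficient 0 of the clock. -/
theorem conjHolds_atomLits (c : Atom (Fin k)) (q : ℝ≥0 × Val (Fin k)) :
    ConjHolds (pointEnv q) (atomLits c.code) ↔ c.Sat q.1 q.2 := by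
  cases c with
  | clock c t =>
    simp only [Atom.code, atomLits, if_true, conjHolds_cmpLits, Cmp.decode_code, Atom.Sat]
    refine c.rel_add_iff ?_
    rw [termVal_termCons, termVal_neg, eval_eq_termVal]
    simp [pointEnv, sub_eq_add_neg]
  | param p c m =>
    simp only [Atom.code, atomLits, if_true, one_ne_zero, if_false, conjHolds_cmpLits,
      Cmp.decode_code, Atom.Sat]
    refine c.rel_add_iff ?_
    rw [termVal_termCons, termVal_single]
    simp [pointEnv, env_real, sub_eq_add_neg]
  | top => simp [Atom.code, atomLits, ConjHolds, Atom.Sat]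
  | bot => simp [Atom.code, atomLits, ConjHolds, Atom.Sat, LitHolds, termVal_nil, Neg]

theorem zoneSet_constraintLits (g : Constraint (Fin k)) :
    zoneSet k (constraintLits (g.map Atom.code)) = Zone.of g := by
  ext q
  simp only [zoneSet, ConjHolds, constraintLits, List.forall_mem_flatMap, List.forall_mem_map,
    Zone.of, Sat, Set.mem_ofPred_eq]
  exact forall₂_congr fun c _ => conjHolds_atomLits c q

end OneClock
namespace OneClock

/-! ### Symbolic semantics on codes -/

/-- The inequalities equivalent to the invariant of the location `l`. -/
def invLits (A : PTACode) (l : ℕ) : List Lit := constraintLits (A.2.1.getD l [])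

/-- The edges with the source `l`. -/
def outEdges (A : PTACode) (l : ℕ) : List EdgeCode := A.2.2.filter fun e => e.1 = l

/-- The solutions just after taking the edge `e` from the zone `Z`. -/
def entryLits (A : PTACode) (Z : List Lit) (e : EdgeCode) : List Lit :=
  resetLits e.2.2.2.1 (Z ++ constraintLits e.2.1) ++ invLits A e.2.2.2.2

/-- The successor of the zone `Z` by the edge `e`. -/
def succLits (A : PTACode) (Z : List Lit) (e : EdgeCode) : List Lit :=
  elapseLits (entryLits A Z e) ++ invLits A e.2.2.2.2

/-- The initial zone. -/
def initLits (A : PTACode) : List Lit :=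
  elapseLits (weak [1] :: invLits A A.1) ++ invLits A A.1

/-- The invariant of the target of `e` after a transition, in terms of the clock value before a
reset. -/
def targetLits (A : PTACode) (e : EdgeCode) : List Lit :=
  if e.2.2.2.1 = true then ((invLits A e.2.2.2.2).map (litMap termZero)).map (litMap termShift)
  else (invLits A e.2.2.2.2).map (litMap termInsert)

/-- The clock values in `l` that admit a transition along `e`. -/
def moveLits (A : PTACode) (l : ℕ) (e : EdgeCode) : List Lit :=
  elimHead (weak [-1, 1] :: ((invLits A l).map (litMap termShift) ++
    ((invLits A l).map (litMap termInsert) ++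
      ((constraintLits e.2.1).map (litMap termInsert) ++ targetLits A e))))

/-- The clock values in `l` that admit no transition. -/
def blockedDnf (A : PTACode) (l : ℕ) : DNF := dnfNot ((outEdges A l).map fun e => moveLits A l e)

/-- The parameter constraint `blockAfter`. -/
def blockAfterDnf (A : PTACode) (Z : List Lit) (e : EdgeCode) : DNF :=
  (blockedDnf A e.2.2.2.2).map fun D => elimHead (entryLits A Z e ++ D)

/-- The parameter constraint `blockInit`. -/
def blockInitDnf (A : PTACode) : DNF :=
  (blockedDnf A A.1).map fun D => elimHead (weak [1] :: (invLits A A.1 ++ D))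

section PrimrecSymbolic

variable {α : Type*} [Primcodable α]

theorem primrec_termInsert {t : α → TermCode} (ht : Primrec t) :
    Primrec fun a => termInsert (t a) :=
  primrec_termCons (primrec_termHead ht) (primrec_termCons (Primrec.const 0) (primrec_termTail ht))

theorem primrec_map_insert {D : α → List Lit} (hD : Primrec D) :
    Primrec fun a => (D a).map (litMap termInsert) :=
  primrec_map hD (Primrec.pair (primrec_fst Primrec.snd)
    (primrec_termInsert (primrec_snd Primrec.snd)))

theorem primrec_map_shift {D : α → List Lit} (hD : Primrec D) :
    Primrec fun a => (D a).map (litMap termShift) :=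
  primrec_map hD (Primrec.pair (primrec_fst Primrec.snd)
    (primrec_termCons (Primrec.const 0) (primrec_snd Primrec.snd)))

theorem primrec_map_zero {D : α → List Lit} (hD : Primrec D) :
    Primrec fun a => (D a).map (litMap termZero) :=
  primrec_map hD (Primrec.pair (primrec_fst Primrec.snd)
    (primrec_termCons (Primrec.const 0) (primrec_termTail (primrec_snd Primrec.snd))))

theorem primrec_elapseLits {Z : α → List Lit} (hZ : Primrec Z) :
    Primrec fun a => elapseLits (Z a) :=
  primrec_elimHead (primrec_cons (Primrec.const _) (primrec_map_insert hZ))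

theorem primrec_resetLits {b : α → Bool} {Z : α → List Lit} (hb : Primrec b) (hZ : Primrec Z) :
    Primrec fun a => resetLits (b a) (Z a) :=
  primrec_ite (primrecPred_eq hb (Primrec.const true))
    (primrec_cons (Primrec.const _) (primrec_map_shift (primrec_elimHead hZ))) hZ

theorem primrec_atomLits {c : α → AtomCode} (hc : Primrec c) : Primrec fun a => atomLits (c a) := by
  have h : ∀ n : ℕ, PrimrecPred fun a => (c a).1 = n := fun n =>
    primrecPred_eq (primrec_fst hc) (Primrec.const n)
  have ht : Primrec fun a => (c a).2.2 := primrec_snd (primrec_snd hc)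
  have hop : Primrec fun a => (c a).2.1 := primrec_fst (primrec_snd hc)
  refine primrec_ite (h 0) (primrec_cmpLits (Primrec.pair hop
      (primrec_termCons (Primrec.const 1) (primrec_termNeg ht)))) <|
    primrec_ite (h 1) (primrec_cmpLits (Primrec.pair hop (primrec_termCons (Primrec.const 0)
      (Primrec.pair (primrec_append (primrec_map (Primrec.list_range.comp (primrec_toNat
        (primrec_getD 0 (primrec_fst ht) (Primrec.const 0)))) (Primrec.const 0))
        (Primrec.const [1])) (primrec_int_neg (primrec_snd ht)))))) <|
    primrec_ite (h 2) (Primrec.const _) (Primrec.const _)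

theorem primrec_constraintLits {g : α → List AtomCode} (hg : Primrec g) :
    Primrec fun a => constraintLits (g a) :=
  primrec_flatMap hg (primrec_atomLits Primrec.snd)

theorem primrec_invLits {A : α → PTACode} {l : α → ℕ} (hA : Primrec A) (hl : Primrec l) :
    Primrec fun a => invLits (A a) (l a) :=
  primrec_constraintLits (primrec_getD [] (primrec_fst (primrec_snd hA)) hl)

theorem primrec_outEdges {A : α → PTACode} {l : α → ℕ} (hA : Primrec A) (hl : Primrec l) :
    Primrec fun a => outEdges (A a) (l a) :=
  primrec_filter (primrec_snd (primrec_snd hA))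
    (primrecPred_eq (primrec_fst Primrec.snd) (hl.comp Primrec.fst))

theorem primrec_edgeTgt {e : α → EdgeCode} (he : Primrec e) : Primrec fun a => (e a).2.2.2.2 :=
  primrec_snd (primrec_snd (primrec_snd (primrec_snd he)))

theorem primrec_edgeReset {e : α → EdgeCode} (he : Primrec e) : Primrec fun a => (e a).2.2.2.1 :=
  primrec_fst (primrec_snd (primrec_snd (primrec_snd he)))

theorem primrec_edgeGuard {e : α → EdgeCode} (he : Primrec e) :
    Primrec fun a => constraintLits (e a).2.1 :=
  primrec_constraintLits (primrec_fst (primrec_snd he))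

theorem primrec_entryLits {A : α → PTACode} {Z : α → List Lit} {e : α → EdgeCode}
    (hA : Primrec A) (hZ : Primrec Z) (he : Primrec e) :
    Primrec fun a => entryLits (A a) (Z a) (e a) :=
  primrec_append (primrec_resetLits (primrec_edgeReset he)
    (primrec_append hZ (primrec_edgeGuard he))) (primrec_invLits hA (primrec_edgeTgt he))

theorem primrec_succLits {A : α → PTACode} {Z : α → List Lit} {e : α → EdgeCode}
    (hA : Primrec A) (hZ : Primrec Z) (he : Primrec e) :
    Primrec fun a => succLits (A a) (Z a) (e a) :=
  primrec_append (primrec_elapseLits (primrec_entryLits hA hZ he))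
    (primrec_invLits hA (primrec_edgeTgt he))

theorem primrec_initLits {A : α → PTACode} (hA : Primrec A) : Primrec fun a => initLits (A a) :=
  have h := primrec_invLits hA (primrec_fst hA)
  primrec_append (primrec_elapseLits (primrec_cons (Primrec.const _) h)) h

theorem primrec_targetLits {A : α → PTACode} {e : α → EdgeCode} (hA : Primrec A)
    (he : Primrec e) : Primrec fun a => targetLits (A a) (e a) :=
  have h := primrec_invLits hA (primrec_edgeTgt he)
  primrec_ite (primrecPred_eq (primrec_edgeReset he) (Primrec.const true))
    (primrec_map_shift (primrec_map_zero h)) (primrec_map_insert h)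

theorem primrec_moveLits {A : α → PTACode} {l : α → ℕ} {e : α → EdgeCode} (hA : Primrec A)
    (hl : Primrec l) (he : Primrec e) : Primrec fun a => moveLits (A a) (l a) (e a) :=
  have h := primrec_invLits hA hl
  primrec_elimHead (primrec_cons (Primrec.const _) (primrec_append (primrec_map_shift h)
    (primrec_append (primrec_map_insert h) (primrec_append
      (primrec_map_insert (primrec_edgeGuard he)) (primrec_targetLits hA he)))))

theorem primrec_blockedDnf {A : α → PTACode} {l : α → ℕ} (hA : Primrec A) (hl : Primrec l) :
    Primrec fun a => blockedDnf (A a) (l a) :=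
  primrec_dnfNot (primrec_map (primrec_outEdges hA hl)
    (primrec_moveLits (hA.comp Primrec.fst) (hl.comp Primrec.fst) Primrec.snd))

theorem primrec_blockAfterDnf {A : α → PTACode} {Z : α → List Lit} {e : α → EdgeCode}
    (hA : Primrec A) (hZ : Primrec Z) (he : Primrec e) :
    Primrec fun a => blockAfterDnf (A a) (Z a) (e a) :=
  primrec_map (primrec_blockedDnf hA (primrec_edgeTgt he)) (primrec_elimHead (primrec_append
    ((primrec_entryLits hA hZ he).comp Primrec.fst) Primrec.snd))

theorem primrec_blockInitDnf {A : α → PTACode} (hA : Primrec A) :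
    Primrec fun a => blockInitDnf (A a) :=
  primrec_map (primrec_blockedDnf hA (primrec_fst hA)) (primrec_elimHead (primrec_cons
    (Primrec.const _) (primrec_append ((primrec_invLits hA (primrec_fst hA)).comp Primrec.fst)
      Primrec.snd)))

end PrimrecSymbolic

section Semantics

variable {k l a : ℕ} (A : PTA (Fin a) (Fin l) (Fin k))

theorem zoneSet_invLits (m : Fin l) : zoneSet k (invLits A.code m) = Zone.of (A.inv m) := by
  rw [← zoneSet_constraintLits, invLits]
  congr 2
  simp [PTA.code]

theorem conjHolds_invLits (m : Fin l) (x : ℝ≥0) (v : Val (Fin k)) :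
    ConjHolds (pointEnv (x, v)) (invLits A.code m) ↔ A.Valid v (m, x) :=
  Set.ext_iff.1 (zoneSet_invLits A m) (x, v)

theorem mem_outEdges {m : Fin l} {c : EdgeCode} :
    c ∈ outEdges A.code m ↔ ∃ e ∈ A.edges, e.src = m ∧ e.code = c := by
  simp only [outEdges, PTA.code, List.mem_filter, List.mem_map, decide_eq_true_eq]
  constructor
  · rintro ⟨⟨e, he, rfl⟩, h⟩
    exact ⟨e, he, Fin.ext h, rfl⟩
  · rintro ⟨e, he, rfl, rfl⟩
    exact ⟨⟨e, he, rfl⟩, rfl⟩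

theorem zoneSet_entryLits (Z : List Lit) (e : Edge (Fin a) (Fin l) (Fin k)) :
    zoneSet k (entryLits A.code Z e.code) = A.entry (zoneSet k Z) e := by
  rw [entryLits, zoneSet_append, zoneSet_resetLits, zoneSet_append]
  simp only [Edge.code, zoneSet_constraintLits, zoneSet_invLits]
  rfl

theorem zoneSet_succLits (Z : List Lit) (e : Edge (Fin a) (Fin l) (Fin k)) :
    zoneSet k (succLits A.code Z e.code) =
      Zone.elapse (A.entry (zoneSet k Z) e) ∩ Zone.of (A.inv e.tgt) := by
  rw [succLits, zoneSet_append, zoneSet_elapseLits, zoneSet_entryLits]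
  simp only [Edge.code, zoneSet_invLits]

theorem zoneSet_weak_one_cons (D : List Lit) :
    zoneSet k (weak [1] :: D) = {q | q.1 = 0} ∩ zoneSet k D := by
  ext q
  exact (conjHolds_cons _ _ _).trans (and_congr_left fun _ => pointEnv_zero_iff q)

theorem zoneSet_initLits : zoneSet k (initLits A.code) = A.symInit.2 := by
  rw [initLits, zoneSet_append, zoneSet_elapseLits, zoneSet_weak_one_cons]
  simp only [PTA.code]
  rw [← PTA.code, zoneSet_invLits]
  rfl

/-- The first variable is the value y at which the edge is taken, the second the present value x,
and `weak [-1, 1]` is x ≤ y. By convexity the source invariant is tested at x and y only; the target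
invariant is tested at y, or at 0 after a reset. -/
theorem conjHolds_moveLits {e : Edge (Fin a) (Fin l) (Fin k)} (he : e ∈ A.edges) (x : ℝ≥0)
    (v : Val (Fin k)) : ConjHolds (pointEnv (x, v)) (moveLits A.code e.src e.code) ↔
      ∃ d s', A.Step v (e.src, x) d e s' := by
  have hy : ∀ y : ℝ≥0, ConjHolds (consEnv (y : ℝ) (pointEnv (x, v)))
      (weak [-1, 1] :: ((invLits A.code e.src).map (litMap termShift) ++
    ((invLits A.code e.src).map (litMap termInsert) ++
      ((constraintLits e.code.2.1).map (litMap termInsert) ++ targetLits A.code e.code)))) ↔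
      x ≤ y ∧ A.Valid v (e.src, x) ∧ A.Valid v (e.src, y) ∧ Sat y v e.guard ∧
        A.Valid v (e.tgt, if e.reset then 0 else y) := by
    intro y
    rw [conjHolds_cons, conjHolds_append, conjHolds_append, conjHolds_append]
    refine and_congr ?_ (and_congr ?_ (and_congr ?_ (and_congr ?_ ?_)))
    · rw [litHolds_weak_cons, show (([1], 0) : TermCode) = termCons 1 ([], 0) from rfl,
        termVal_termCons, termVal_nil]
      simp [pointEnv]
    · rw [conjHolds_map_shift, conjHolds_invLits]
    · rw [pointEnv, conjHolds_map_insert, ← conjHolds_invLits]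
      rfl
    · rw [pointEnv, conjHolds_map_insert]
      exact Set.ext_iff.1 (zoneSet_constraintLits e.guard) (y, v)
    · have ht : targetLits A.code e.code = if e.reset = true then
          ((invLits A.code e.tgt).map (litMap termZero)).map (litMap termShift)
          else (invLits A.code e.tgt).map (litMap termInsert) := rfl
      rw [ht]
      by_cases hr : e.reset = true
      · rw [if_pos hr, if_pos hr, conjHolds_map_shift, pointEnv, conjHolds_map_zero,
          ← conjHolds_invLits]
        simp [pointEnv]
      · rw [if_neg hr, if_neg hr, pointEnv, conjHolds_map_insert, ← conjHolds_invLits]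
        rfl
  rw [moveLits, conjHolds_elimHead]
  constructor
  · rintro ⟨y, hy0, h⟩
    lift y to ℝ≥0 using hy0
    obtain ⟨hxy, h1, h2, h3, h4⟩ := (hy y).1 h
    have hd : x + (y - x) = y := add_tsub_cancel_of_le hxy
    refine ⟨y - x, _, he, rfl, rfl, fun d' hd' => ?_, ?_, ?_, h4⟩
    · refine Sat.of_between h1 h2 le_self_add ?_
      calc x + d' ≤ x + (y - x) := by gcongr
        _ = y := hd
    · simpa only [hd] using h3
    · simp only [hd]
  · rintro ⟨d, ⟨m, z⟩, -, -, hm, hval, hg, hz, hv⟩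
    refine ⟨(x + d : ℝ≥0), NNReal.coe_nonneg _, (hy (x + d)).2 ⟨le_self_add, ?_, hval d le_rfl,
      hg, ?_⟩⟩
    · simpa using hval 0 zero_le
    · simp only at hm hz
      rwa [← hz, hm]

theorem dnfHolds_blockedDnf (m : Fin l) (x : ℝ≥0) (v : Val (Fin k)) :
    DnfHolds (pointEnv (x, v)) (blockedDnf A.code m) ↔ A.Blocked v (m, x) := by
  rw [blockedDnf, dnfHolds_dnfNot, PTA.Blocked, not_iff_not]
  simp only [DnfHolds, List.mem_map]
  constructor
  · rintro ⟨_, ⟨c, hc, rfl⟩, h⟩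
    obtain ⟨e, he, rfl, rfl⟩ := (mem_outEdges A).1 hc
    obtain ⟨d, s', hs⟩ := (conjHolds_moveLits A he x v).1 h
    exact ⟨d, e, s', hs⟩
  · rintro ⟨d, e, s', hs⟩
    obtain ⟨he, rfl : e.src = m, -⟩ := id hs
    exact ⟨_, ⟨_, (mem_outEdges A).2 ⟨e, he, rfl, rfl⟩, rfl⟩,
      (conjHolds_moveLits A he x v).2 ⟨d, s', hs⟩⟩

/-- Projection commutes with disjunction, so the clock can be eliminated from each conjunction
separately. -/
theorem dnfHolds_map_elimHead (F : DNF) (Z : List Lit) (v : Val (Fin k)) :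
    DnfHolds (env v) (F.map fun D => elimHead (Z ++ D)) ↔
      ∃ x : ℝ≥0, (x, v) ∈ zoneSet k Z ∧ DnfHolds (pointEnv (x, v)) F := by
  simp only [DnfHolds, List.mem_map]
  constructor
  · rintro ⟨_, ⟨D, hD, rfl⟩, h⟩
    obtain ⟨x, hx⟩ := (conjHolds_elimHead_env v _).1 h
    rw [zoneSet_append] at hx
    exact ⟨x, hx.1, D, hD, hx.2⟩
  · rintro ⟨x, hx, D, hD, h⟩
    refine ⟨_, ⟨D, hD, rfl⟩, (conjHolds_elimHead_env v _).2 ⟨x, ?_⟩⟩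
    rw [zoneSet_append]
    exact ⟨hx, h⟩

theorem dnfSet_blockAfterDnf (Z : List Lit) (e : Edge (Fin a) (Fin l) (Fin k)) :
    dnfSet k (blockAfterDnf A.code Z e.code) = A.blockAfter (zoneSet k Z) e := by
  ext v
  refine (dnfHolds_map_elimHead _ _ v).trans (exists_congr fun x => ?_)
  rw [zoneSet_entryLits]
  exact and_congr_right fun _ => dnfHolds_blockedDnf A e.tgt x v

theorem dnfSet_blockInitDnf : dnfSet k (blockInitDnf A.code) = A.blockInit := by
  ext v
  refine (dnfHolds_map_elimHead _ (weak [1] :: invLits A.code A.init) v).trans ?_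
  rw [zoneSet_weak_one_cons, zoneSet_invLits]
  constructor
  · rintro ⟨x, ⟨rfl : x = 0, hx⟩, h⟩
    exact ⟨hx, (dnfHolds_blockedDnf A A.init 0 v).1 h⟩
  · rintro ⟨hx, h⟩
    exact ⟨0, ⟨rfl, hx⟩, (dnfHolds_blockedDnf A A.init 0 v).2 h⟩

end Semantics

end OneClock
namespace OneClock

/-! ### The algorithm on codes -/

/-- The disjunction of conjunctions of inequalities equivalent to a coded parameter constraint. -/
def decodeParam (F : ParamConstraintCode) : DNF := F.map fun D => D.flatMap cmpLits

/-- The code of a disjunction of conjunctions of inequalities. -/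
def encodeParam (F : DNF) : ParamConstraintCode := F.map fun D => D.map litCmp

/-- The conjunction of inequalities equivalent to a coded zone. -/
def decodeZone (z : ZoneCode) : List Lit := z.flatMap fun c => cmpLits (c.1, termCons c.2.1 c.2.2)

/-- The code of the zone described by a conjunction of inequalities. -/
def encodeZone (Z : List Lit) : ZoneCode :=
  Z.map fun c => ((litCmp c).1, termHead c.2, termTail c.2)

/-- The contribution of a compatible symbolic state. -/
def contributionDnf (κ : RunKind) (i : PTACode × ValCode) (s : ℕ × List Lit) : DNF :=
  match κ with
  | .maximal => dnfAll ([elimHead s.2] ::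
      (outEdges i.1 s.1).map fun e => dnfAgree i.2 (blockAfterDnf i.1 s.2 e))
  | .allFinite => [elimHead s.2]

/-- The initial value of `good`. -/
def startDnf (κ : RunKind) (i : PTACode × ValCode) : DNF :=
  match κ with
  | .maximal => dnfAgree i.2 (blockInitDnf i.1)
  | .allFinite => [[]]

/-- The initial contents of the variables. -/
def startCode (κ : RunKind) (i : PTACode × ValCode) : VarCode :=
  (encodeParam (startDnf κ i), [], [], [(i.1.1, encodeZone (initLits i.1))])

/-- The new symbolic states. -/
def newCodes (i : PTACode × ValCode) (c : VarCode) : List (ℕ × List Lit) :=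
  (c.2.2.2.filter fun s => s.1 < i.1.2.1.length).map fun s => (s.1, decodeZone s.2)

/-- The new symbolic states that are compatible with the valuation. -/
def compatibleCodes (i : PTACode × ValCode) (c : VarCode) : List (ℕ × List Lit) :=
  (newCodes i c).filter fun s => ConjTrue i.2 (elimHead s.2)

/-- The new symbolic states that are not compatible with the valuation. -/
def incompatibleCodes (i : PTACode × ValCode) (c : VarCode) : List (ℕ × List Lit) :=
  (newCodes i c).filter fun s => ¬ ConjTrue i.2 (elimHead s.2)

/-- The value of `good` after the treatment of the new symbolic states. -/
def goodCode (κ : RunKind) (i : PTACode × ValCode) (c : VarCode) : DNF :=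
  dnfAll (decodeParam c.1 :: (compatibleCodes i c).map fun s => contributionDnf κ i s)

/-- The value of `bad` after the treatment of the new symbolic states. -/
def badCode (i : PTACode × ValCode) (c : VarCode) : DNF :=
  decodeParam c.2.1 ++ (incompatibleCodes i c).map fun s => elimHead s.2

/-- The nonempty successors of a symbolic state. -/
def succCodes (i : PTACode × ValCode) (s : ℕ × List Lit) : List (ℕ × List Lit) :=
  ((outEdges i.1 s.1).map fun e => (e.2.2.2.2, succLits i.1 s.2 e)).filter fun s =>
    Satisfiable (i.2.length + 1) s.2

/-- Equality of the symbolic states with the given codes. -/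
def SameState (k : ℕ) (s t : ℕ × List Lit) : Prop :=
  s.1 = t.1 ∧ ZoneLe k s.2 t.2 ∧ ZoneLe k t.2 s.2

instance (k : ℕ) (s t : ℕ × List Lit) : Decidable (SameState k s t) := by
  unfold SameState; infer_instance

/-- The symbolic states that are new in the next iteration. -/
def nextCodes (i : PTACode × ValCode) (c : VarCode) : List (ℕ × List Lit) :=
  ((compatibleCodes i c).flatMap fun s => succCodes i s).filter fun s =>
    ∀ t ∈ c.2.2.1 ++ c.2.2.2, ¬ SameState i.2.length s (t.1, decodeZone t.2)

/-- The result of an iteration of the while loop. -/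
def iterationCode (κ : RunKind) (i : PTACode × ValCode) (c : VarCode) :
    ParamConstraintCode ⊕ VarCode :=
  if compatibleCodes i c = [] then
    .inl (encodeParam (dnfAnd (goodCode κ i c) (dnfNot (badCode i c))))
  else .inr (encodeParam (goodCode κ i c), encodeParam (badCode i c), c.2.2.1 ++ c.2.2.2,
    (nextCodes i c).map fun s => (s.1, encodeZone s.2))

section PrimrecAlgorithm

variable {α : Type*} [Primcodable α]

theorem primrec_decodeParam {F : α → ParamConstraintCode} (hF : Primrec F) :
    Primrec fun a => decodeParam (F a) :=
  primrec_map hF (primrec_flatMap Primrec.snd (primrec_cmpLits Primrec.snd))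

theorem primrec_encodeParam {F : α → DNF} (hF : Primrec F) :
    Primrec fun a => encodeParam (F a) :=
  primrec_map hF (primrec_map Primrec.snd (primrec_litCmp Primrec.snd))

theorem primrec_decodeZone {z : α → ZoneCode} (hz : Primrec z) :
    Primrec fun a => decodeZone (z a) :=
  primrec_flatMap hz (primrec_cmpLits (Primrec.pair (primrec_fst Primrec.snd)
    (primrec_termCons (primrec_fst (primrec_snd Primrec.snd))
      (primrec_snd (primrec_snd Primrec.snd)))))

theorem primrec_encodeZone {Z : α → List Lit} (hZ : Primrec Z) :
    Primrec fun a => encodeZone (Z a) :=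
  primrec_map hZ (Primrec.pair (primrec_fst (primrec_litCmp Primrec.snd)) (Primrec.pair
    (primrec_termHead (primrec_snd Primrec.snd)) (primrec_termTail (primrec_snd Primrec.snd))))

theorem primrec_contributionDnf (κ : RunKind) {i : α → PTACode × ValCode} {s : α → ℕ × List Lit}
    (hi : Primrec i) (hs : Primrec s) : Primrec fun a => contributionDnf κ (i a) (s a) := by
  have h : Primrec fun a => [elimHead (s a).2] :=
    primrec_cons (primrec_elimHead (primrec_snd hs)) (Primrec.const [])
  cases κ
  · have hi' : Primrec fun p : α × EdgeCode => i p.1 := hi.comp Primrec.fst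
    have hs' : Primrec fun p : α × EdgeCode => s p.1 := hs.comp Primrec.fst
    exact primrec_dnfAll (primrec_cons h (primrec_map
      (primrec_outEdges (primrec_fst hi) (primrec_fst hs)) (primrec_dnfAgree (primrec_snd hi')
        (primrec_blockAfterDnf (primrec_fst hi') (primrec_snd hs') Primrec.snd))))
  · exact h

theorem primrec_startCode (κ : RunKind) : Primrec (startCode κ) := by
  have h : Primrec (startDnf κ) := by
    cases κ
    · exact primrec_dnfAgree Primrec.snd (primrec_blockInitDnf Primrec.fst)
    · exact Primrec.const _
  exact Primrec.pair (primrec_encodeParam h) (Primrec.pair (Primrec.const _) (Primrec.pair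
    (Primrec.const _) (primrec_cons (Primrec.pair (primrec_fst Primrec.fst)
      (primrec_encodeZone (primrec_initLits Primrec.fst))) (Primrec.const []))))

variable {i : α → PTACode × ValCode} {c : α → VarCode}

theorem primrec_newCodes (hi : Primrec i) (hc : Primrec c) :
    Primrec fun a => newCodes (i a) (c a) :=
  primrec_map (primrec_filter (primrec_snd (primrec_snd (primrec_snd hc)))
    (primrecPred_nat_lt (primrec_fst Primrec.snd)
      (Primrec.list_length.comp (primrec_fst (primrec_snd (primrec_fst (hi.comp Primrec.fst)))))))
    (Primrec.pair (primrec_fst Primrec.snd) (primrec_decodeZone (primrec_snd Primrec.snd)))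

theorem primrecPred_compatible (hi : Primrec i) : PrimrecPred fun p : α × (ℕ × List Lit) =>
    ConjTrue (i p.1).2 (elimHead p.2.2) :=
  primrecPred_conjTrue (primrec_snd (hi.comp Primrec.fst))
    (primrec_elimHead (primrec_snd Primrec.snd))

theorem primrec_compatibleCodes (hi : Primrec i) (hc : Primrec c) :
    Primrec fun a => compatibleCodes (i a) (c a) :=
  primrec_filter (primrec_newCodes hi hc) (primrecPred_compatible hi)

theorem primrec_incompatibleCodes (hi : Primrec i) (hc : Primrec c) :
    Primrec fun a => incompatibleCodes (i a) (c a) :=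
  primrec_filter (primrec_newCodes hi hc) (primrecPred_compatible hi).not

theorem primrec_goodCode (κ : RunKind) (hi : Primrec i) (hc : Primrec c) :
    Primrec fun a => goodCode κ (i a) (c a) :=
  primrec_dnfAll (primrec_cons (primrec_decodeParam (primrec_fst hc))
    (primrec_map (primrec_compatibleCodes hi hc)
      (primrec_contributionDnf κ (hi.comp Primrec.fst) Primrec.snd)))

theorem primrec_badCode (hi : Primrec i) (hc : Primrec c) :
    Primrec fun a => badCode (i a) (c a) :=
  primrec_append (primrec_decodeParam (primrec_fst (primrec_snd hc)))
    (primrec_map (primrec_incompatibleCodes hi hc) (primrec_elimHead (primrec_snd Primrec.snd)))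

theorem primrec_succCodes {s : α → ℕ × List Lit} (hi : Primrec i) (hs : Primrec s) :
    Primrec fun a => succCodes (i a) (s a) := by
  have hi' : Primrec fun p : α × EdgeCode => i p.1 := hi.comp Primrec.fst
  have hs' : Primrec fun p : α × EdgeCode => s p.1 := hs.comp Primrec.fst
  exact primrec_filter (primrec_map (primrec_outEdges (primrec_fst hi) (primrec_fst hs))
    (Primrec.pair (primrec_edgeTgt Primrec.snd)
      (primrec_succLits (primrec_fst hi') (primrec_snd hs') Primrec.snd)))
    (primrecPred_satisfiable (Primrec.succ.comp (Primrec.list_length.comp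
      (primrec_snd (hi.comp Primrec.fst)))) (primrec_snd Primrec.snd))

theorem primrecPred_zoneLe {n : α → ℕ} {Z W : α → List Lit} (hn : Primrec n) (hZ : Primrec Z)
    (hW : Primrec W) : PrimrecPred fun a => ZoneLe (n a) (Z a) (W a) :=
  primrecPred_forall hW (primrecPred_not (primrecPred_satisfiable
    (Primrec.succ.comp (hn.comp Primrec.fst))
    (primrec_cons (primrec_litNot Primrec.snd) (hZ.comp Primrec.fst))))

theorem primrecPred_sameState {n : α → ℕ} {s t : α → ℕ × List Lit} (hn : Primrec n)
    (hs : Primrec s) (ht : Primrec t) : PrimrecPred fun a => SameState (n a) (s a) (t a) :=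
  primrecPred_and (primrecPred_eq (primrec_fst hs) (primrec_fst ht))
    (primrecPred_and (primrecPred_zoneLe hn (primrec_snd hs) (primrec_snd ht))
      (primrecPred_zoneLe hn (primrec_snd ht) (primrec_snd hs)))

theorem primrec_nextCodes (hi : Primrec i) (hc : Primrec c) :
    Primrec fun a => nextCodes (i a) (c a) := by
  have hc' : Primrec fun p : α × (ℕ × List Lit) => c p.1 := hc.comp Primrec.fst
  have hi' : Primrec fun p : (α × (ℕ × List Lit)) × (ℕ × ZoneCode) => i p.1.1 :=
    hi.comp (Primrec.fst.comp Primrec.fst)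
  exact primrec_filter (primrec_flatMap (primrec_compatibleCodes hi hc)
      (primrec_succCodes (hi.comp Primrec.fst) Primrec.snd))
    (primrecPred_forall (primrec_append (primrec_fst (primrec_snd (primrec_snd hc')))
        (primrec_snd (primrec_snd (primrec_snd hc'))))
      (primrecPred_not (primrecPred_sameState (Primrec.list_length.comp (primrec_snd hi'))
        (Primrec.snd.comp Primrec.fst) (Primrec.pair (primrec_fst Primrec.snd)
          (primrec_decodeZone (primrec_snd Primrec.snd))))))

theorem primrec_iterationCode (κ : RunKind) (hi : Primrec i) (hc : Primrec c) :
    Primrec fun a => iterationCode κ (i a) (c a) := by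
  refine primrec_ite ((primrecPred_eq (Primrec.list_length.comp (primrec_compatibleCodes hi hc))
      (Primrec.const 0)).of_eq fun _ => List.length_eq_zero_iff)
    (Primrec.sumInl.comp (primrec_encodeParam (primrec_dnfAnd (primrec_goodCode κ hi hc)
      (primrec_dnfNot (primrec_badCode hi hc)))))
    (Primrec.sumInr.comp (Primrec.pair (primrec_encodeParam (primrec_goodCode κ hi hc))
      (Primrec.pair (primrec_encodeParam (primrec_badCode hi hc)) (Primrec.pair
        (primrec_append (primrec_fst (primrec_snd (primrec_snd hc)))
          (primrec_snd (primrec_snd (primrec_snd hc))))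
        (primrec_map (primrec_nextCodes hi hc) (Primrec.pair (primrec_fst Primrec.snd)
          (primrec_encodeZone (primrec_snd Primrec.snd))))))))

end PrimrecAlgorithm

section Semantics

variable {k l a : ℕ}

theorem solutions_eq_dnfSet (F : ParamConstraintCode) :
    ParamConstraintCode.solutions k F = dnfSet k (decodeParam F) := by
  ext v
  change _ ↔ DnfHolds (env v) (decodeParam F)
  simp only [ParamConstraintCode.solutions, DnfHolds, decodeParam, Set.mem_ofPred_eq, List.mem_map,
    exists_exists_and_eq_and]
  refine exists_congr fun D => and_congr_right fun _ => ?_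
  rw [← conjHolds_ratCast, ConjHolds, List.forall_mem_flatMap]
  refine forall₂_congr fun c _ => ?_
  rw [eval_toTerm]
  exact (conjHolds_cmpLits _ c).symm

theorem solutions_encodeParam (F : DNF) :
    ParamConstraintCode.solutions k (encodeParam F) = dnfSet k F := by
  ext v
  change _ ↔ DnfHolds (env v) F
  simp only [ParamConstraintCode.solutions, DnfHolds, encodeParam, Set.mem_ofPred_eq, List.mem_map,
    exists_exists_and_eq_and, forall_exists_index, and_imp, forall_apply_eq_imp_iff₂]
  refine exists_congr fun D => and_congr_right fun _ => ?_
  rw [← conjHolds_ratCast]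
  refine forall₂_congr fun c _ => ?_
  rw [eval_toTerm, litHolds_litCmp]

theorem termVal_pointEnv (m : ℤ) (t : TermCode) (q : ℝ≥0 × Val (Fin k)) :
    (m : ℝ) * (q.1 : ℝ) + (TermCode.toTerm k t).eval q.2 = termVal (termCons m t) (pointEnv q) := by
  rw [termVal_termCons, eval_toTerm]
  rfl

theorem zoneSolutions_eq_zoneSet (z : ZoneCode) :
    ZoneCode.solutions k z = zoneSet k (decodeZone z) := by
  ext q
  change _ ↔ ConjHolds (pointEnv q) (decodeZone z)
  rw [ConjHolds, decodeZone, List.forall_mem_flatMap]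
  refine forall₂_congr fun c _ => ?_
  rw [termVal_pointEnv]
  exact (conjHolds_cmpLits _ (c.1, termCons c.2.1 c.2.2)).symm

theorem zoneSolutions_encodeZone (Z : List Lit) :
    ZoneCode.solutions k (encodeZone Z) = zoneSet k Z := by
  ext q
  change _ ↔ ConjHolds (pointEnv q) Z
  simp only [ZoneCode.solutions, encodeZone, Set.mem_ofPred_eq, List.forall_mem_map]
  refine forall₂_congr fun c _ => ?_
  rw [termVal_pointEnv, ← litHolds_litCmp, termVal_termCons, termVal_head_tail (litCmp c).2]
  rfl

/-- The set of the symbolic states that occur in a list. -/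
def stateSet (l k : ℕ) (S : List (ℕ × List Lit)) : Set (SymState (Fin l) (Fin k)) :=
  {σ | ∃ Z, ((σ.1 : ℕ), Z) ∈ S ∧ σ.2 = zoneSet k Z}

theorem symStates_encode (S : List (ℕ × List Lit)) :
    symStates l k (S.map fun s => (s.1, encodeZone s.2)) = stateSet l k S := by
  ext σ
  simp only [symStates, stateSet, List.mem_map, Set.mem_ofPred_eq, Prod.mk.injEq]
  constructor
  · rintro ⟨_, ⟨s, hs, h1, rfl⟩, h2⟩
    exact ⟨s.2, h1 ▸ hs, h2.trans (zoneSolutions_encodeZone _)⟩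
  · rintro ⟨Z, hZ, h⟩
    exact ⟨_, ⟨_, hZ, rfl, rfl⟩, h.trans (zoneSolutions_encodeZone _).symm⟩

theorem dnfSet_contributionDnf (κ : RunKind) (A : PTA (Fin a) (Fin l) (Fin k)) (v : Val (Fin k))
    (m : Fin l) (Z : List Lit) : dnfSet k (contributionDnf κ (A.code, valCode v) (m, Z)) =
      TPSState.contribution κ A v (m, zoneSet k Z) := by
  cases κ
  · ext v'
    simp only [contributionDnf, TPSState.contribution, Set.mem_inter_iff, ← dnfSet_elimHead]
    refine (dnfHolds_dnfAll _ _).trans ?_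
    rw [List.forall_mem_cons]
    refine and_congr Iff.rfl ?_
    rw [List.forall_mem_map]
    have h : ∀ e : Edge (Fin a) (Fin l) (Fin k),
        DnfHolds (env v') (dnfAgree (valCode v) (blockAfterDnf A.code Z e.code)) ↔
          v' ∈ agree (A.blockAfter (zoneSet k Z) e) v := fun e => by
      rw [← dnfSet_blockAfterDnf, ← dnfSet_dnfAgree]
      rfl
    constructor
    · exact fun H e he hm => (h e).1 (H _ ((mem_outEdges A).2 ⟨e, he, hm, rfl⟩))
    · intro H c hc
      obtain ⟨e, he, hm, rfl⟩ := (mem_outEdges A).1 hc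
      exact (h e).2 (H e he hm)
  · exact dnfSet_elimHead Z

theorem dnfSet_startDnf (κ : RunKind) (A : PTA (Fin a) (Fin l) (Fin k)) (v : Val (Fin k)) :
    dnfSet k (startDnf κ (A.code, valCode v)) = (TPSState.start κ A v).good := by
  cases κ
  · simp only [startDnf, TPSState.start, dnfSet_dnfAgree, dnfSet_blockInitDnf]
  · exact Set.eq_univ_of_forall fun v' => ⟨[], List.mem_cons_self, by simp [ConjHolds]⟩

theorem represents_startCode (κ : RunKind) (A : PTA (Fin a) (Fin l) (Fin k)) (v : Val (Fin k)) :
    (startCode κ (A.code, valCode v)).Represents (TPSState.start κ A v) := by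
  refine ⟨(solutions_encodeParam _).trans (dnfSet_startDnf κ A v), ?_, ?_, ?_⟩
  · simp [startCode, ParamConstraintCode.solutions, TPSState.start]
  · simp [startCode, symStates, TPSState.start]
  · refine (symStates_encode [(A.code.1, initLits A.code)]).trans ?_
    ext σ
    simp only [stateSet, Set.mem_ofPred_eq, List.mem_singleton, Prod.mk.injEq, TPSState.start,
      Set.mem_singleton_iff]
    constructor
    · rintro ⟨Z, ⟨h1, rfl⟩, h2⟩
      exact Prod.ext (Fin.ext h1) (h2.trans (zoneSet_initLits A))
    · rintro rfl
      exact ⟨_, ⟨rfl, rfl⟩, (zoneSet_initLits A).symm⟩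

variable {A : PTA (Fin a) (Fin l) (Fin k)} {v : Val (Fin k)} {c : VarCode}
  {T : TPSState (Fin l) (Fin k)}

theorem valCode_length (v : Val (Fin k)) : (valCode v).length = k := by
  simp [valCode]

theorem lt_of_mem_newCodes {s : ℕ × List Lit} (hs : s ∈ newCodes (A.code, valCode v) c) :
    s.1 < l := by
  simp only [newCodes, List.mem_map, List.mem_filter, PTA.code, List.length_ofFn,
    decide_eq_true_eq] at hs
  obtain ⟨t, ⟨-, h⟩, rfl⟩ := hs
  exact h

theorem stateSet_newCodes (h : c.Represents T) :
    stateSet l k (newCodes (A.code, valCode v) c) = T.new := by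
  rw [← h.2.2.2]
  ext σ
  simp only [stateSet, symStates, newCodes, List.mem_map, List.mem_filter, PTA.code,
    List.length_ofFn, decide_eq_true_eq, Set.mem_ofPred_eq, Prod.mk.injEq]
  constructor
  · rintro ⟨_, ⟨t, ⟨ht, -⟩, h1, rfl⟩, h2⟩
    exact ⟨t.2, h1 ▸ ht, h2.trans (zoneSolutions_eq_zoneSet _).symm⟩
  · rintro ⟨z, hz, h2⟩
    exact ⟨_, ⟨_, ⟨hz, σ.1.2⟩, rfl, rfl⟩, h2.trans (zoneSolutions_eq_zoneSet _)⟩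

theorem conjTrue_elimHead_iff (Z : List Lit) :
    ConjTrue (valCode v) (elimHead Z) ↔ v ∈ (zoneSet k Z).proj := by
  rw [conjTrue_iff, conjHolds_elimHead_env]

theorem stateSet_compatibleCodes (h : c.Represents T) :
    stateSet l k (compatibleCodes (A.code, valCode v) c) = T.compatible v := by
  rw [TPSState.compatible, ← stateSet_newCodes (A := A) (v := v) h]
  ext σ
  simp only [stateSet, compatibleCodes, List.mem_filter, decide_eq_true_eq, conjTrue_elimHead_iff,
    Set.mem_ofPred_eq]
  constructor
  · rintro ⟨Z, ⟨h1, h2⟩, h3⟩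
    exact ⟨⟨Z, h1, h3⟩, h3 ▸ h2⟩
  · rintro ⟨⟨Z, h1, h3⟩, h2⟩
    exact ⟨Z, ⟨h1, h3 ▸ h2⟩, h3⟩

theorem stateSet_incompatibleCodes (h : c.Represents T) :
    stateSet l k (incompatibleCodes (A.code, valCode v) c) = T.new \ T.compatible v := by
  rw [TPSState.compatible, ← stateSet_newCodes (A := A) (v := v) h]
  ext σ
  simp only [stateSet, incompatibleCodes, List.mem_filter, decide_eq_true_eq,
    conjTrue_elimHead_iff, Set.mem_ofPred_eq, Set.mem_sdiff, not_and]
  constructor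
  · rintro ⟨Z, ⟨h1, h2⟩, h3⟩
    exact ⟨⟨Z, h1, h3⟩, fun _ => h3 ▸ h2⟩
  · rintro ⟨⟨Z, h1, h3⟩, h2⟩
    exact ⟨Z, ⟨h1, h3 ▸ h2 ⟨Z, h1, h3⟩⟩, h3⟩

/-- A code may list location numbers outside the automaton. They describe no symbolic state, and the
filter in `newCodes` removes them; otherwise they could keep the loop running although no new
symbolic state is compatible. -/
theorem compatibleCodes_eq_nil_iff (h : c.Represents T) :
    compatibleCodes (A.code, valCode v) c = [] ↔ T.compatible v = ∅ := by
  rw [← stateSet_compatibleCodes (A := A) h]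
  constructor
  · intro h0
    simp [h0, stateSet]
  · intro h0
    refine List.eq_nil_iff_forall_not_mem.2 fun s hs => ?_
    have hlt := lt_of_mem_newCodes (List.mem_of_mem_filter hs)
    exact Set.eq_empty_iff_forall_notMem.1 h0 (⟨s.1, hlt⟩, zoneSet k s.2) ⟨s.2, hs, rfl⟩

theorem dnfSet_goodCode (κ : RunKind) (h : c.Represents T) :
    dnfSet k (goodCode κ (A.code, valCode v) c) = (T.treat κ A v).good := by
  ext v'
  refine (dnfHolds_dnfAll _ _).trans ?_
  rw [List.forall_mem_cons, List.forall_mem_map]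
  simp only [TPSState.treat, Set.mem_inter_iff, Set.mem_iInter]
  refine and_congr ?_ ?_
  · rw [← h.1, solutions_eq_dnfSet]
    rfl
  · rw [← stateSet_compatibleCodes (A := A) h]
    constructor
    · rintro H ⟨m, Z'⟩ ⟨Z, hZ, rfl : Z' = _⟩
      rw [← dnfSet_contributionDnf]
      exact H _ hZ
    · rintro H ⟨n, Z⟩ hs
      have hlt : n < l := lt_of_mem_newCodes (List.mem_of_mem_filter hs)
      have := H (⟨n, hlt⟩, zoneSet k Z) ⟨Z, hs, rfl⟩
      rw [← dnfSet_contributionDnf] at this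
      exact this

theorem dnfSet_badCode (κ : RunKind) (h : c.Represents T) :
    dnfSet k (badCode (A.code, valCode v) c) = (T.treat κ A v).bad := by
  ext v'
  refine (dnfHolds_append _ _ _).trans ?_
  simp only [TPSState.treat, Set.mem_union, Set.mem_iUnion, exists_prop]
  refine or_congr ?_ ?_
  · rw [← h.2.1, solutions_eq_dnfSet]
    rfl
  · rw [← stateSet_incompatibleCodes (A := A) h]
    simp only [DnfHolds, List.mem_map]
    constructor
    · rintro ⟨_, ⟨⟨n, Z⟩, hs, rfl⟩, hv⟩
      have hlt : n < l := lt_of_mem_newCodes (List.mem_of_mem_filter hs)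
      exact ⟨(⟨n, hlt⟩, zoneSet k Z), ⟨Z, hs, rfl⟩, (conjHolds_elimHead_env v' Z).1 hv⟩
    · rintro ⟨⟨m, Z'⟩, ⟨Z, hZ, rfl : Z' = _⟩, hv⟩
      exact ⟨_, ⟨_, hZ, rfl⟩, (conjHolds_elimHead_env v' Z).2 hv⟩

theorem stateSet_succCodes (m : Fin l) (Z : List Lit) :
    stateSet l k (succCodes (A.code, valCode v) (m, Z)) = A.symSucc (m, zoneSet k Z) := by
  ext ⟨m', W⟩
  simp only [stateSet, succCodes, List.mem_filter, List.mem_map, decide_eq_true_eq,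
    Set.mem_ofPred_eq, valCode_length, ← zoneSet_nonempty_iff, PTA.symSucc, Prod.mk.injEq]
  constructor
  · rintro ⟨Z', ⟨⟨c, hc, h1, rfl⟩, hne⟩, rfl⟩
    obtain ⟨e, he, hm, rfl⟩ := (mem_outEdges A).1 hc
    exact ⟨e, he, hm, ⟨Fin.ext h1.symm, zoneSet_succLits A Z e⟩, hne⟩
  · rintro ⟨e, he, hm, ⟨rfl, rfl⟩, hne⟩
    have hz := zoneSet_succLits A Z e
    exact ⟨_, ⟨⟨e.code, (mem_outEdges A).2 ⟨e, he, hm, rfl⟩, rfl, rfl⟩, hz ▸ hne⟩, hz.symm⟩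

theorem symStates_append (S S' : List (ℕ × ZoneCode)) :
    symStates l k (S ++ S') = symStates l k S ∪ symStates l k S' := by
  ext σ
  simp [symStates, or_and_right, exists_or]

theorem sameState_iff (m : Fin l) (Z : List Lit) (S : List (ℕ × ZoneCode)) :
    (∃ t ∈ S, SameState k (m, Z) (t.1, decodeZone t.2)) ↔ (m, zoneSet k Z) ∈ symStates l k S := by
  simp only [SameState, zoneLe_iff, ← Set.Subset.antisymm_iff, ← zoneSolutions_eq_zoneSet]
  constructor
  · rintro ⟨⟨n, z⟩, ht, rfl : (m : ℕ) = n, h2⟩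
    exact ⟨z, ht, h2⟩
  · rintro ⟨z, hz, h⟩
    exact ⟨_, hz, rfl, h⟩

theorem stateSet_nextCodes (h : c.Represents T) :
    stateSet l k (nextCodes (A.code, valCode v) c) =
      (⋃ σ ∈ T.compatible v, A.symSucc σ) \ (T.met ∪ T.new) := by
  rw [← h.2.2.1, ← h.2.2.2, ← symStates_append, ← stateSet_compatibleCodes (A := A) h]
  ext ⟨m, W⟩
  simp only [Set.mem_sdiff, Set.mem_iUnion, exists_prop]
  constructor
  · rintro ⟨Z, hZ, rfl : W = _⟩
    simp only [nextCodes, List.mem_filter, List.mem_flatMap, decide_eq_true_eq,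
      valCode_length] at hZ
    obtain ⟨⟨⟨n, Z₀⟩, hs, hZ'⟩, hnew⟩ := hZ
    have hlt : n < l := lt_of_mem_newCodes (List.mem_of_mem_filter hs)
    refine ⟨⟨(⟨n, hlt⟩, zoneSet k Z₀), ⟨Z₀, hs, rfl⟩, ?_⟩, ?_⟩
    · rw [← stateSet_succCodes (v := v)]
      exact ⟨Z, hZ', rfl⟩
    · rw [← sameState_iff]
      push Not
      exact hnew
  · rintro ⟨⟨⟨m₀, W₀⟩, ⟨Z₀, hs, rfl : W₀ = _⟩, hsucc⟩, hnew⟩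
    rw [← stateSet_succCodes (v := v)] at hsucc
    obtain ⟨Z, hZ, rfl : W = _⟩ := hsucc
    refine ⟨Z, ?_, rfl⟩
    simp only [nextCodes, List.mem_filter, List.mem_flatMap, decide_eq_true_eq, valCode_length]
    refine ⟨⟨_, hs, hZ⟩, ?_⟩
    rw [← sameState_iff] at hnew
    push Not at hnew
    exact hnew

end Semantics

/-! ### Effectivity of the algorithm and computation of the returned constraint. -/

theorem effective (κ : RunKind) : Effective κ := by
  refine ⟨fun i => Part.some (startCode κ i), fun p => Part.some (iterationCode κ p.1 p.2),
    (primrec_startCode κ).to_comp.partrec,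
    (primrec_iterationCode κ Primrec.fst Primrec.snd).to_comp.partrec, fun a l k A v => ⟨?_, ?_⟩⟩
  · exact ⟨_, Part.mem_some _, represents_startCode κ A v⟩
  · intro c T h
    refine ⟨fun hT => ?_, fun hT => ?_⟩
    · rw [← compatibleCodes_eq_nil_iff (A := A) h] at hT
      refine ⟨encodeParam (dnfAnd (goodCode κ (A.code, valCode v) c)
        (dnfNot (badCode (A.code, valCode v) c))), ?_, ?_⟩
      · simp only [iterationCode, if_pos hT]
        exact Part.mem_some _
      · rw [solutions_encodeParam, ← dnfSet_goodCode κ h, ← dnfSet_badCode κ h]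
        ext v'
        refine (dnfHolds_dnfAnd _ _ _).trans (and_congr_right fun _ => ?_)
        exact dnfHolds_dnfNot _ _
    · rw [Ne, ← compatibleCodes_eq_nil_iff (A := A) h] at hT
      refine ⟨_, by simp only [iterationCode, if_neg hT]; exact Part.mem_some _, ?_⟩
      refine ⟨(solutions_encodeParam _).trans (dnfSet_goodCode κ h),
        (solutions_encodeParam _).trans (dnfSet_badCode κ h), ?_,
        (symStates_encode _).trans (stateSet_nextCodes h)⟩
      change symStates l k (c.2.2.1 ++ c.2.2.2) = T.met ∪ T.new
      rw [symStates_append, h.2.2.1, h.2.2.2]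

/-- The while loop is the fixed point of one iteration, with the input carried along. Its
termination is not claimed here; it comes from a derivation of `Returns`. -/
theorem partrec_iterate {α β γ : Type*} [Primcodable α] [Primcodable β] [Primcodable γ]
    {next : α × β →. γ ⊕ β} (hnext : Partrec next) :
    Partrec (PFun.fix fun p => (next p).map fun r => Sum.map id (fun c => (p.1, c)) r) := by
  refine Partrec.fix (hnext.map ?_)
  exact (Computable.sumCasesOn Computable.snd (Computable.sumInl.comp Computable.snd).to₂
    (Computable.sumInr.comp (Computable.pair (Computable.fst.comp (Computable.fst.comp
      Computable.fst)) Computable.snd)).to₂).of_eq fun p => by rcases p with ⟨p, r | r⟩ <;> rfl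

/-- A procedure that can be executed on codes computes a code of the constraint returned. -/
theorem Effective.exists_partrec {κ : RunKind} (h : Effective κ) :
    ∃ f : PTACode × ValCode →. ParamConstraintCode, Partrec f ∧
      ∀ (a l k : ℕ) (A : PTA (Fin a) (Fin l) (Fin k)) (v : Val (Fin k)) (K : Set (Val (Fin k)))
        (t : ℕ∞), TPS κ A v K t →
        ∃ F ∈ f (A.code, valCode v), ParamConstraintCode.solutions k F = K := by
  obtain ⟨first, next, hfirst, hnext, hspec⟩ := h
  let loop : (PTACode × ValCode) × VarCode →.
      ParamConstraintCode ⊕ ((PTACode × ValCode) × VarCode) :=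
    fun p => (next p).map fun r => Sum.map id (fun c => (p.1, c)) r
  refine ⟨fun i => (first i).bind fun c => PFun.fix loop (i, c), hfirst.bind
    ((partrec_iterate hnext).comp Computable.id).to₂, fun a l k A v K t hK => ?_⟩
  obtain ⟨c₀, hc₀, hrep⟩ := (hspec a l k A v).1
  -- Induction on the execution of the loop. The code is quantified inside, since the variables have
  -- many codes and each iteration produces another one.
  have key : ∀ (T : TPSState (Fin l) (Fin k)) (K : Set (Val (Fin k))) (t : ℕ∞),
      TPSState.Returns κ A v T K t → ∀ c : VarCode, c.Represents T →
      ∃ F ∈ PFun.fix loop ((A.code, valCode v), c), ParamConstraintCode.solutions k F = K := by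
    intro T K t hT
    induction hT with
    | exit h0 =>
      intro c hc
      obtain ⟨F, hF, hsol⟩ := ((hspec a l k A v).2 c _ hc).1 h0
      exact ⟨F, PFun.fix_stop (Part.mem_map_iff _ |>.2 ⟨_, hF, rfl⟩), hsol⟩
    | loop h0 _ ih =>
      intro c hc
      obtain ⟨c', hc', hrep'⟩ := ((hspec a l k A v).2 c _ hc).2 h0
      obtain ⟨F, hF, hsol⟩ := ih c' hrep'
      have hmem : Sum.inr ((A.code, valCode v), c') ∈ loop ((A.code, valCode v), c) :=
        (Part.mem_map_iff _).2 ⟨_, hc', rfl⟩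
      exact ⟨F, PFun.fix_fwd_eq hmem ▸ hF, hsol⟩
  obtain ⟨F, hF, hsol⟩ := key _ K t hK c₀ hrep
  exact ⟨F, Part.mem_bind hc₀ hF, hsol⟩

end OneClock

theorem mainTheorem8 :
    (∃ C : ℕ, ∀ (κ : OneClock.RunKind) (Act Loc Par : Type) [Finite Act] [Finite Loc]
        [Fintype Par] (A : OneClock.PTA Act Loc Par) (v : OneClock.Val Par), A.Deterministic →
      ∃ (K : Set (OneClock.Val Par)) (t : ℕ∞), OneClock.TPS κ A v K t ∧
        t ≤ ((C * (Nat.card Loc * 2 ^ (A.linTerms.ncard * (A.linTerms.ncard + 1))) : ℕ) : ℕ∞) ∧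
        K = {v' | A.traces v' κ = A.traces v κ} ∧
        K = {v' | A.language v' κ = A.language v κ}) ∧
    (∀ κ : OneClock.RunKind,
      OneClock.Effective κ ∧
      ∃ f : OneClock.PTACode × OneClock.ValCode →. OneClock.ParamConstraintCode, Partrec f ∧
        ∀ (a l k : ℕ) (A : OneClock.PTA (Fin a) (Fin l) (Fin k)) (v : OneClock.Val (Fin k)),
          A.Deterministic →
          ∃ F ∈ f (A.code, OneClock.valCode v),
            OneClock.ParamConstraintCode.solutions k F =
              {v' | A.traces v' κ = A.traces v κ} ∧
            OneClock.ParamConstraintCode.solutions k F =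
              {v' | A.language v' κ = A.language v κ}) := by
  obtain ⟨C, hC⟩ := OneClock.exists_TPS_time
  refine ⟨⟨C, fun κ Act Loc Par _ _ _ A v hA => ?_⟩, fun κ => ⟨OneClock.effective κ, ?_⟩⟩
  · obtain ⟨t, ht, hle⟩ := hC κ Act Loc Par A v
    exact ⟨_, t, ht, hle, OneClock.PTA.outcome_eq_traces hA κ v,
      OneClock.PTA.outcome_eq_language hA κ v⟩
  · obtain ⟨f, hf, hspec⟩ := (OneClock.effective κ).exists_partrec
    refine ⟨f, hf, fun a l k A v hA => ?_⟩
    -- The terminating execution behind the time bound is what makes `f` defined at this input.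
    obtain ⟨t, ht, -⟩ := hC κ _ _ _ A v
    obtain ⟨F, hF, hsol⟩ := hspec a l k A v _ t ht
    exact ⟨F, hF, hsol.trans (OneClock.PTA.outcome_eq_traces hA κ v),
      hsol.trans (OneClock.PTA.outcome_eq_language hA κ v)⟩
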